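/- **Conventions.** All categories below have finite products, used as the monoidal structure. For a category $V$, a *$V$-graph* $A$ is a set $A_0$ of objects with an object $A(a,a')\in V$ for all $a,a'\in A_0$; morphisms are functions on objects with morphisms $A(a,a')\to B(Fa,Fa')$. This gives a category $V\text{-}\mathbf{Gph}$. A functor (resp. monad) $T$ on $V$ induces a functor (resp. monad) $T_*$ on $V\text{-}\mathbf{Gph}$, the identity on objects and $T$ on hom-objects. Put $0\text{-}\mathbf{Gph}=\mathbf{Set}$ and $n\text{-}\mathbf{Gph}=((n-1)\text{-}\mathbf{Gph})\text{-}\mathbf{Gph}$; this category is equivalent to, and is identified with, the category $n\text{-}\mathbf{GSet}$ of $n$-dimensional globular sets. An *operad* $P$ in $V$ consists of objects $P(k)\in V$ ($k\ge 0$), a unit $1\to P(1)$ and compositions $P(n)\times P(k_1)\times\dots\times P(k_n)\to P(k_1+\dots+k_n)$ satisfying the unit and associativity laws (no symmetric group actions). A *$(V,P)$-category* is a $V$-graph $A$ with maps $\gamma:P(k)\times A(a_{k-1},a_k)\times\dots\times A(a_0,a_1)\to A(a_0,a_k)$ for all $k\ge0$ and $a_0,\dots,a_k\in A_0$, compatible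 with the unit and composition of $P$; morphisms are graph morphisms commuting with the $\gamma$'s. These form a category $(V,P)\text{-}\mathbf{Cat}$ with componentwise products. When products in $V$ distribute over small coproducts, the *free $(V,P)$-category monad* $\mathbf{fc}_{(V,P)}$ on $V\text{-}\mathbf{Gph}$ is the identity on objects, with $$\mathbf{fc}_{(V,P)}(A)(a,a')=\coprod_{k\ge0,\;a=a_0,\dots,a_k=a'}P(k)\times A(a_{k-1},a_k)\times\dots\times A(a_0,a_1),$$ unit given by the operad unit (chains of length one) and multiplication by concatenating chains and composing in $P$. **Iterative operadic theory.** Put $\mathcal V_0=\mathbf{Set}$, where a set is *contractible* if it is terminal. Let $P_0,P_1,\dots$ be such that each $P_m$ is an operad in $\mathcal V_m$ all of whose objects $P_m(k)$ are contractible, where $\mathcal V_{m+1}=(\mathcal V_m,P_m)\text{-}\mathbf{Cat}$, and $A\in\mathcal V_{m+1}$ is contractible if $A_0\ne\emptyset$ and all $A(a,a')$ are contractible. There are product-preserving forgetful functors $U_m:\mathcal V_m\to m\text{-}\mathbf{Gph}$ with $U_0=\mathrm{id}$ and $U_{m+1}$ the composite of $\mathcal V_{m+1}\to\mathcal V_m\text{-}\mathbf{Gph}$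 with $(U_m)_*$. For $0\le i<n$ let $$Q^{(n)}_i=\big(\mathbf{fc}_{((n-i-1)\text{-}\mathbf{Gph},\;U_{n-i-1}P_{n-i-1})}\big)_{*\cdots*}\qquad(i\text{ stars}),$$ a monad on $n\text{-}\mathbf{Gph}$ (only $P_0,\dots,P_{n-1}$ are involved). It acts on the underlying $n$-graph $U_nA$ of each $A\in\mathcal V_n$: by the composition maps $\gamma$ of $A$ if $i=0$, and by the action of $Q^{(n-1)}_{i-1}$ on every hom-object if $i>0$. **Parametrised interchange.** Let $T$ be a coproduct-preserving monad on $V$ and $P$ an operad in the category of $T$-algebras, that is, an operad $P$ in $V$ with $T$-actions $\alpha_k:TP(k)\to P(k)$ for which the unit and compositions of $P$ are algebra maps. The *parametrised interchange law* $T_*\,\mathbf{fc}_{(V,P)}\Rightarrow\mathbf{fc}_{(V,P)}\,T_*$ is the identity on objects, and on the summand of $a_0,\dots,a_k$ it is the map $$T\big(P(k)\times A(a_{k-1},a_k)\times\dots\times A(a_0,a_1)\big)\longrightarrow P(k)\times TA(a_{k-1},a_k)\times\dots\times TA(a_0,a_1)$$ with components $\alpha_k\circ T(\mathrm{pr})$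 and $T(\mathrm{pr})$, followed by the coproduct inclusion. **Theorem.** Let $n\ge3$, and let $P_0,\dots,P_{n-1}$ be the first $n$ operads of an iterative operadic theory as above. Then the monads $Q^{(n)}_0,\dots,Q^{(n)}_{n-1}$ on $n\text{-}\mathbf{Gph}\simeq n\text{-}\mathbf{GSet}$ form a distributive series of monads: there are distributive laws $$\lambda_{ij}:Q^{(n)}_iQ^{(n)}_j\Rightarrow Q^{(n)}_jQ^{(n)}_i\qquad(n>i>j\ge0)$$ satisfying, for all $i>j>k$, the Yang–Baxter equation $$(\lambda_{jk}Q_i)\circ(Q_j\lambda_{ik})\circ(\lambda_{ij}Q_k)=(Q_k\lambda_{ij})\circ(\lambda_{ik}Q_j)\circ(Q_i\lambda_{jk}):\;Q_iQ_jQ_k\Rightarrow Q_kQ_jQ_i .$$ Moreover these laws are instances of the parametrised interchange law: for $m=n-j-1$, $\lambda_{ij}$ is obtained by applying $(-)_*$ $j$ times to the parametrised interchange law for $V=m\text{-}\mathbf{Gph}$, the monad $T=Q^{(m)}_{i-j-1}$ (which preserves coproducts), and the operad $U_mP_m$ with the actions of $T$ on the objects $U_mP_m(k)$ (which make it an operad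 in $T$-algebras). -/

import Mathlib

set_option linter.unusedSectionVars false
set_option linter.unusedVariables false
universe u

open CategoryTheory CategoryTheory.Limits MonoidalCategory CartesianMonoidalCategory

noncomputable section

namespace IterOp

/-! ### Graphs enriched in a category -/

/-- A `V`-graph: a set of objects and, for every pair of objects, a hom-object in `V`. -/
structure VGraph (V : Type (u + 1)) : Type (u + 1) where
  obj : Type u
  hom : obj → obj → V

namespace VGraph

variable {V : Type (u + 1)} [Category.{u} V] {W : Type (u + 1)} [Category.{u} W]

/-- A morphism of `V`-graphs. -/
structure Hom (A B : VGraph V) : Type u where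
  obj : A.obj → B.obj
  hom : ∀ a b, A.hom a b ⟶ B.hom (obj a) (obj b)

instance : Category.{u} (VGraph V) where
  Hom A B := Hom A B
  id A := { obj := fun a => a, hom := fun a b => 𝟙 (A.hom a b) }
  comp F G :=
    { obj := fun a => G.obj (F.obj a)
      hom := fun a b => F.hom a b ≫ G.hom (F.obj a) (F.obj b) }
  id_comp F := by
    show Hom.mk _ _ = _
    cases F; simp
  comp_id F := by
    show Hom.mk _ _ = _
    cases F; simp
  assoc F G H := by
    show Hom.mk _ _ = Hom.mk _ _
    simp

theorem hom_mk_congr {A B : VGraph V} {o : A.obj → B.obj}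
    {h h' : ∀ a b, A.hom a b ⟶ B.hom (o a) (o b)} (e : ∀ a b, h a b = h' a b) :
    (Hom.mk o h : A ⟶ B) = Hom.mk o h' := by
  have : h = h' := by funext a b; exact e a b
  rw [this]

@[simp] theorem id_obj (A : VGraph V) (a : A.obj) : Hom.obj (𝟙 A) a = a := rfl
@[simp] theorem id_hom (A : VGraph V) (a b : A.obj) : Hom.hom (𝟙 A) a b = 𝟙 _ := rfl
@[simp] theorem comp_obj {A B C : VGraph V} (F : A ⟶ B) (G : B ⟶ C) (a : A.obj) :
    Hom.obj (F ≫ G) a = Hom.obj G (Hom.obj F a) := rfl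
@[simp] theorem comp_hom {A B C : VGraph V} (F : A ⟶ B) (G : B ⟶ C) (a b : A.obj) :
    Hom.hom (F ≫ G) a b = Hom.hom F a b ≫ Hom.hom G _ _ := rfl

/-- The functor `F_* : V-Gph ⥤ W-Gph`: the identity on objects and `F` on hom-objects. -/
def star (F : V ⥤ W) : VGraph V ⥤ VGraph W where
  obj A := { obj := A.obj, hom := fun a b => F.obj (A.hom a b) }
  map f := { obj := f.obj, hom := fun a b => F.map (f.hom a b) }
  map_id A := hom_mk_congr fun a b => F.map_id _
  map_comp f g := hom_mk_congr fun a b => F.map_comp _ _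

/-- The monad `T_*` on `V`-graphs: the identity on objects and `T` on hom-objects. -/
def starMonad (T : Monad V) : Monad (VGraph V) where
  toFunctor := star T.toFunctor
  η :=
    { app := fun A => { obj := fun a => a, hom := fun a b => T.η.app (A.hom a b) }
      naturality := fun _ _ f => hom_mk_congr fun a b => T.η.naturality (Hom.hom f a b) }
  μ :=
    { app := fun A => { obj := fun a => a, hom := fun a b => T.μ.app (A.hom a b) }
      naturality := fun _ _ f => hom_mk_congr fun a b => T.μ.naturality (Hom.hom f a b) }
  assoc A := hom_mk_congr fun a b => T.assoc (A.hom a b)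
  left_unit A := hom_mk_congr fun a b => T.left_unit (A.hom a b)
  right_unit A := hom_mk_congr fun a b => T.right_unit (A.hom a b)

/-! Products of graphs are formed componentwise. -/

section Products

variable [CartesianMonoidalCategory V] [CartesianMonoidalCategory W]

/-- The terminal graph. -/
def terminal : VGraph V := { obj := PUnit, hom := fun _ _ => 𝟙_ V }

/-- The product of two graphs. -/
def prod (A B : VGraph V) : VGraph V :=
  { obj := A.obj × B.obj, hom := fun x y => A.hom x.1 y.1 ⊗ B.hom x.2 y.2 }

def prodFst (A B : VGraph V) : prod A B ⟶ A :=
  { obj := fun x => x.1, hom := fun _ _ => fst _ _ }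

def prodSnd (A B : VGraph V) : prod A B ⟶ B :=
  { obj := fun x => x.2, hom := fun _ _ => snd _ _ }

def prodLift {X A B : VGraph V} (F : X ⟶ A) (G : X ⟶ B) : X ⟶ prod A B :=
  { obj := fun x => (Hom.obj F x, Hom.obj G x),
    hom := fun a b => lift (Hom.hom F a b) (Hom.hom G a b) }

instance cartesian : CartesianMonoidalCategory (VGraph V) :=
  CartesianMonoidalCategory.ofChosenFiniteProducts
    { cone := asEmptyCone (terminal : VGraph V)
      isLimit := IsTerminal.ofUniqueHom
        (fun _ => { obj := fun _ => PUnit.unit, hom := fun _ _ => toUnit _ })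
        (fun _ m => hom_mk_congr fun _ _ => toUnit_unique _ _) }
    (fun A B =>
      { cone := BinaryFan.mk (prodFst A B) (prodSnd A B)
        isLimit := BinaryFan.isLimitMk (fun s => prodLift s.fst s.snd)
          (fun s => by
            refine (hom_mk_congr (h := fun a b => _) fun a b => ?_)
            exact lift_fst _ _)
          (fun s => by
            refine (hom_mk_congr (h := fun a b => _) fun a b => ?_)
            exact lift_snd _ _)
          (fun s m h₁ h₂ => by
            have e₁ : m ≫ prodFst A B = s.fst := h₁
            have e₂ : m ≫ prodSnd A B = s.snd := h₂
            rw [← e₁, ← e₂]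
            refine (hom_mk_congr (h := fun a b => _) fun a b => ?_)
            exact (lift_comp_fst_snd _).symm) })

end Products

end VGraph

/-! ### Categories in which small coproducts commute with finite products -/

/-- The category `V`, with its chosen finite products, has small coproducts, and
`X × -` preserves them. -/
class CoprodDistrib (V : Type (u + 1)) [Category.{u} V] [CartesianMonoidalCategory V] : Prop where
  hasCoproducts : ∀ ι : Type u, HasColimitsOfShape (Discrete ι) V
  preserves : ∀ (X : V) (ι : Type u), PreservesColimitsOfShape (Discrete ι) (tensorLeft X)

attribute [instance] CoprodDistrib.hasCoproducts CoprodDistrib.preserves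

instance : CoprodDistrib (Type u) where
  hasCoproducts _ := inferInstance
  preserves _ _ := inferInstance

section Distrib

variable {V : Type (u + 1)} [Category.{u} V] [CartesianMonoidalCategory V] [CoprodDistrib V]

/-- The cocone of the coproduct, multiplied by `X`, is again a coproduct cocone. -/
def isColimitTensor {ι : Type u} (X : V) (Y : ι → V) :
    IsColimit (Cofan.mk (X ⊗ (∐ Y)) (fun i => X ◁ Sigma.ι Y i)) :=
  isColimitMapCoconeCofanMkEquiv (tensorLeft X) Y (fun i => Sigma.ι Y i)
    (isColimitOfPreserves (tensorLeft X) (coproductIsCoproduct Y))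

def tensorDesc {ι : Type u} {X Z : V} {Y : ι → V} (φ : ∀ i, X ⊗ Y i ⟶ Z) : X ⊗ (∐ Y) ⟶ Z :=
  (isColimitTensor X Y).desc (Cofan.mk Z φ)

theorem ι_tensorDesc {ι : Type u} {X Z : V} {Y : ι → V} (φ : ∀ i, X ⊗ Y i ⟶ Z) (i : ι) :
    X ◁ Sigma.ι Y i ≫ tensorDesc φ = φ i :=
  (isColimitTensor X Y).fac (Cofan.mk Z φ) ⟨i⟩

theorem tensor_hom_ext {ι : Type u} {X Z : V} {Y : ι → V} {f g : X ⊗ (∐ Y) ⟶ Z}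
    (h : ∀ i, X ◁ Sigma.ι Y i ≫ f = X ◁ Sigma.ι Y i ≫ g) : f = g :=
  Cofan.IsColimit.hom_ext (isColimitTensor X Y) _ _ h

end Distrib

namespace VGraph

variable {V : Type (u + 1)} [Category.{u} V] [CartesianMonoidalCategory V]

theorem whiskerLeft_obj (X : VGraph V) {A B : VGraph V} (F : A ⟶ B) (x : (X ⊗ A).obj) :
    Hom.obj (X ◁ F) x = ((x.1, Hom.obj F x.2) : X.obj × B.obj) := rfl

theorem whiskerLeft_hom (X : VGraph V) {A B : VGraph V} (F : A ⟶ B) (x y : (X ⊗ A).obj) :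
    Hom.hom (X ◁ F) x y = X.hom x.1 y.1 ◁ Hom.hom F x.2 y.2 := by
  refine CartesianMonoidalCategory.hom_ext _ _ (Eq.trans ?_ (whiskerLeft_fst _ _).symm)
    (Eq.trans ?_ (whiskerLeft_snd _ _).symm)
  · exact (lift_fst _ _).trans (Category.comp_id _)
  · exact lift_snd _ _

variable [CoprodDistrib V]

/-- The disjoint union of a family of graphs. The hom-object from `(i, a)` to `(j, b)` is that of
the `j`-th graph if `i = j`, and initial (an empty coproduct) otherwise. -/
def sigma {ι : Type u} (A : ι → VGraph V) : VGraph V :=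
  { obj := Σ i, (A i).obj
    hom := fun x y => ∐ fun h : ULift.{u} (PLift (x.1 = y.1)) =>
      (A y.1).hom (h.down.down ▸ x.2) y.2 }

def sigmaInj {ι : Type u} (A : ι → VGraph V) (i : ι) : A i ⟶ sigma A :=
  { obj := fun a => ⟨i, a⟩
    hom := fun a b => Sigma.ι (fun h : ULift.{u} (PLift (i = i)) =>
      (A i).hom (h.down.down ▸ a) b) ⟨⟨rfl⟩⟩ }

/-- The map out of `X × ∐ A` induced by maps out of all the `X × A i`. -/
def sigmaDesc {ι : Type u} (X : VGraph V) (A : ι → VGraph V) {Z : VGraph V}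
    (φ : ∀ i, X ⊗ A i ⟶ Z) : X ⊗ sigma A ⟶ Z :=
  { obj := fun x => Hom.obj (φ x.2.1) (x.1, x.2.2)
    hom := fun x y => tensorDesc (X := X.hom x.1 y.1) (fun h => by
      obtain ⟨x₀, i, a⟩ := x
      obtain ⟨y₀, j, b⟩ := y
      obtain ⟨⟨h⟩⟩ := h
      dsimp only at h
      subst h
      exact Hom.hom (φ i) (x₀, a) (y₀, b)) }

theorem sigmaInj_sigmaDesc {ι : Type u} (X : VGraph V) (A : ι → VGraph V) {Z : VGraph V}
    (φ : ∀ i, X ⊗ A i ⟶ Z) (i : ι) : X ◁ sigmaInj A i ≫ sigmaDesc X A φ = φ i := by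
  refine hom_mk_congr (h := fun a b => _) fun a b => ?_
  have e := whiskerLeft_hom X (sigmaInj A i) a b
  refine (congrArg (· ≫ Hom.hom (sigmaDesc X A φ) _ _) e).trans ?_
  exact ι_tensorDesc _ _

theorem sigma_tensor_hom_ext {ι : Type u} (X : VGraph V) (A : ι → VGraph V) {Z : VGraph V}
    {f g : X ⊗ sigma A ⟶ Z} (h : ∀ i, X ◁ sigmaInj A i ≫ f = X ◁ sigmaInj A i ≫ g) :
    f = g := by
  obtain ⟨fo, fh⟩ := f
  obtain ⟨go, gh⟩ := g
  have ho : fo = go := by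
    funext x
    obtain ⟨x, i, a⟩ := x
    exact congrArg (fun F => Hom.obj F (x, a)) (h i)
  subst ho
  refine hom_mk_congr fun x y => ?_
  obtain ⟨x₀, i, a⟩ := x
  obtain ⟨y₀, j, b⟩ := y
  refine tensor_hom_ext (X := X.hom x₀ y₀) fun k => ?_
  obtain ⟨⟨k⟩⟩ := k
  dsimp only at k
  subst k
  have e : HEq (Hom.hom (X ◁ sigmaInj A i ≫ (Hom.mk fo fh : X ⊗ sigma A ⟶ Z)) (x₀, a) (y₀, b))
      (Hom.hom (X ◁ sigmaInj A i ≫ (Hom.mk fo gh : X ⊗ sigma A ⟶ Z)) (x₀, a) (y₀, b)) := by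
    rw [h i]
  have e' := eq_of_heq e
  have w := whiskerLeft_hom X (sigmaInj A i) (x₀, a) (y₀, b)
  refine (congrArg (· ≫ fh (x₀, ⟨i, a⟩) (y₀, ⟨i, b⟩)) w).symm.trans ?_
  refine Eq.trans ?_ (congrArg (· ≫ gh (x₀, ⟨i, a⟩) (y₀, ⟨i, b⟩)) w)
  exact e'

def sigmaTensorIsColimit {ι : Type u} (X : VGraph V) (A : ι → VGraph V) :
    IsColimit (Cofan.mk (X ⊗ sigma A) (fun i => X ◁ sigmaInj A i)) :=
  Cofan.IsColimit.mk _ (fun s => sigmaDesc X A s.inj)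
    (fun s i => sigmaInj_sigmaDesc X A s.inj i)
    (fun s m hm => sigma_tensor_hom_ext X A fun i =>
      (hm i).trans (sigmaInj_sigmaDesc X A s.inj i).symm)

def sigmaDesc₁ {ι : Type u} (A : ι → VGraph V) {Z : VGraph V} (φ : ∀ i, A i ⟶ Z) :
    sigma A ⟶ Z :=
  (λ_ (sigma A)).inv ≫ sigmaDesc (𝟙_ _) A (fun i => (λ_ (A i)).hom ≫ φ i)

theorem sigmaInj_sigmaDesc₁ {ι : Type u} (A : ι → VGraph V) {Z : VGraph V}
    (φ : ∀ i, A i ⟶ Z) (i : ι) : sigmaInj A i ≫ sigmaDesc₁ A φ = φ i := by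
  rw [sigmaDesc₁, leftUnitor_inv_naturality_assoc, sigmaInj_sigmaDesc, Iso.inv_hom_id_assoc]

theorem sigma_hom_ext {ι : Type u} (A : ι → VGraph V) {Z : VGraph V} {f g : sigma A ⟶ Z}
    (h : ∀ i, sigmaInj A i ≫ f = sigmaInj A i ≫ g) : f = g := by
  rw [← cancel_epi (λ_ (sigma A)).hom]
  refine sigma_tensor_hom_ext _ A fun i => ?_
  rw [leftUnitor_naturality_assoc, leftUnitor_naturality_assoc, h]

def sigmaIsColimit {ι : Type u} (A : ι → VGraph V) :
    IsColimit (Cofan.mk (sigma A) (sigmaInj A)) :=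
  Cofan.IsColimit.mk _ (fun s => sigmaDesc₁ A s.inj)
    (fun s i => sigmaInj_sigmaDesc₁ A s.inj i)
    (fun s m hm => sigma_hom_ext A fun i => (hm i).trans (sigmaInj_sigmaDesc₁ A s.inj i).symm)

instance : CoprodDistrib (VGraph V) where
  hasCoproducts ι :=
    { has_colimit := fun F => by
        have : HasColimit (Discrete.functor (F.obj ∘ Discrete.mk)) :=
          ⟨⟨⟨_, sigmaIsColimit (F.obj ∘ Discrete.mk)⟩⟩⟩
        exact hasColimit_of_iso Discrete.natIsoFunctor }
  preserves X ι := by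
    refine @preservesColimitsOfShape_of_discrete _ _ _ _ _ _ (fun A => ?_)
    exact preservesColimit_of_preserves_colimit_cocone (sigmaIsColimit A)
      ((isColimitMapCoconeCofanMkEquiv (tensorLeft X) A (sigmaInj A)).symm
        (sigmaTensorIsColimit X A))

end VGraph

/-! ### Operads -/

/-- A finite sequence `(k_1, …, k_n)` of natural numbers. -/
inductive Ar : ℕ → Type
  | nil : Ar 0
  | snoc {n : ℕ} (L : Ar n) (k : ℕ) : Ar (n + 1)

namespace Ar

/-- `k_1 + ⋯ + k_n`. -/
def sum : {n : ℕ} → Ar n → ℕ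
  | _, nil => 0
  | _, snoc L k => sum L + k

def append {n : ℕ} (L : Ar n) : {m : ℕ} → Ar m → Ar (n + m)
  | _, nil => L
  | _, snoc K k => (append L K).snoc k

theorem sum_append {n : ℕ} (L : Ar n) : {m : ℕ} → (K : Ar m) →
    (L.append K).sum = L.sum + K.sum
  | _, nil => rfl
  | _, snoc K k => by
      show (L.append K).sum + k = L.sum + (K.sum + k)
      rw [sum_append L K, Nat.add_assoc]

/-- The sequence `(1, …, 1)`. -/
def ones : (n : ℕ) → Ar n
  | 0 => nil
  | n + 1 => (ones n).snoc 1

theorem sum_ones : (n : ℕ) → (ones n).sum = n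
  | 0 => rfl
  | n + 1 => by
      show (ones n).sum + 1 = n + 1
      rw [sum_ones n]

end Ar

/-- For a sequence `L = (k_1, …, k_n)`, a family of sequences of lengths `k_1, …, k_n`. -/
inductive NAr : {n : ℕ} → Ar n → Type
  | nil : NAr Ar.nil
  | snoc {n k : ℕ} {L : Ar n} (M : NAr L) (K : Ar k) : NAr (L.snoc k)

namespace NAr

/-- The concatenation of all the sequences of the family. -/
def flatten : {n : ℕ} → {L : Ar n} → NAr L → Ar L.sum
  | _, _, nil => Ar.nil
  | _, _, snoc M K => (flatten M).append K

/-- The sequence of the sums of the sequences of the family. -/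
def sums : {n : ℕ} → {L : Ar n} → NAr L → Ar n
  | _, _, nil => Ar.nil
  | _, _, snoc M K => (sums M).snoc K.sum

theorem sum_flatten : {n : ℕ} → {L : Ar n} → (M : NAr L) → M.flatten.sum = M.sums.sum
  | _, _, nil => rfl
  | _, _, snoc M K => by
      show (M.flatten.append K).sum = M.sums.sum + K.sum
      rw [Ar.sum_append, sum_flatten M]

end NAr

section Tens

variable {V : Type (u + 1)} [Category.{u} V] [CartesianMonoidalCategory V] (P : ℕ → V)

/-- `P(k_1) × ⋯ × P(k_n)`. -/
def tens : {n : ℕ} → Ar n → V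
  | _, Ar.nil => 𝟙_ V
  | _, Ar.snoc L k => tens L ⊗ P k

/-- The isomorphism between `P(k)` and the product over the sequence `(k)`. -/
def tensOne (k : ℕ) : P k ⟶ tens P (Ar.nil.snoc k) :=
  lift (toUnit (P k) : P k ⟶ 𝟙_ V) (𝟙 (P k))

def tensJoin {n : ℕ} (L : Ar n) : {m : ℕ} → (K : Ar m) → (tens P L ⊗ tens P K ⟶ tens P (L.append K))
  | _, Ar.nil => fst _ _
  | _, Ar.snoc K k => lift (lift (fst _ _) (snd _ _ ≫ fst _ _) ≫ tensJoin L K) (snd _ _ ≫ snd _ _)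

/-- The product over `i` of `P(k_i) × P(k_{i1}) × ⋯ × P(k_{i k_i})`. -/
def nestTens : {n : ℕ} → {L : Ar n} → NAr L → V
  | _, _, NAr.nil => 𝟙_ V
  | _, _, @NAr.snoc _ k _ M K => nestTens M ⊗ (P k ⊗ tens P K)

/-- The projection to `P(k_1) × ⋯ × P(k_n)`. -/
def nestLabels : {n : ℕ} → {L : Ar n} → (M : NAr L) → (nestTens P M ⟶ tens P L)
  | _, _, NAr.nil => 𝟙 _
  | _, _, NAr.snoc M K => nestLabels M ⊗ₘ fst _ _

/-- The projection to the product of all the `P(k_{ij})`. -/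
def nestFlat : {n : ℕ} → {L : Ar n} → (M : NAr L) → (nestTens P M ⟶ tens P M.flatten)
  | _, _, NAr.nil => 𝟙 _
  | _, _, NAr.snoc M K => (nestFlat M ⊗ₘ snd _ _) ≫ tensJoin P M.flatten K

/-- The product of given maps `P(k_i) × P(k_{i1}) × ⋯ × P(k_{i k_i}) ⟶ P(k_{i1} + ⋯ + k_{i k_i})`. -/
def nestComp (comp : ∀ {n : ℕ} (L : Ar n), P n ⊗ tens P L ⟶ P L.sum) :
    {n : ℕ} → {L : Ar n} → (M : NAr L) → (nestTens P M ⟶ tens P M.sums)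
  | _, _, NAr.nil => 𝟙 _
  | _, _, NAr.snoc M K => nestComp comp M ⊗ₘ comp K

/-- The element of `P(1) × ⋯ × P(1)` all of whose components are the unit. -/
def tensUnits (unit : 𝟙_ V ⟶ P 1) : (n : ℕ) → (𝟙_ V ⟶ tens P (Ar.ones n))
  | 0 => 𝟙 _
  | n + 1 => lift (tensUnits unit n) unit

end Tens

/-- A (classical, non-symmetric) operad in a category with finite products: objects `P(k)`, a unit
`1 ⟶ P(1)` and compositions `P(n) × P(k_1) × ⋯ × P(k_n) ⟶ P(k_1 + ⋯ + k_n)`, subject to the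
unit and associativity laws. -/
structure Operad (V : Type (u + 1)) [Category.{u} V] [CartesianMonoidalCategory V] :
    Type (u + 1) where
  P : ℕ → V
  unit : 𝟙_ V ⟶ P 1
  comp : ∀ {n : ℕ} (L : Ar n), P n ⊗ tens P L ⟶ P L.sum
  unit_comp : ∀ k : ℕ,
    lift (toUnit (P k) ≫ unit) (tensOne P k) ≫ comp (Ar.nil.snoc k) =
      eqToHom (congrArg P (Nat.zero_add k).symm)
  comp_unit : ∀ n : ℕ,
    lift (𝟙 (P n)) (toUnit (P n) ≫ tensUnits P unit n) ≫ comp (Ar.ones n) =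
      eqToHom (congrArg P (Ar.sum_ones n).symm)
  comp_assoc : ∀ {n : ℕ} {L : Ar n} (M : NAr L),
    lift (P n ◁ nestLabels P M ≫ comp L) (snd _ _ ≫ nestFlat P M) ≫ comp M.flatten ≫
        eqToHom (congrArg P M.sum_flatten) =
      P n ◁ nestComp P comp M ≫ comp M.sums

/-! ### Categories enriched in `V` and weakened by an operad -/

/-- A chain `a = a_0, a_1, …, a_n = b` of elements of `S`. -/
inductive Chain {S : Type u} : ℕ → S → S → Type u
  | nil (a : S) : Chain 0 a a
  | snoc {n : ℕ} {a b : S} (c : Chain n a b) (b' : S) : Chain (n + 1) a b'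

namespace Chain

variable {S : Type u} {S' : Type u}

def append {n : ℕ} {a b : S} (c : Chain n a b) :
    {m : ℕ} → {b' : S} → Chain m b b' → Chain (n + m) a b'
  | _, _, nil _ => c
  | _, _, snoc d b' => (append c d).snoc b'

def map (o : S → S') : {n : ℕ} → {a b : S} → Chain n a b → Chain n (o a) (o b)
  | _, _, _, nil a => nil (o a)
  | _, _, _, snoc c b' => (map o c).snoc (o b')

end Chain

/-- For a chain `a_0, …, a_n` and a sequence `(k_1, …, k_n)`, a family of chains of
length `k_i` from `a_{i-1}` to `a_i`. -/
inductive NChain {S : Type u} : {n : ℕ} → {a b : S} → Chain n a b → Ar n → Type u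
  | nil (a : S) : NChain (Chain.nil a) Ar.nil
  | snoc {n k : ℕ} {a b b' : S} {c : Chain n a b} {L : Ar n} (N : NChain c L)
      (l : Chain k b b') : NChain (c.snoc b') (L.snoc k)

namespace NChain

variable {S : Type u} {S' : Type u}

/-- The concatenation of all the chains of the family. -/
def flatten : {n : ℕ} → {a b : S} → {c : Chain n a b} → {L : Ar n} → NChain c L →
    Chain L.sum a b
  | _, _, _, _, _, nil a => Chain.nil a
  | _, _, _, _, _, snoc N l => (flatten N).append l

def map (o : S → S') : {n : ℕ} → {a b : S} → {c : Chain n a b} → {L : Ar n} → NChain c L →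
    NChain (c.map o) L
  | _, _, _, _, _, nil a => nil (o a)
  | _, _, _, _, _, snoc N l => (map o N).snoc (l.map o)

end NChain

section Along

variable {V : Type (u + 1)} [Category.{u} V] [CartesianMonoidalCategory V] {S S' : Type u}

/-- `H(a_0, a_1) × ⋯ × H(a_{n-1}, a_n)`. -/
def along (H : S → S → V) : {n : ℕ} → {a b : S} → Chain n a b → V
  | _, _, _, Chain.nil _ => 𝟙_ V
  | _, _, _, @Chain.snoc _ _ _ b c b' => along H c ⊗ H b b'

/-- The isomorphism between `H(a, b)` and the product along the chain `a, b`. -/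
def alongOne (H : S → S → V) (a b : S) : H a b ⟶ along H ((Chain.nil a).snoc b) :=
  lift (toUnit (H a b) : H a b ⟶ 𝟙_ V) (𝟙 (H a b))

def alongJoin (H : S → S → V) {n : ℕ} {a b : S} (c : Chain n a b) :
    {m : ℕ} → {b' : S} → (d : Chain m b b') → (along H c ⊗ along H d ⟶ along H (c.append d))
  | _, _, Chain.nil _ => fst _ _
  | _, _, Chain.snoc d _ =>
      lift (lift (fst _ _) (snd _ _ ≫ fst _ _) ≫ alongJoin H c d) (snd _ _ ≫ snd _ _)

def alongMap {H : S → S → V} {H' : S' → S' → V} (o : S → S')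
    (h : ∀ a b, H a b ⟶ H' (o a) (o b)) :
    {n : ℕ} → {a b : S} → (c : Chain n a b) → (along H c ⟶ along H' (c.map o))
  | _, _, _, Chain.nil _ => 𝟙 _
  | _, _, _, Chain.snoc c _ => alongMap o h c ⊗ₘ h _ _

/-- The product over `i` of `P(k_i) × H(a_{i-1}, b_{i1}) × ⋯ × H(b_{i(k_i - 1)}, a_i)`. -/
def nest (P : ℕ → V) (H : S → S → V) :
    {n : ℕ} → {a b : S} → {c : Chain n a b} → {L : Ar n} → NChain c L → V
  | _, _, _, _, _, NChain.nil _ => 𝟙_ V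
  | _, _, _, _, _, @NChain.snoc _ _ k _ _ _ _ _ N l => nest P H N ⊗ (P k ⊗ along H l)

/-- The projection to `P(k_1) × ⋯ × P(k_n)`. -/
def labels (P : ℕ → V) (H : S → S → V) :
    {n : ℕ} → {a b : S} → {c : Chain n a b} → {L : Ar n} → (N : NChain c L) →
      (nest P H N ⟶ tens P L)
  | _, _, _, _, _, NChain.nil _ => 𝟙 _
  | _, _, _, _, _, NChain.snoc N _ => labels P H N ⊗ₘ fst _ _

/-- The projection to the product of the hom-objects along the concatenated chain. -/
def arrows (P : ℕ → V) (H : S → S → V) :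
    {n : ℕ} → {a b : S} → {c : Chain n a b} → {L : Ar n} → (N : NChain c L) →
      (nest P H N ⟶ along H N.flatten)
  | _, _, _, _, _, NChain.nil _ => 𝟙 _
  | _, _, _, _, _, NChain.snoc N l => (arrows P H N ⊗ₘ snd _ _) ≫ alongJoin H N.flatten l

/-- The product of given maps `P(k) × H(b_0, b_1) × ⋯ × H(b_{k-1}, b_k) ⟶ H'(b_0, b_k)`. -/
def nestEval {P : ℕ → V} {H H' : S → S → V}
    (γ : ∀ {k : ℕ} {a b : S} (l : Chain k a b), P k ⊗ along H l ⟶ H' a b) :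
    {n : ℕ} → {a b : S} → {c : Chain n a b} → {L : Ar n} → (N : NChain c L) →
      (nest P H N ⟶ along H' c)
  | _, _, _, _, _, NChain.nil _ => 𝟙 _
  | _, _, _, _, _, NChain.snoc N l => nestEval γ N ⊗ₘ γ l

end Along

section PCat

variable {V : Type (u + 1)} [Category.{u} V] [CartesianMonoidalCategory V]

/-- A `(V, P)`-category: a `V`-graph `A` with composition maps
`P(k) × A(a_0, a_1) × ⋯ × A(a_{k-1}, a_k) ⟶ A(a_0, a_k)` compatible with the unit and the
composition of the operad. -/
structure PCat (P : Operad V) : Type (u + 1) where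
  graph : VGraph V
  γ : ∀ {n : ℕ} {a b : graph.obj} (c : Chain n a b), P.P n ⊗ along graph.hom c ⟶ graph.hom a b
  γ_unit : ∀ a b : graph.obj,
    lift (toUnit (graph.hom a b) ≫ P.unit) (alongOne graph.hom a b) ≫
      γ ((Chain.nil a).snoc b) = 𝟙 (graph.hom a b)
  γ_assoc : ∀ {n : ℕ} {a b : graph.obj} {c : Chain n a b} {L : Ar n} (N : NChain c L),
    lift (P.P n ◁ labels P.P graph.hom N ≫ P.comp L) (snd _ _ ≫ arrows P.P graph.hom N) ≫
        γ N.flatten =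
      P.P n ◁ nestEval γ N ≫ γ c

namespace PCat

variable {P : Operad V}

/-- Morphisms of `(V, P)`-categories are the graph morphisms that commute with composition. -/
def IsFunctor (A B : PCat P) (F : A.graph ⟶ B.graph) : Prop :=
  ∀ {n : ℕ} {a b : A.graph.obj} (c : Chain n a b),
    A.γ c ≫ VGraph.Hom.hom F a b =
      P.P n ◁ alongMap (VGraph.Hom.obj F) (VGraph.Hom.hom F) c ≫ B.γ (c.map (VGraph.Hom.obj F))

end PCat
end PCat

/-! ### Generalised elements -/

section Elements

variable {V : Type (u + 1)} [Category.{u} V] [CartesianMonoidalCategory V] {S S' : Type u}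

/-- A chain from `a` to `b` together with an `X`-valued element of each hom-object along it. -/
def Arr (X : V) (H : S → S → V) (a b : S) : Type u :=
  Σ n : ℕ, Σ c : Chain n a b, (X ⟶ along H c)

namespace Arr

variable {X Y : V} {H : S → S → V} {H' : S' → S' → V}

def mk {n : ℕ} {a b : S} (c : Chain n a b) (f : X ⟶ along H c) : Arr X H a b := ⟨n, c, f⟩

def nil (X : V) (H : S → S → V) (a : S) : Arr X H a a := mk (Chain.nil a) (toUnit X)

def snoc {a b b' : S} (x : Arr X H a b) (f : X ⟶ H b b') : Arr X H a b' :=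
  mk (x.2.1.snoc b') (lift x.2.2 f : X ⟶ along H x.2.1 ⊗ H b b')

theorem mk_nil {a : S} (f : X ⟶ along H (Chain.nil a)) : mk (Chain.nil a) f = nil X H a :=
  congrArg (mk (Chain.nil a)) (toUnit_unique f _)

theorem mk_snoc {n : ℕ} {a b : S} (c : Chain n a b) (b' : S)
    (f : X ⟶ along H c ⊗ H b b') :
    (mk (c.snoc b') f : Arr X H a b') = (mk c (f ≫ fst _ _)).snoc (f ≫ snd _ _) :=
  congrArg (mk (c.snoc b')) (lift_comp_fst_snd f).symm

def append {a b b' : S} (x : Arr X H a b) (y : Arr X H b b') : Arr X H a b' :=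
  mk (x.2.1.append y.2.1) (lift x.2.2 y.2.2 ≫ alongJoin H x.2.1 y.2.1)

theorem append_nil {a b : S} (x : Arr X H a b) : x.append (nil X H b) = x := by
  obtain ⟨n, c, f⟩ := x
  exact congrArg (mk c) (lift_fst _ _)

theorem append_snoc {a b b' b'' : S} (x : Arr X H a b) (y : Arr X H b b') (f : X ⟶ H b' b'') :
    x.append (y.snoc f) = (x.append y).snoc f := by
  obtain ⟨n, c, x⟩ := x
  obtain ⟨m, d, y⟩ := y
  refine congrArg (mk ((c.append d).snoc b'')) ?_
  refine CartesianMonoidalCategory.hom_ext _ _ ?_ ?_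
  · show (lift x (lift y f) ≫ lift (lift (fst _ _) (snd _ _ ≫ fst _ _) ≫ alongJoin H c d)
      (snd _ _ ≫ snd _ _)) ≫ fst _ _ = lift (lift x y ≫ alongJoin H c d) f ≫ fst _ _
    simp [← Category.assoc, comp_lift]
  · show (lift x (lift y f) ≫ lift (lift (fst _ _) (snd _ _ ≫ fst _ _) ≫ alongJoin H c d)
      (snd _ _ ≫ snd _ _)) ≫ snd _ _ = lift (lift x y ≫ alongJoin H c d) f ≫ snd _ _
    simp

@[elab_as_elim]
theorem ind {a : S} {motive : ∀ b, Arr X H a b → Prop} (h₀ : motive a (nil X H a))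
    (h₁ : ∀ {b b' : S} (x : Arr X H a b) (f : X ⟶ H b b'), motive b x → motive b' (x.snoc f)) :
    ∀ {b : S} (x : Arr X H a b), motive b x := by
  intro b x
  obtain ⟨n, c, f⟩ := x
  induction c with
  | nil a =>
      have := mk_nil f
      rw [mk] at this
      rw [this]
      exact h₀
  | snoc c b' ih =>
      have := mk_snoc c b' f
      rw [mk] at this
      rw [this]
      exact h₁ _ _ (ih h₀ h₁ _)

theorem nil_append {a b : S} (x : Arr X H a b) : (nil X H a).append x = x := by
  induction x using Arr.ind with
  | h₀ => exact append_nil _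
  | h₁ x f ih => rw [append_snoc, ih]

theorem append_assoc {a b b' b'' : S} (x : Arr X H a b) (y : Arr X H b b')
    (z : Arr X H b' b'') : (x.append y).append z = x.append (y.append z) := by
  induction z using Arr.ind with
  | h₀ => rw [append_nil, append_nil]
  | h₁ z f ih => rw [append_snoc, append_snoc, append_snoc, ih]

def map (o : S → S') (h : ∀ a b, H a b ⟶ H' (o a) (o b)) {a b : S} (x : Arr X H a b) :
    Arr X H' (o a) (o b) :=
  mk (x.2.1.map o) (x.2.2 ≫ alongMap o h x.2.1)

theorem map_nil (o : S → S') (h : ∀ a b, H a b ⟶ H' (o a) (o b)) (a : S) :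
    (nil X H a).map o h = nil X H' (o a) := mk_nil _

theorem map_snoc (o : S → S') (h : ∀ a b, H a b ⟶ H' (o a) (o b)) {a b b' : S}
    (x : Arr X H a b) (f : X ⟶ H b b') :
    (x.snoc f).map o h = (x.map o h).snoc (f ≫ h b b') := by
  obtain ⟨n, c, x⟩ := x
  exact congrArg (mk ((c.map o).snoc (o b'))) (lift_map _ _ _ _)

theorem map_append (o : S → S') (h : ∀ a b, H a b ⟶ H' (o a) (o b)) {a b b' : S}
    (x : Arr X H a b) (y : Arr X H b b') :
    (x.append y).map o h = (x.map o h).append (y.map o h) := by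
  induction y using Arr.ind with
  | h₀ => rw [map_nil, append_nil, append_nil]
  | h₁ y f ih => rw [append_snoc, map_snoc, map_snoc, append_snoc, ih]

theorem map_id {a b : S} (x : Arr X H a b) : x.map (fun a => a) (fun _ _ => 𝟙 _) = x := by
  induction x using Arr.ind with
  | h₀ => exact map_nil _ _ _
  | h₁ x f ih => rw [map_snoc, ih, Category.comp_id]

theorem map_map {S'' : Type u} {H'' : S'' → S'' → V} (o : S → S')
    (h : ∀ a b, H a b ⟶ H' (o a) (o b)) (o' : S' → S'')
    (h' : ∀ a b, H' a b ⟶ H'' (o' a) (o' b)) {a b : S} (x : Arr X H a b) :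
    (x.map o h).map o' h' = x.map (fun a => o' (o a)) (fun a b => h a b ≫ h' _ _) := by
  induction x using Arr.ind with
  | h₀ => rw [map_nil, map_nil, map_nil]
  | h₁ x f ih => rw [map_snoc, map_snoc, map_snoc, ih, Category.assoc]

/-- Apply a family of maps `P(n) × H(a_0, a_1) × ⋯ × H(a_{n-1}, a_n) ⟶ Z` to elements. -/
theorem ap_congr {P : ℕ → V} {a b : S} {Z : V}
    (φ : ∀ {n : ℕ} (c : Chain n a b), P n ⊗ along H c ⟶ Z)
    {n m : ℕ} {c : Chain n a b} {d : Chain m a b} {f : X ⟶ along H c} {g : X ⟶ along H d}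
    (e : mk c f = mk d g) {p : X ⟶ P n} {q : X ⟶ P m}
    (h : ∀ e' : n = m, p ≫ eqToHom (congrArg P e') = q) :
    lift p f ≫ φ c = lift q g ≫ φ d := by
  obtain rfl : n = m := congrArg Sigma.fst e
  have e₁ := eq_of_heq (Sigma.mk.inj e).2
  obtain rfl : c = d := congrArg Sigma.fst e₁
  obtain rfl : f = g := eq_of_heq (Sigma.mk.inj e₁).2
  have := h rfl
  rw [eqToHom_refl, Category.comp_id] at this
  rw [this]

end Arr

variable {X : V} {P : ℕ → V} {H : S → S → V} {H' : S' → S' → V}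

theorem arr_arrows_nil (a : S) (f : X ⟶ 𝟙_ V) :
    Arr.mk (NChain.nil a).flatten (f ≫ arrows P H (NChain.nil a)) = Arr.nil X H a :=
  Arr.mk_nil _

theorem arr_arrows_snoc {n k : ℕ} {a b b' : S} {c : Chain n a b} {L : Ar n} (N : NChain c L)
    (l : Chain k b b') (f : X ⟶ nest P H N ⊗ (P k ⊗ along H l)) :
    Arr.mk (N.snoc l).flatten (f ≫ arrows P H (N.snoc l)) =
      (Arr.mk N.flatten (f ≫ fst _ _ ≫ arrows P H N)).append
        (Arr.mk l (f ≫ snd _ _ ≫ snd _ _)) := by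
  refine congrArg (Arr.mk (N.flatten.append l)) ?_
  show f ≫ (arrows P H N ⊗ₘ snd _ _) ≫ alongJoin H N.flatten l =
    lift (f ≫ fst _ _ ≫ arrows P H N) (f ≫ snd _ _ ≫ snd _ _) ≫ alongJoin H N.flatten l
  rw [← Category.assoc]
  congr 1
  ext <;> simp

theorem alongOne_map (o : S → S') (h : ∀ a b, H a b ⟶ H' (o a) (o b)) (a b : S) :
    alongOne H a b ≫ alongMap o h ((Chain.nil a).snoc b) = h a b ≫ alongOne H' (o a) (o b) := by
  show lift (toUnit (H a b)) (𝟙 (H a b)) ≫ (𝟙 (𝟙_ V) ⊗ₘ h a b) =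
    h a b ≫ lift (toUnit (H' (o a) (o b))) (𝟙 _)
  ext
  simp

theorem mk_alongOne {a b : S} (f : X ⟶ H a b) :
    Arr.mk ((Chain.nil a).snoc b) (f ≫ alongOne H a b) = (Arr.nil X H a).snoc f := by
  refine (Arr.mk_snoc (Chain.nil a) b _).trans (congrArg₂ Arr.snoc (Arr.mk_nil _) ?_)
  show (f ≫ lift (toUnit (H a b) : _ ⟶ 𝟙_ V) (𝟙 _)) ≫ snd (𝟙_ V) (H a b) = f
  rw [Category.assoc, lift_snd, Category.comp_id]

def nestMap (o : S → S') (h : ∀ a b, H a b ⟶ H' (o a) (o b)) :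
    {n : ℕ} → {a b : S} → {c : Chain n a b} → {L : Ar n} → (N : NChain c L) →
      (nest P H N ⟶ nest P H' (N.map o))
  | _, _, _, _, _, NChain.nil _ => 𝟙 _
  | _, _, _, _, _, NChain.snoc N l => nestMap o h N ⊗ₘ (_ ◁ alongMap o h l)

theorem nestMap_labels (o : S → S') (h : ∀ a b, H a b ⟶ H' (o a) (o b))
    {n : ℕ} {a b : S} {c : Chain n a b} {L : Ar n} (N : NChain c L) :
    nestMap (P := P) o h N ≫ labels P H' (N.map o) = labels P H N := by
  induction N with
  | nil a => exact toUnit_unique _ _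
  | snoc N l ih =>
      show (nestMap o h N ⊗ₘ (_ ◁ alongMap o h l)) ≫ (labels P H' (N.map o) ⊗ₘ fst _ _) =
        labels P H N ⊗ₘ fst _ _
      rw [tensorHom_comp_tensorHom, ih, whiskerLeft_fst]

theorem nestMap_arrows (o : S → S') (h : ∀ a b, H a b ⟶ H' (o a) (o b))
    {n : ℕ} {a b : S} {c : Chain n a b} {L : Ar n} (N : NChain c L) (f : X ⟶ nest P H N) :
    Arr.mk (N.map o).flatten (f ≫ nestMap o h N ≫ arrows P H' (N.map o)) =
      (Arr.mk N.flatten (f ≫ arrows P H N)).map o h := by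
  induction N with
  | nil a => exact (Arr.mk_nil _).trans (Arr.mk_nil _).symm
  | @snoc _ k _ _ _ _ _ N l ih =>
      revert f
      intro (f : X ⟶ nest P H N ⊗ (P k ⊗ along H l))
      have e₁ := arr_arrows_snoc (P := P) (H := H) N l f
      have e₂ := arr_arrows_snoc (P := P) (H := H') (N.map o) (l.map o)
        (f ≫ nestMap o h (N.snoc l))
      refine (congrArg (Arr.mk _) (Category.assoc _ _ _).symm).trans (e₂.trans ?_)
      refine Eq.trans ?_ ((congrArg (Arr.map o h) e₁).trans (Arr.map_append o h _ _)).symm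
      refine congrArg₂ Arr.append ?_ ?_
      · refine Eq.trans ?_ ((ih (f ≫ fst _ _)).trans ?_)
        · refine congrArg (Arr.mk _) ?_
          show (f ≫ (nestMap o h N ⊗ₘ (_ ◁ alongMap o h l))) ≫ fst _ _ ≫ arrows P H' (N.map o) = _
          simp
        · exact congrArg (fun y => Arr.map o h (Arr.mk N.flatten y)) (Category.assoc _ _ _)
      · refine congrArg (Arr.mk _) ?_
        show (f ≫ (nestMap o h N ⊗ₘ (_ ◁ alongMap o h l))) ≫ snd _ _ ≫ snd _ _ =
          (f ≫ snd _ _ ≫ snd _ _) ≫ alongMap o h l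
        simp

theorem nestMap_eval {K : S → S → V} {K' : S' → S' → V} (o : S → S')
    (h : ∀ a b, H a b ⟶ H' (o a) (o b)) (k : ∀ a b, K a b ⟶ K' (o a) (o b))
    (γ : ∀ {n : ℕ} {a b : S} (l : Chain n a b), P n ⊗ along H l ⟶ K a b)
    (γ' : ∀ {n : ℕ} {a b : S'} (l : Chain n a b), P n ⊗ along H' l ⟶ K' a b)
    (e : ∀ {n : ℕ} {a b : S} (l : Chain n a b),
      γ l ≫ k a b = P n ◁ alongMap o h l ≫ γ' (l.map o))
    {n : ℕ} {a b : S} {c : Chain n a b} {L : Ar n} (N : NChain c L) :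
    nestMap o h N ≫ nestEval γ' (N.map o) = nestEval γ N ≫ alongMap o k c := by
  induction N with
  | nil a => exact toUnit_unique _ _
  | snoc N l ih =>
      show (nestMap o h N ⊗ₘ (_ ◁ alongMap o h l)) ≫ (nestEval γ' (N.map o) ⊗ₘ γ' (l.map o)) =
        (nestEval γ N ⊗ₘ γ l) ≫ (alongMap o k _ ⊗ₘ k _ _)
      rw [tensorHom_comp_tensorHom, tensorHom_comp_tensorHom, ih, e]

end Elements

/-! ### The free `(V, P)`-category monad -/

section Free

variable {V : Type (u + 1)} [Category.{u} V] [CartesianMonoidalCategory V] [CoprodDistrib V]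
  {S S' : Type u}

/-- The hom-object of the free `(V, P)`-category: the coproduct over all `n` and all chains
`a = a_0, …, a_n = b` of `P(n) × H(a_0, a_1) × ⋯ × H(a_{n-1}, a_n)`. -/
def fcHom (P : ℕ → V) (H : S → S → V) (a b : S) : V :=
  ∐ fun c : (Σ n : ℕ, Chain n a b) => P c.1 ⊗ along H c.2

/-- The coproduct inclusion of the summand indexed by a chain. -/
def fcInj (P : ℕ → V) (H : S → S → V) {n : ℕ} {a b : S} (c : Chain n a b) :
    P n ⊗ along H c ⟶ fcHom P H a b :=
  Sigma.ι (fun c : (Σ n : ℕ, Chain n a b) => P c.1 ⊗ along H c.2) ⟨n, c⟩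

def fcDesc {P : ℕ → V} {H : S → S → V} {a b : S} {Z : V}
    (φ : ∀ {n : ℕ} (c : Chain n a b), P n ⊗ along H c ⟶ Z) : fcHom P H a b ⟶ Z :=
  Sigma.desc fun c => φ c.2

theorem fcInj_desc {P : ℕ → V} {H : S → S → V} {a b : S} {Z : V}
    (φ : ∀ {n : ℕ} (c : Chain n a b), P n ⊗ along H c ⟶ Z) {n : ℕ} (c : Chain n a b) :
    fcInj P H c ≫ fcDesc φ = φ c :=
  Sigma.ι_desc _ _

theorem fcHom_ext {P : ℕ → V} {H : S → S → V} {a b : S} {Z : V} {f g : fcHom P H a b ⟶ Z}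
    (h : ∀ {n : ℕ} (c : Chain n a b), fcInj P H c ≫ f = fcInj P H c ≫ g) : f = g :=
  Sigma.hom_ext _ _ fun c => h c.2

theorem fc_tensor_ext {P : ℕ → V} {H : S → S → V} {a b : S} {Y Z : V}
    {f g : Y ⊗ fcHom P H a b ⟶ Z}
    (h : ∀ {n : ℕ} (c : Chain n a b), Y ◁ fcInj P H c ≫ f = Y ◁ fcInj P H c ≫ g) : f = g :=
  tensor_hom_ext fun c => h c.2

variable (P : ℕ → V) (H : S → S → V)

/-- Since coproducts commute with products, a product of hom-objects of the free
`(V, P)`-category is the coproduct of the products `nest P H N`. -/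
theorem existsUnique_alongDesc {n : ℕ} {a b : S} (c : Chain n a b) :
    ∀ (Y Z : V) (φ : ∀ {L : Ar n} (N : NChain c L), Y ⊗ nest P H N ⟶ Z),
      ∃! d : Y ⊗ along (fcHom P H) c ⟶ Z,
        ∀ {L : Ar n} (N : NChain c L), Y ◁ nestEval (fcInj P H) N ≫ d = φ N := by
  induction c with
  | nil a =>
      intro Y Z φ
      refine ⟨φ (NChain.nil a), ?_, ?_⟩
      · intro L N
        cases N
        show Y ◁ 𝟙 _ ≫ _ = _
        rw [whiskerLeft_id]
        exact Category.id_comp _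
      · intro d hd
        rw [← hd]
        show _ = Y ◁ 𝟙 _ ≫ _
        rw [whiskerLeft_id]
        exact (Category.id_comp _).symm
  | @snoc n a b c b' ih =>
      intro Y Z φ
      have key : ∀ {k : ℕ} (l : Chain k b b'), ∃! d : (Y ⊗ (P k ⊗ along H l)) ⊗ along (fcHom P H) c ⟶ Z,
          ∀ {L : Ar n} (N : NChain c L), (Y ⊗ (P k ⊗ along H l)) ◁ nestEval (fcInj P H) N ≫ d =
            lift (fst _ _ ≫ fst _ _) (lift (snd _ _) (fst _ _ ≫ snd _ _)) ≫ φ (N.snoc l) :=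
        fun {k} l => ih _ _ _
      choose d hd hd' using @key
      let ψ : (Y ⊗ along (fcHom P H) c) ⊗ fcHom P H b b' ⟶ Z :=
        tensorDesc fun l => lift (lift (fst _ _ ≫ fst _ _) (snd _ _)) (fst _ _ ≫ snd _ _) ≫ d l.2
      have hψ : ∀ {k : ℕ} (l : Chain k b b'), (Y ⊗ along (fcHom P H) c) ◁ fcInj P H l ≫ ψ =
          lift (lift (fst _ _ ≫ fst _ _) (snd _ _)) (fst _ _ ≫ snd _ _) ≫ d l :=
        fun {k} l => ι_tensorDesc _ (⟨k, l⟩ : Σ k : ℕ, Chain k b b')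
      refine ⟨lift (lift (fst _ _) (snd _ _ ≫ fst _ _)) (snd _ _ ≫ snd _ _) ≫ ψ, ?_, ?_⟩
      · intro L N
        cases N with
        | @snoc _ k _ _ _ _ L N l =>
        show Y ◁ (nestEval (fcInj P H) N ⊗ₘ fcInj P H l) ≫
          lift (lift (fst Y (along (fcHom P H) c ⊗ fcHom P H b b')) (snd _ _ ≫ fst _ _))
            (snd _ _ ≫ snd _ _) ≫ ψ = _
        have e : Y ◁ (nestEval (fcInj P H) N ⊗ₘ fcInj P H l) ≫
            lift (lift (fst Y (along (fcHom P H) c ⊗ fcHom P H b b')) (snd _ _ ≫ fst _ _))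
            (snd _ _ ≫ snd _ _) =
            lift (lift (fst _ _) (snd _ _ ≫ fst _ _ ≫ nestEval (fcInj P H) N))
              (snd _ _ ≫ snd _ _) ≫ (Y ⊗ along (fcHom P H) c) ◁ fcInj P H l := by
          ext <;> simp
        rw [← Category.assoc, e, Category.assoc, hψ]
        have e' : lift (lift (fst Y (nest P H N ⊗ (P k ⊗ along H l))) (snd _ _ ≫ fst _ _ ≫
            nestEval (fcInj P H) N)) (snd _ _ ≫ snd _ _) ≫
            lift (lift (fst _ _ ≫ fst _ _) (snd _ _)) (fst _ _ ≫ snd _ _) =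
            lift (lift (fst _ _) (snd _ _ ≫ snd _ _)) (snd _ _ ≫ fst _ _) ≫
              (Y ⊗ (P k ⊗ along H l)) ◁ nestEval (fcInj P H) N := by
          ext <;> simp
        rw [← Category.assoc, e', Category.assoc, hd]
        refine (Category.assoc _ _ _).symm.trans ?_
        refine (congrArg (· ≫ φ (N.snoc l)) ?_).trans (Category.id_comp _)
        show _ = 𝟙 (Y ⊗ (nest P H N ⊗ (P k ⊗ along H l)))
        ext <;> simp
      · intro d' h'
        have e : ∀ {k : ℕ} (l : Chain k b b'),
            lift (fst _ _ ≫ fst _ _) (lift (snd _ _) (fst _ _ ≫ snd _ _ ≫ fcInj P H l)) ≫ d' =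
              d l := by
          intro k l
          refine hd' l _ fun {L} N => ?_
          rw [← h' (N.snoc l)]
          refine (Category.assoc _ _ _).symm.trans (Eq.trans ?_ (Category.assoc _ _ _))
          refine congrArg (· ≫ d') ?_
          show _ = lift (fst _ _ ≫ fst _ _) (lift (snd _ _) (fst _ _ ≫ snd _ _)) ≫
            Y ◁ (nestEval (fcInj P H) N ⊗ₘ fcInj P H l)
          ext <;> simp [-MonoidalCategory.tensor_whiskerLeft]
        have e₂ : ψ = lift (fst _ _ ≫ fst _ _) (lift (fst _ _ ≫ snd _ _) (snd _ _)) ≫ d' := by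
          refine fc_tensor_ext fun {k} l => ?_
          rw [hψ, ← e]
          refine (Category.assoc _ _ _).symm.trans (Eq.trans ?_ (Category.assoc _ _ _))
          refine congrArg (· ≫ d') ?_
          ext <;> simp
        rw [e₂]
        refine Eq.trans ?_ (Category.assoc _ _ _)
        refine (Category.id_comp _).symm.trans (congrArg (· ≫ d') ?_)
        have e₃ : 𝟙 (Y ⊗ (along (fcHom P H) c ⊗ fcHom P H b b')) =
            lift (lift (fst _ _) (snd _ _ ≫ fst _ _)) (snd _ _ ≫ snd _ _) ≫
              lift (fst _ _ ≫ fst _ _) (lift (fst _ _ ≫ snd _ _) (snd _ _)) := by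
          ext <;> simp
        exact e₃

theorem along_ext {n : ℕ} {a b : S} {c : Chain n a b} {Y Z : V}
    {f g : Y ⊗ along (fcHom P H) c ⟶ Z}
    (h : ∀ {L : Ar n} (N : NChain c L), Y ◁ nestEval (fcInj P H) N ≫ f =
      Y ◁ nestEval (fcInj P H) N ≫ g) : f = g :=
  (existsUnique_alongDesc P H c Y Z (fun N => Y ◁ nestEval (fcInj P H) N ≫ g)).unique h
    (fun _ => rfl)

/-- The map out of `Y × ∏ᵢ fcHom(a_{i-1}, a_i)` with given restrictions to the summands. -/
def alongDesc {n : ℕ} {a b : S} (c : Chain n a b) (Y Z : V)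
    (φ : ∀ {L : Ar n} (N : NChain c L), Y ⊗ nest P H N ⟶ Z) : Y ⊗ along (fcHom P H) c ⟶ Z :=
  (existsUnique_alongDesc P H c Y Z φ).choose

theorem nestEval_alongDesc {n : ℕ} {a b : S} (c : Chain n a b) (Y Z : V)
    (φ : ∀ {L : Ar n} (N : NChain c L), Y ⊗ nest P H N ⟶ Z) {L : Ar n} (N : NChain c L) :
    Y ◁ nestEval (fcInj P H) N ≫ alongDesc P H c Y Z φ = φ N :=
  (existsUnique_alongDesc P H c Y Z φ).choose_spec.1 N

variable {P H}

/-- The `X`-valued element of the free hom-object given by a label, a chain and elements of the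
hom-objects along it. -/
def fcCell {X : V} {n : ℕ} {a b : S} (p : X ⟶ P n) (c : Chain n a b) (f : X ⟶ along H c) :
    X ⟶ fcHom P H a b :=
  lift p f ≫ fcInj P H c

theorem comp_fcCell {X Y : V} (g : Y ⟶ X) {n : ℕ} {a b : S} (p : X ⟶ P n) (c : Chain n a b)
    (f : X ⟶ along H c) : g ≫ fcCell p c f = fcCell (g ≫ p) c (g ≫ f) := by
  rw [fcCell, fcCell, ← Category.assoc, comp_lift]

theorem fcCell_congr {X : V} {n m : ℕ} {a b : S} {c : Chain n a b} {d : Chain m a b}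
    {f : X ⟶ along H c} {g : X ⟶ along H d} (e : Arr.mk c f = Arr.mk d g) {p : X ⟶ P n}
    {q : X ⟶ P m} (h : ∀ e' : n = m, p ≫ eqToHom (congrArg P e') = q) :
    fcCell p c f = fcCell q d g :=
  Arr.ap_congr (fcInj P H) e h

theorem fcInj_eq {n : ℕ} {a b : S} (c : Chain n a b) :
    fcInj P H c = fcCell (fst _ _) c (snd _ _) := by
  rw [fcCell, lift_fst_snd, Category.id_comp]

theorem fcCell_ext {a b : S} {Z : V} {f g : fcHom P H a b ⟶ Z}
    (h : ∀ {X : V} {n : ℕ} (p : X ⟶ P n) (c : Chain n a b) (y : X ⟶ along H c),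
      fcCell p c y ≫ f = fcCell p c y ≫ g) : f = g :=
  fcHom_ext fun c => by rw [fcInj_eq]; exact h _ _ _

theorem fcCell_ext₂ {a b : S} {Z : V} {f g : fcHom P (fcHom P H) a b ⟶ Z}
    (h : ∀ {X : V} {n : ℕ} (p : X ⟶ P n) {c : Chain n a b} {L : Ar n} (N : NChain c L)
      (y : X ⟶ nest P H N), fcCell p c (y ≫ nestEval (fcInj P H) N) ≫ f =
        fcCell p c (y ≫ nestEval (fcInj P H) N) ≫ g) : f = g := by
  refine fcHom_ext fun {n} c => along_ext P H fun {L} N => ?_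
  have w : P n ◁ nestEval (fcInj P H) N ≫ fcInj P (fcHom P H) c =
      fcCell (fst _ _) c (snd _ _ ≫ nestEval (fcInj P H) N) := by
    refine congrArg (· ≫ fcInj P (fcHom P H) c) ?_
    ext <;> simp
  rw [← Category.assoc, ← Category.assoc, w]
  exact h _ _ _

/-- The action of the free `(V, P)`-category functor on a morphism of graphs. -/
def fcMap {H' : S' → S' → V} (o : S → S')
    (h : ∀ a b, H a b ⟶ H' (o a) (o b)) (a b : S) : fcHom P H a b ⟶ fcHom P H' (o a) (o b) :=
  fcDesc fun {n} c => P n ◁ alongMap o h c ≫ fcInj P H' (c.map o)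

theorem fcCell_map {H' : S' → S' → V} (o : S → S') (h : ∀ a b, H a b ⟶ H' (o a) (o b))
    {X : V} {n : ℕ} {a b : S} (p : X ⟶ P n) (c : Chain n a b) (f : X ⟶ along H c) :
    fcCell p c f ≫ fcMap o h a b = fcCell p (c.map o) (f ≫ alongMap o h c) := by
  rw [fcCell, fcMap, Category.assoc, fcInj_desc, lift_whiskerLeft_assoc, fcCell]

variable (H) (O : Operad V)

/-- The unit of the free `(V, P)`-category monad: the inclusion of the chains of length one,
labelled by the unit of the operad. -/
def fcUnit (a b : S) : H a b ⟶ fcHom O.P H a b :=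
  fcCell (toUnit (H a b) ≫ O.unit) ((Chain.nil a).snoc b) (alongOne H a b)

/-- The multiplication of the free `(V, P)`-category monad: it concatenates a chain of chains and
composes the labels in the operad. -/
def fcMul (a b : S) : fcHom O.P (fcHom O.P H) a b ⟶ fcHom O.P H a b :=
  fcDesc fun {n} c => alongDesc O.P H c (O.P n) (fcHom O.P H a b) fun {L} N =>
    lift (O.P n ◁ labels O.P H N ≫ O.comp L) (snd _ _ ≫ arrows O.P H N) ≫ fcInj O.P H N.flatten

variable {H O}

theorem fcCell_mul {X : V} {n : ℕ} {a b : S} {c : Chain n a b} {L : Ar n} (N : NChain c L)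
    (p : X ⟶ O.P n) (y : X ⟶ nest O.P H N) :
    fcCell p c (y ≫ nestEval (fcInj O.P H) N) ≫ fcMul H O a b =
      fcCell (lift p (y ≫ labels O.P H N) ≫ O.comp L) N.flatten (y ≫ arrows O.P H N) := by
  rw [fcCell, fcMul, Category.assoc, fcInj_desc, ← lift_whiskerLeft_assoc, nestEval_alongDesc,
    ← Category.assoc, fcCell]
  congr 1
  ext <;> simp

theorem fcMap_id (a b : S) : fcMap (P := P) (H := H) (fun a => a) (fun _ _ => 𝟙 _) a b = 𝟙 _ := by
  refine fcCell_ext fun p c f => ?_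
  rw [fcCell_map, Category.comp_id]
  exact fcCell_congr (Arr.map_id (Arr.mk c f)) fun _ => Category.comp_id _

theorem fcMap_comp {S'' : Type u} {H' : S' → S' → V} {H'' : S'' → S'' → V} (o : S → S')
    (h : ∀ a b, H a b ⟶ H' (o a) (o b)) (o' : S' → S'')
    (h' : ∀ a b, H' a b ⟶ H'' (o' a) (o' b)) (a b : S) :
    fcMap (P := P) (fun a => o' (o a)) (fun a b => h a b ≫ h' _ _) a b =
      fcMap o h a b ≫ fcMap o' h' _ _ := by
  refine fcCell_ext fun p c f => ?_
  rw [← Category.assoc, fcCell_map, fcCell_map, fcCell_map]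
  exact fcCell_congr (Arr.map_map o h o' h' (Arr.mk c f)).symm fun _ => Category.comp_id _

theorem fcUnit_naturality {H' : S' → S' → V} (o : S → S')
    (h : ∀ a b, H a b ⟶ H' (o a) (o b)) (a b : S) :
    h a b ≫ fcUnit H' O (o a) (o b) = fcUnit H O a b ≫ fcMap o h a b := by
  rw [fcUnit, fcUnit, fcCell_map, comp_fcCell]
  refine congrArg₂ (fun x y => fcCell x _ y) ?_ ?_
  · rw [comp_toUnit_assoc]
  · exact (alongOne_map o h a b).symm

theorem fcMul_naturality {H' : S' → S' → V} (o : S → S')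
    (h : ∀ a b, H a b ⟶ H' (o a) (o b)) (a b : S) :
    fcMap o (fcMap o h) a b ≫ fcMul H' O (o a) (o b) = fcMul H O a b ≫ fcMap o h a b := by
  refine fcCell_ext₂ fun {X n} p {c L} N y => ?_
  rw [← Category.assoc, fcCell_map, ← Category.assoc, fcCell_mul, fcCell_map, Category.assoc,
    ← nestMap_eval o h (fcMap o h) (fcInj O.P H) (fcInj O.P H') (fun l => fcInj_desc _ l) N,
    ← Category.assoc, fcCell_mul, Category.assoc, Category.assoc, nestMap_labels]
  exact fcCell_congr (nestMap_arrows o h N _) fun _ => Category.comp_id _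

/-! #### The monad laws -/

def alongHom {H H' : S → S → V} (h : ∀ a b, H a b ⟶ H' a b) :
    {n : ℕ} → {a b : S} → (c : Chain n a b) → (along H c ⟶ along H' c)
  | _, _, _, Chain.nil _ => 𝟙 _
  | _, _, _, Chain.snoc c _ => alongHom h c ⊗ₘ h _ _

theorem mk_alongMap_id {H H' : S → S → V} (h : ∀ a b, H a b ⟶ H' a b) {X : V}
    {n : ℕ} {a b : S} (c : Chain n a b) (f : X ⟶ along H c) :
    Arr.mk (c.map fun a => a) (f ≫ alongMap (fun a => a) h c) = Arr.mk c (f ≫ alongHom h c) := by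
  induction c with
  | nil a => exact (Arr.mk_nil _).trans (Arr.mk_nil _).symm
  | @snoc n a b c b' ih =>
      revert f
      intro (f : X ⟶ along H c ⊗ H b b')
      refine (Arr.mk_snoc (c.map fun a => a) b' _).trans
        (Eq.trans ?_ (Arr.mk_snoc c b' (f ≫ (alongHom h c ⊗ₘ h b b'))).symm)
      have e : f ≫ (alongMap (fun a => a) h c ⊗ₘ h b b') =
          lift (f ≫ fst _ _ ≫ alongMap (fun a => a) h c) (f ≫ snd _ _ ≫ h b b') := by
        ext <;> simp
      have e' : f ≫ (alongHom h c ⊗ₘ h b b') =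
          lift (f ≫ fst _ _ ≫ alongHom h c) (f ≫ snd _ _ ≫ h b b') := by
        ext <;> simp
      have i := ih (f ≫ fst _ _)
      rw [Category.assoc, Category.assoc] at i
      rw [e', lift_fst, lift_snd, ← i]
      refine congrArg₂ Arr.snoc (congrArg (Arr.mk _) ?_) ?_
      · exact (congrArg (· ≫ fst _ _) e).trans (lift_fst _ _)
      · exact (congrArg (· ≫ snd _ _) e).trans (lift_snd _ _)

theorem fcCell_map_id {H H' : S → S → V} (h : ∀ a b, H a b ⟶ H' a b) {X : V} {n : ℕ} {a b : S}
    (p : X ⟶ P n) (c : Chain n a b) (f : X ⟶ along H c) :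
    fcCell p c f ≫ fcMap (fun a => a) h a b = fcCell p c (f ≫ alongHom h c) := by
  rw [fcCell_map]
  exact fcCell_congr (mk_alongMap_id h c f) fun _ => Category.comp_id _

theorem fcUnit_mul (a b : S) :
    fcUnit (fcHom O.P H) O a b ≫ fcMul H O a b = 𝟙 (fcHom O.P H a b) := by
  refine fcCell_ext fun {X n} p c f => ?_
  rw [Category.comp_id, ← Category.assoc]
  let y : X ⟶ nest O.P H ((NChain.nil a).snoc c) := lift (toUnit X : X ⟶ 𝟙_ V) (lift p f)
  have e := fcCell_mul (O := O) (H := H) ((NChain.nil a).snoc c) (toUnit X ≫ O.unit) y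
  refine Eq.trans ?_ (e.trans ?_)
  · refine congrArg (· ≫ fcMul H O a b)
      ((comp_fcCell _ _ _ _).trans (congrArg₂ (fun x y => fcCell x _ y) ?_ ?_))
    · rw [comp_toUnit_assoc]
    · show fcCell p c f ≫ lift (toUnit (fcHom O.P H a b) : _ ⟶ 𝟙_ V) (𝟙 _) =
        lift (toUnit X) (lift p f) ≫ (𝟙 (𝟙_ V) ⊗ₘ fcInj O.P H c)
      refine CartesianMonoidalCategory.hom_ext _ _ (toUnit_unique _ _) ?_
      simp [fcCell]
  · refine fcCell_congr ?_ fun e' => ?_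
    · refine (arr_arrows_snoc (P := O.P) (H := H) (NChain.nil a) c y).trans ?_
      refine Eq.trans ?_ (Arr.nil_append (Arr.mk c f))
      refine congrArg₂ Arr.append (Arr.mk_nil _) (congrArg (Arr.mk c) ?_)
      exact (Category.assoc _ _ _).symm.trans
        ((congrArg (· ≫ snd _ _) (lift_snd _ _)).trans (lift_snd _ _))
    · have u := O.unit_comp n
      have e₁ : lift (toUnit X ≫ O.unit) (y ≫ labels O.P H ((NChain.nil a).snoc c)) = p ≫
            lift (toUnit (O.P n) ≫ O.unit) (tensOne O.P n) := by
        show lift (toUnit X ≫ O.unit) (lift (toUnit X) (lift p f) ≫ (𝟙 (𝟙_ V) ⊗ₘ fst _ _)) =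
          p ≫ lift (toUnit (O.P n) ≫ O.unit) (lift (toUnit (O.P n) : _ ⟶ 𝟙_ V) (𝟙 (O.P n)))
        ext <;> simp
      refine (congrArg (fun x => (x ≫ O.comp (Ar.nil.snoc n)) ≫ eqToHom _) e₁).trans ?_
      refine (congrArg (· ≫ eqToHom (congrArg O.P e')) ((Category.assoc _ _ _).trans
        (congrArg (p ≫ ·) u))).trans ?_
      exact (Category.assoc _ _ _).trans ((congrArg (p ≫ ·) (eqToHom_trans _ _)).trans
        (Category.comp_id _))

def singles : {n : ℕ} → {a b : S} → (c : Chain n a b) → NChain c (Ar.ones n)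
  | _, _, _, Chain.nil a => NChain.nil a
  | _, _, _, @Chain.snoc _ _ _ b c b' => (singles c).snoc ((Chain.nil b).snoc b')

variable (H O) in
def singlesElt : {n : ℕ} → {a b : S} → (c : Chain n a b) → (along H c ⟶ nest O.P H (singles c))
  | _, _, _, Chain.nil _ => 𝟙 _
  | _, _, _, @Chain.snoc _ _ _ b c b' =>
      singlesElt c ⊗ₘ lift (toUnit (H b b') ≫ O.unit) (alongOne H b b')

theorem singlesElt_labels {n : ℕ} {a b : S} (c : Chain n a b) :
    singlesElt H O c ≫ labels O.P H (singles c) = toUnit _ ≫ tensUnits O.P O.unit n := by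
  induction c with
  | nil a => exact toUnit_unique _ _
  | @snoc n a b c b' ih =>
      show (singlesElt H O c ⊗ₘ lift (toUnit (H b b') ≫ O.unit) (alongOne H b b')) ≫ (labels O.P H (singles c) ⊗ₘ fst _ _) =
          toUnit (along H c ⊗ H b b') ≫ lift (tensUnits O.P O.unit n) O.unit
      rw [tensorHom_comp_tensorHom, ih, lift_fst]
      ext
      · rw [tensorHom_fst, comp_toUnit_assoc, Category.assoc, lift_fst]
      · rw [tensorHom_snd, comp_toUnit_assoc, Category.assoc, lift_snd]

theorem singlesElt_eval {n : ℕ} {a b : S} (c : Chain n a b) :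
    singlesElt H O c ≫ nestEval (fcInj O.P H) (singles c) = alongHom (fcUnit H O) c := by
  induction c with
  | nil a => exact toUnit_unique _ _
  | @snoc n a b c b' ih =>
      show (singlesElt H O c ⊗ₘ lift (toUnit (H b b') ≫ O.unit) (alongOne H b b')) ≫ (nestEval (fcInj O.P H) (singles c) ⊗ₘ
          fcInj O.P H ((Chain.nil b).snoc b')) = alongHom (fcUnit H O) c ⊗ₘ fcUnit H O b b'
      refine (tensorHom_comp_tensorHom _ _ _ _).trans ?_
      rw [ih]
      rfl

theorem singlesElt_arrows {X : V} {n : ℕ} {a b : S} (c : Chain n a b) (f : X ⟶ along H c) :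
    Arr.mk (singles c).flatten (f ≫ singlesElt H O c ≫ arrows O.P H (singles c)) = Arr.mk c f := by
  induction c with
  | nil a => exact (Arr.mk_nil _).trans (Arr.mk_nil _).symm
  | @snoc n a b c b' ih =>
      revert f
      intro (f : X ⟶ along H c ⊗ H b b')
      have e : f ≫ (singlesElt H O c ⊗ₘ lift (toUnit (H b b') ≫ O.unit) (alongOne H b b')) = lift (f ≫ fst _ _ ≫ singlesElt H O c)
            (lift (toUnit _ ≫ O.unit) ((f ≫ snd _ _) ≫ alongOne H b b')) := by
        ext <;> simp
      refine (congrArg (Arr.mk _) (Category.assoc _ _ _).symm).trans ?_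
      refine (arr_arrows_snoc (P := O.P) (H := H) (singles c) ((Chain.nil b).snoc b')
        (f ≫ (singlesElt H O c ⊗ₘ lift (toUnit (H b b') ≫ O.unit) (alongOne H b b')))).trans ?_
      have i := ih (f ≫ fst _ _)
      rw [Category.assoc] at i
      refine Eq.trans ?_ ((Arr.mk_snoc c b' f).symm)
      rw [← i]
      refine Eq.trans ?_ ((Arr.append_snoc _ (Arr.nil X H b) (f ≫ snd _ _)).trans
        (congrArg (Arr.snoc · _) (Arr.append_nil _)))
      refine congrArg₂ Arr.append (congrArg (Arr.mk _) ?_) ?_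
      · refine (Category.assoc _ _ _).symm.trans ((congrArg (· ≫ _)
          ((congrArg (· ≫ fst _ _) e).trans (lift_fst _ _))).trans ?_)
        rw [Category.assoc, Category.assoc]
      · refine (congrArg (Arr.mk _) ((Category.assoc _ _ _).symm.trans ((congrArg (· ≫ snd _ _)
          ((congrArg (· ≫ snd _ _) e).trans (lift_snd _ _))).trans (lift_snd _ _)))).trans ?_
        exact mk_alongOne _

theorem fcMap_unit_mul (a b : S) :
    fcMap (fun a => a) (fcUnit H O) a b ≫ fcMul H O a b = 𝟙 (fcHom O.P H a b) := by
  refine fcCell_ext fun {X n} p c f => ?_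
  rw [Category.comp_id, ← Category.assoc, fcCell_map_id, ← singlesElt_eval, ← Category.assoc,
    fcCell_mul, Category.assoc, Category.assoc, singlesElt_labels]
  refine fcCell_congr (singlesElt_arrows c f) fun e' => ?_
  have u := O.comp_unit n
  have e₁ : lift p (f ≫ toUnit _ ≫ tensUnits O.P O.unit n) =
      p ≫ lift (𝟙 (O.P n)) (toUnit (O.P n) ≫ tensUnits O.P O.unit n) := by
    ext <;> simp
  rw [e₁, Category.assoc, Category.assoc, reassoc_of% u, eqToHom_trans, eqToHom_refl,
    Category.comp_id]


end Free

section Assoc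

variable {V : Type (u + 1)} [Category.{u} V] [CartesianMonoidalCategory V] {S : Type u}

def NChain.append {n : ℕ} {a b : S} {c : Chain n a b} {L : Ar n} (N : NChain c L) :
    {m : ℕ} → {b' : S} → {d : Chain m b b'} → {K : Ar m} → NChain d K →
      NChain (c.append d) (L.append K)
  | _, _, _, _, NChain.nil _ => N
  | _, _, _, _, NChain.snoc N' l => (append N N').snoc l

/-- A family of families of chains, of the lengths prescribed by `M`. -/
inductive NNChain : {n : ℕ} → {a b : S} → {c : Chain n a b} → {L : Ar n} → NChain c L → NAr L →
    Type u
  | nil (a : S) : NNChain (NChain.nil a) NAr.nil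
  | snoc {n k : ℕ} {a b b' : S} {c : Chain n a b} {L : Ar n} {N : NChain c L} {M : NAr L}
      (NN : NNChain N M) {l : Chain k b b'} {K : Ar k} (N' : NChain l K) :
      NNChain (N.snoc l) (M.snoc K)

namespace NNChain

def flatten : {n : ℕ} → {a b : S} → {c : Chain n a b} → {L : Ar n} → {N : NChain c L} →
    {M : NAr L} → NNChain N M → NChain N.flatten M.flatten
  | _, _, _, _, _, _, _, nil a => NChain.nil a
  | _, _, _, _, _, _, _, snoc NN N' => (flatten NN).append N'

def inner : {n : ℕ} → {a b : S} → {c : Chain n a b} → {L : Ar n} → {N : NChain c L} →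
    {M : NAr L} → NNChain N M → NChain c M.sums
  | _, _, _, _, _, _, _, nil a => NChain.nil a
  | _, _, _, _, _, _, _, snoc NN N' => (inner NN).snoc N'.flatten

end NNChain

variable (P : ℕ → V) (H : S → S → V)

def nestJoin {n : ℕ} {a b : S} {c : Chain n a b} {L : Ar n} (N : NChain c L) :
    {m : ℕ} → {b' : S} → {d : Chain m b b'} → {K : Ar m} → (N' : NChain d K) →
      (nest P H N ⊗ nest P H N' ⟶ nest P H (N.append N'))
  | _, _, _, _, NChain.nil _ => fst _ _
  | _, _, _, _, NChain.snoc N' _ =>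
      lift (lift (fst _ _) (snd _ _ ≫ fst _ _) ≫ nestJoin N N') (snd _ _ ≫ snd _ _)

def nest2 : {n : ℕ} → {a b : S} → {c : Chain n a b} → {L : Ar n} → {N : NChain c L} →
    {M : NAr L} → NNChain N M → V
  | _, _, _, _, _, _, _, NNChain.nil _ => 𝟙_ V
  | _, _, _, _, _, _, _, @NNChain.snoc _ _ k _ _ _ _ _ _ _ NN _ _ N' =>
      nest2 NN ⊗ (P k ⊗ nest P H N')

def flat2 : {n : ℕ} → {a b : S} → {c : Chain n a b} → {L : Ar n} → {N : NChain c L} →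
    {M : NAr L} → (NN : NNChain N M) → (nest2 P H NN ⟶ nest P H NN.flatten)
  | _, _, _, _, _, _, _, NNChain.nil _ => 𝟙 _
  | _, _, _, _, _, _, _, NNChain.snoc NN N' =>
      (flat2 NN ⊗ₘ snd _ _) ≫ nestJoin P H NN.flatten N'

def toNestTens : {n : ℕ} → {a b : S} → {c : Chain n a b} → {L : Ar n} → {N : NChain c L} →
    {M : NAr L} → (NN : NNChain N M) → (nest2 P H NN ⟶ nestTens P M)
  | _, _, _, _, _, _, _, NNChain.nil _ => 𝟙 _
  | _, _, _, _, _, _, _, NNChain.snoc NN N' => toNestTens NN ⊗ₘ (_ ◁ labels P H N')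

variable {P H}

theorem nestJoin_eval {H' : S → S → V}
    (γ : ∀ {k : ℕ} {a b : S} (l : Chain k a b), P k ⊗ along H l ⟶ H' a b)
    {n : ℕ} {a b : S} {c : Chain n a b} {L : Ar n} (N : NChain c L)
    {m : ℕ} {b' : S} {d : Chain m b b'} {K : Ar m} (N' : NChain d K) :
    nestJoin P H N N' ≫ nestEval γ (N.append N') =
      (nestEval γ N ⊗ₘ nestEval γ N') ≫ alongJoin H' c d := by
  induction N' with
  | nil a =>
      show fst _ _ ≫ nestEval γ N = (nestEval γ N ⊗ₘ 𝟙 (𝟙_ V)) ≫ fst _ _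
      rw [tensorHom_fst]
  | @snoc m k b b'' b' d K N' l ih =>
      show lift (lift (fst (nest P H N) (nest P H N' ⊗ (P k ⊗ along H l))) (snd _ _ ≫ fst _ _) ≫
          nestJoin P H N N') (snd _ _ ≫ snd _ _) ≫ (nestEval γ (N.append N') ⊗ₘ γ l) =
        (nestEval γ N ⊗ₘ (nestEval γ N' ⊗ₘ γ l)) ≫
          lift (lift (fst _ _) (snd _ _ ≫ fst _ _) ≫ alongJoin H' c d) (snd _ _ ≫ snd _ _)
      rw [lift_map, comp_lift, Category.assoc, ih N]
      ext
      · rw [lift_fst, lift_fst, ← Category.assoc, ← Category.assoc]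
        congr 1
        ext <;> simp
      · simp

theorem nestJoin_labels {n : ℕ} {a b : S} {c : Chain n a b} {L : Ar n} (N : NChain c L)
    {m : ℕ} {b' : S} {d : Chain m b b'} {K : Ar m} (N' : NChain d K) :
    nestJoin P H N N' ≫ labels P H (N.append N') =
      (labels P H N ⊗ₘ labels P H N') ≫ tensJoin P L K := by
  induction N' with
  | nil a =>
      show fst _ _ ≫ labels P H N = (labels P H N ⊗ₘ 𝟙 (𝟙_ V)) ≫ fst _ _
      rw [tensorHom_fst]
  | @snoc m k b b'' b' d K N' l ih =>
      show lift (lift (fst (nest P H N) (nest P H N' ⊗ (P k ⊗ along H l))) (snd _ _ ≫ fst _ _) ≫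
          nestJoin P H N N') (snd _ _ ≫ snd _ _) ≫ (labels P H (N.append N') ⊗ₘ fst _ _) =
        (labels P H N ⊗ₘ (labels P H N' ⊗ₘ fst _ _)) ≫
          lift (lift (fst _ _) (snd _ _ ≫ fst _ _) ≫ tensJoin P L K) (snd _ _ ≫ snd _ _)
      rw [lift_map, comp_lift, Category.assoc, ih N]
      ext
      · rw [lift_fst, lift_fst, ← Category.assoc, ← Category.assoc]
        congr 1
        ext <;> simp
      · simp

theorem nestJoin_arrows {X : V} {n : ℕ} {a b : S} {c : Chain n a b} {L : Ar n} (N : NChain c L)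
    {m : ℕ} {b' : S} {d : Chain m b b'} {K : Ar m} (N' : NChain d K)
    (f : X ⟶ nest P H N) (g : X ⟶ nest P H N') :
    Arr.mk (N.append N').flatten ((lift f g ≫ nestJoin P H N N') ≫ arrows P H (N.append N')) =
      (Arr.mk N.flatten (f ≫ arrows P H N)).append (Arr.mk N'.flatten (g ≫ arrows P H N')) := by
  induction N' with
  | nil a =>
      refine Eq.trans ?_ ((congrArg (Arr.append _) (arr_arrows_nil a g)).trans
        (Arr.append_nil _)).symm
      exact congrArg (fun y => Arr.mk N.flatten (y ≫ arrows P H N)) (lift_fst _ _)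
  | @snoc m k b b'' b' d K N' l ih =>
      revert g
      intro (g : X ⟶ nest P H N' ⊗ (P k ⊗ along H l))
      have e : lift f g ≫ lift (lift (fst (nest P H N) (nest P H N' ⊗ (P k ⊗ along H l)))
          (snd _ _ ≫ fst _ _) ≫ nestJoin P H N N') (snd _ _ ≫ snd _ _) =
          lift (lift f (g ≫ fst _ _) ≫ nestJoin P H N N') (g ≫ snd _ _) := by
        rw [comp_lift]
        congr 1
        · rw [← Category.assoc, comp_lift]
          congr 1
          simp
        · simp
      refine (arr_arrows_snoc (P := P) (H := H) (N.append N') l (lift f g ≫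
        lift (lift (fst (nest P H N) (nest P H N' ⊗ (P k ⊗ along H l)))
          (snd _ _ ≫ fst _ _) ≫ nestJoin P H N N') (snd _ _ ≫ snd _ _))).trans ?_
      rw [e]
      refine Eq.trans ?_ (congrArg (Arr.append _) (arr_arrows_snoc N' l g)).symm
      rw [← Arr.append_assoc]
      refine congrArg₂ Arr.append ?_ ?_
      · have i := ih N f (g ≫ fst _ _)
        rw [Category.assoc g] at i
        rw [← i, lift_fst_assoc]
      · rw [lift_snd_assoc, Category.assoc]

theorem toNestTens_flat {n : ℕ} {a b : S} {c : Chain n a b} {L : Ar n} {N : NChain c L}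
    {M : NAr L} (NN : NNChain N M) :
    flat2 P H NN ≫ labels P H NN.flatten = toNestTens P H NN ≫ nestFlat P M := by
  induction NN with
  | nil a => exact toUnit_unique _ _
  | @snoc n k a b b' c L N M NN l K N' ih =>
      show ((flat2 P H NN ⊗ₘ snd (P k) _) ≫ nestJoin P H NN.flatten N') ≫ labels P H _ =
        (toNestTens P H NN ⊗ₘ (_ ◁ labels P H N')) ≫ (nestFlat P M ⊗ₘ snd _ _) ≫
          tensJoin P M.flatten K
      refine (Category.assoc _ _ _).trans ((congrArg _ (nestJoin_labels NN.flatten N')).trans ?_)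
      rw [← Category.assoc, ← Category.assoc, tensorHom_comp_tensorHom, tensorHom_comp_tensorHom,
        ih, whiskerLeft_snd]

variable (O : Operad V)

variable (H) in
def inner2 : {n : ℕ} → {a b : S} → {c : Chain n a b} → {L : Ar n} → {N : NChain c L} →
    {M : NAr L} → (NN : NNChain N M) → (nest2 O.P H NN ⟶ nest O.P H NN.inner)
  | _, _, _, _, _, _, _, NNChain.nil _ => 𝟙 _
  | _, _, _, _, _, _, _, @NNChain.snoc _ _ _ _ _ _ _ _ _ _ NN _ K N' =>
      inner2 NN ⊗ₘ lift (_ ◁ labels O.P H N' ≫ O.comp K) (snd _ _ ≫ arrows O.P H N')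

theorem toNestTens_comp {n : ℕ} {a b : S} {c : Chain n a b} {L : Ar n} {N : NChain c L}
    {M : NAr L} (NN : NNChain N M) :
    inner2 H O NN ≫ labels O.P H NN.inner = toNestTens O.P H NN ≫ nestComp O.P O.comp M := by
  induction NN with
  | nil a => exact toUnit_unique _ _
  | @snoc n k a b b' c L N M NN l K N' ih =>
      show (inner2 H O NN ⊗ₘ lift (O.P k ◁ labels O.P H N' ≫ O.comp K) (snd _ _ ≫ arrows O.P H N'))
          ≫ (labels O.P H NN.inner ⊗ₘ fst _ _) =
        (toNestTens O.P H NN ⊗ₘ (_ ◁ labels O.P H N')) ≫ (nestComp O.P O.comp M ⊗ₘ O.comp K)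
      rw [tensorHom_comp_tensorHom, tensorHom_comp_tensorHom, ih, lift_fst]

theorem flat2_inner2_arrows {X : V} {n : ℕ} {a b : S} {c : Chain n a b} {L : Ar n}
    {N : NChain c L} {M : NAr L} (NN : NNChain N M) (y : X ⟶ nest2 O.P H NN) :
    Arr.mk NN.flatten.flatten ((y ≫ flat2 O.P H NN) ≫ arrows O.P H NN.flatten) =
      Arr.mk NN.inner.flatten ((y ≫ inner2 H O NN) ≫ arrows O.P H NN.inner) := by
  induction NN with
  | nil a => exact (Arr.mk_nil _).trans (Arr.mk_nil _).symm
  | @snoc n k a b b' c L N M NN l K N' ih =>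
      revert y
      intro (y : X ⟶ nest2 O.P H NN ⊗ (O.P k ⊗ nest O.P H N'))
      have e : y ≫ (flat2 O.P H NN ⊗ₘ snd _ _) ≫ nestJoin O.P H NN.flatten N' =
          lift ((y ≫ fst _ _) ≫ flat2 O.P H NN) (y ≫ snd _ _ ≫ snd _ _) ≫
            nestJoin O.P H NN.flatten N' := by
        rw [← Category.assoc]
        congr 1
        ext <;> simp
      refine (congrArg (fun z => Arr.mk (NN.flatten.append N').flatten (z ≫ arrows O.P H _)) e).trans
        ((nestJoin_arrows NN.flatten N' _ _).trans ?_)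
      rw [ih (y ≫ fst _ _)]
      refine Eq.trans ?_ (arr_arrows_snoc (P := O.P) (H := H) NN.inner N'.flatten (y ≫
        (inner2 H O NN ⊗ₘ lift (O.P k ◁ labels O.P H N' ≫ O.comp K)
          (snd _ _ ≫ arrows O.P H N')))).symm
      refine congrArg₂ Arr.append (congrArg (Arr.mk _) ?_) (congrArg (Arr.mk _) ?_) <;> simp

variable [CoprodDistrib V]

variable (P H) in
def eval2 : {n : ℕ} → {a b : S} → {c : Chain n a b} → {L : Ar n} → {N : NChain c L} →
    {M : NAr L} → (NN : NNChain N M) → (nest2 P H NN ⟶ nest P (fcHom P H) N)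
  | _, _, _, _, _, _, _, NNChain.nil _ => 𝟙 _
  | _, _, _, _, _, _, _, NNChain.snoc NN N' => eval2 NN ⊗ₘ (_ ◁ nestEval (fcInj P H) N')

theorem eval2_labels {n : ℕ} {a b : S} {c : Chain n a b} {L : Ar n} {N : NChain c L}
    {M : NAr L} (NN : NNChain N M) :
    eval2 P H NN ≫ labels P (fcHom P H) N = toNestTens P H NN ≫ nestLabels P M := by
  induction NN with
  | nil a => exact toUnit_unique _ _
  | @snoc n k a b b' c L N M NN l K N' ih =>
      show (eval2 P H NN ⊗ₘ (P k ◁ nestEval (fcInj P H) N')) ≫ (labels P (fcHom P H) N ⊗ₘ fst _ _) =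
        (toNestTens P H NN ⊗ₘ (P k ◁ labels P H N')) ≫ (nestLabels P M ⊗ₘ fst _ _)
      rw [tensorHom_comp_tensorHom, tensorHom_comp_tensorHom, ih, whiskerLeft_fst, whiskerLeft_fst]

theorem eval2_arrows {n : ℕ} {a b : S} {c : Chain n a b} {L : Ar n} {N : NChain c L}
    {M : NAr L} (NN : NNChain N M) :
    eval2 P H NN ≫ arrows P (fcHom P H) N = flat2 P H NN ≫ nestEval (fcInj P H) NN.flatten := by
  induction NN with
  | nil a => exact toUnit_unique _ _
  | @snoc n k a b b' c L N M NN l K N' ih =>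
      show (eval2 P H NN ⊗ₘ (P k ◁ nestEval (fcInj P H) N')) ≫
          (arrows P (fcHom P H) N ⊗ₘ snd _ _) ≫ alongJoin _ N.flatten l =
        ((flat2 P H NN ⊗ₘ snd _ _) ≫ nestJoin P H NN.flatten N') ≫ nestEval _ _
      refine Eq.trans ?_ ((Category.assoc _ _ _).trans
        (congrArg _ (nestJoin_eval (fcInj P H) NN.flatten N'))).symm
      rw [← Category.assoc, ← Category.assoc, tensorHom_comp_tensorHom, tensorHom_comp_tensorHom,
        ih, whiskerLeft_snd]

theorem eval2_mul {n : ℕ} {a b : S} {c : Chain n a b} {L : Ar n} {N : NChain c L}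
    {M : NAr L} (NN : NNChain N M) :
    eval2 O.P H NN ≫ nestEval (fcInj O.P (fcHom O.P H)) N ≫ alongHom (fcMul H O) c =
      inner2 H O NN ≫ nestEval (fcInj O.P H) NN.inner := by
  induction NN with
  | nil a => exact toUnit_unique _ _
  | @snoc n k a b b' c L N M NN l K N' ih =>
      show (eval2 O.P H NN ⊗ₘ (O.P k ◁ nestEval (fcInj O.P H) N')) ≫
          (nestEval (fcInj O.P (fcHom O.P H)) N ⊗ₘ fcInj O.P (fcHom O.P H) l) ≫
            (alongHom (fcMul H O) c ⊗ₘ fcMul H O b b') =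
        (inner2 H O NN ⊗ₘ lift (O.P k ◁ labels O.P H N' ≫ O.comp K) (snd _ _ ≫ arrows O.P H N')) ≫
          (nestEval (fcInj O.P H) NN.inner ⊗ₘ fcInj O.P H N'.flatten)
      rw [tensorHom_comp_tensorHom, tensorHom_comp_tensorHom, tensorHom_comp_tensorHom, ih]
      congr 1
      rw [fcMul, fcInj_desc, nestEval_alongDesc]

theorem nest_ext {n : ℕ} {a b : S} {c : Chain n a b} {L : Ar n} (N : NChain c L) :
    ∀ {Y Z : V} {f g : Y ⊗ nest P (fcHom P H) N ⟶ Z},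
      (∀ {M : NAr L} (NN : NNChain N M), Y ◁ eval2 P H NN ≫ f = Y ◁ eval2 P H NN ≫ g) →
        f = g := by
  induction N with
  | nil a =>
      intro Y Z f g h
      have := h (NNChain.nil a)
      have e : Y ◁ eval2 P H (NNChain.nil a) = 𝟙 _ := whiskerLeft_id _ _
      rw [e] at this
      exact (Category.id_comp _).symm.trans (this.trans (Category.id_comp _))
  | @snoc n k a b b' c L N l ih =>
      intro Y Z (f : Y ⊗ (nest P (fcHom P H) N ⊗ (P k ⊗ along (fcHom P H) l)) ⟶ Z)
        (g : Y ⊗ (nest P (fcHom P H) N ⊗ (P k ⊗ along (fcHom P H) l)) ⟶ Z) h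
      have h' : ∀ {M : NAr L} (NN : NNChain N M) {K : Ar k} (N' : NChain l K),
          Y ◁ (eval2 P H NN ⊗ₘ (P k ◁ nestEval (fcInj P H) N')) ≫ f =
            Y ◁ (eval2 P H NN ⊗ₘ (P k ◁ nestEval (fcInj P H) N')) ≫ g :=
        fun {M} NN {K} N' => h (NN.snoc N')
      let r : ((Y ⊗ nest P (fcHom P H) N) ⊗ P k) ⊗ along (fcHom P H) l ⟶
          Y ⊗ (nest P (fcHom P H) N ⊗ (P k ⊗ along (fcHom P H) l)) :=
        lift (fst _ _ ≫ fst _ _ ≫ fst _ _) (lift (fst _ _ ≫ fst _ _ ≫ snd _ _)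
          (lift (fst _ _ ≫ snd _ _) (snd _ _)))
      let s : Y ⊗ (nest P (fcHom P H) N ⊗ (P k ⊗ along (fcHom P H) l)) ⟶
          ((Y ⊗ nest P (fcHom P H) N) ⊗ P k) ⊗ along (fcHom P H) l :=
        lift (lift (lift (fst _ _) (snd _ _ ≫ fst _ _)) (snd _ _ ≫ snd _ _ ≫ fst _ _))
          (snd _ _ ≫ snd _ _ ≫ snd _ _)
      have sr : s ≫ r = 𝟙 _ := by
        ext <;> simp [s, r]
      suffices r ≫ f = r ≫ g by
        rw [← Category.id_comp f, ← sr, Category.assoc, this, ← Category.assoc, sr,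
          Category.id_comp]
      refine along_ext P H fun {K} N' => ?_
      let t : ((Y ⊗ nest P (fcHom P H) N) ⊗ P k) ⊗ nest P H N' ⟶
          (Y ⊗ (P k ⊗ nest P H N')) ⊗ nest P (fcHom P H) N :=
        lift (lift (fst _ _ ≫ fst _ _ ≫ fst _ _) (lift (fst _ _ ≫ snd _ _) (snd _ _)))
          (fst _ _ ≫ fst _ _ ≫ snd _ _)
      let w : (Y ⊗ (P k ⊗ nest P H N')) ⊗ nest P (fcHom P H) N ⟶
          Y ⊗ (nest P (fcHom P H) N ⊗ (P k ⊗ along (fcHom P H) l)) :=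
        lift (fst _ _ ≫ fst _ _) (lift (snd _ _) (fst _ _ ≫ snd _ _ ≫
          P k ◁ nestEval (fcInj P H) N'))
      have e : ((Y ⊗ nest P (fcHom P H) N) ⊗ P k) ◁ nestEval (fcInj P H) N' ≫ r = t ≫ w := by
        ext <;> simp [t, r, w, -MonoidalCategory.tensor_whiskerLeft]
      rw [← Category.assoc, ← Category.assoc, e, Category.assoc, Category.assoc]
      congr 1
      refine ih fun {M} NN => ?_
      have e' : (Y ⊗ (P k ⊗ nest P H N')) ◁ eval2 P H NN ≫ w =
          lift (fst _ _ ≫ fst _ _) (lift (snd _ _) (fst _ _ ≫ snd _ _)) ≫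
            Y ◁ (eval2 P H NN ⊗ₘ (P k ◁ nestEval (fcInj P H) N')) := by
        ext <;> simp [w, -MonoidalCategory.tensor_whiskerLeft]
      rw [← Category.assoc, ← Category.assoc, e', Category.assoc, Category.assoc, h']

theorem fcCell_ext₃ {a b : S} {Z : V} {f g : fcHom P (fcHom P (fcHom P H)) a b ⟶ Z}
    (h : ∀ {X : V} {n : ℕ} (p : X ⟶ P n) {c : Chain n a b} {L : Ar n} {N : NChain c L}
      {M : NAr L} (NN : NNChain N M) (y : X ⟶ nest2 P H NN),
        fcCell p c ((y ≫ eval2 P H NN) ≫ nestEval (fcInj P (fcHom P H)) N) ≫ f =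
        fcCell p c ((y ≫ eval2 P H NN) ≫ nestEval (fcInj P (fcHom P H)) N) ≫ g) : f = g := by
  refine fcHom_ext fun {n} c => along_ext P (fcHom P H) fun {L} N => nest_ext N fun {M} NN => ?_
  have w : P n ◁ eval2 P H NN ≫ P n ◁ nestEval (fcInj P (fcHom P H)) N ≫
      fcInj P (fcHom P (fcHom P H)) c =
      fcCell (fst _ _) c ((snd _ _ ≫ eval2 P H NN) ≫ nestEval (fcInj P (fcHom P H)) N) := by
    rw [← Category.assoc]
    refine congrArg (· ≫ fcInj P (fcHom P (fcHom P H)) c) ?_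
    ext <;> simp
  have := h (fst _ _) NN (snd _ _)
  rw [← w] at this
  simpa only [Category.assoc] using this

theorem fcMul_assoc (a b : S) :
    fcMap (fun a => a) (fcMul H O) a b ≫ fcMul H O a b =
      fcMul (fcHom O.P H) O a b ≫ fcMul H O a b := by
  refine fcCell_ext₃ fun {X n} p {c L N M} NN y => ?_
  have e₁ : ((y ≫ eval2 O.P H NN) ≫ nestEval (fcInj O.P (fcHom O.P H)) N) ≫
      alongHom (fcMul H O) c = (y ≫ inner2 H O NN) ≫ nestEval (fcInj O.P H) NN.inner := by
    simp only [Category.assoc, eval2_mul]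
  have e₂ : (y ≫ eval2 O.P H NN) ≫ arrows O.P (fcHom O.P H) N =
      (y ≫ flat2 O.P H NN) ≫ nestEval (fcInj O.P H) NN.flatten := by
    simp only [Category.assoc, eval2_arrows]
  rw [← Category.assoc, ← Category.assoc, fcCell_map_id, e₁, fcCell_mul, fcCell_mul, e₂,
    fcCell_mul]
  refine (fcCell_congr (flat2_inner2_arrows O NN y) fun e' => ?_).symm
  have h := O.comp_assoc M
  have h₁ : lift (lift p ((y ≫ eval2 O.P H NN) ≫ labels O.P (fcHom O.P H) N) ≫ O.comp L)
      ((y ≫ flat2 O.P H NN) ≫ labels O.P H NN.flatten) =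
      lift p (y ≫ toNestTens O.P H NN) ≫
        lift (O.P n ◁ nestLabels O.P M ≫ O.comp L) (snd _ _ ≫ nestFlat O.P M) := by
    rw [Category.assoc, Category.assoc, eval2_labels, toNestTens_flat, comp_lift]
    simp
  have h₂ : lift p ((y ≫ inner2 H O NN) ≫ labels O.P H NN.inner) =
      lift p (y ≫ toNestTens O.P H NN) ≫ O.P n ◁ nestComp O.P O.comp M := by
    rw [Category.assoc, toNestTens_comp]
    simp
  rw [h₁, h₂, Category.assoc, Category.assoc, Category.assoc, h]

end Assoc

section FreeMonad

variable {V : Type (u + 1)} [Category.{u} V] [CartesianMonoidalCategory V] [CoprodDistrib V]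

/-- The underlying graph of the free `(V, P)`-category on a graph: it has the same objects, and
its hom-objects are the coproducts `fcHom`. -/
def fcGraph (P : ℕ → V) (A : VGraph V) : VGraph V :=
  { obj := A.obj, hom := fcHom P A.hom }

/-- The free `(V, P)`-category functor on `V`-graphs. -/
def fcFunctor (P : ℕ → V) : VGraph V ⥤ VGraph V where
  obj A := fcGraph P A
  map {A B} f := VGraph.Hom.mk (A := fcGraph P A) (B := fcGraph P B)
    (VGraph.Hom.obj (A := A) (B := B) f)
    (fcMap (H := A.hom) (H' := B.hom) (VGraph.Hom.obj f) (VGraph.Hom.hom f))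
  map_id A := VGraph.hom_mk_congr (A := fcGraph P A) (B := fcGraph P A) fun a b => fcMap_id a b
  map_comp {A B C} f g := VGraph.hom_mk_congr (A := fcGraph P A) (B := fcGraph P C) fun a b =>
    fcMap_comp (H := A.hom) (H' := B.hom) (H'' := C.hom) (VGraph.Hom.obj f) (VGraph.Hom.hom f)
      (VGraph.Hom.obj g) (VGraph.Hom.hom g) a b

/-- The free `(V, P)`-category monad on `V`-graphs. -/
def fcMonad (O : Operad V) : Monad (VGraph V) where
  toFunctor := fcFunctor O.P
  η :=
    { app := fun A => VGraph.Hom.mk (A := A) (B := fcGraph O.P A) (fun a => a) (fcUnit A.hom O)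
      naturality := fun A B f =>
        VGraph.hom_mk_congr (A := A) (B := fcGraph O.P B) fun a b =>
          fcUnit_naturality (H := A.hom) (H' := B.hom) (VGraph.Hom.obj f) (VGraph.Hom.hom f) a b }
  μ :=
    { app := fun A => VGraph.Hom.mk (A := fcGraph O.P (fcGraph O.P A)) (B := fcGraph O.P A)
        (fun a => a) (fcMul A.hom O)
      naturality := fun A B f =>
        VGraph.hom_mk_congr (A := fcGraph O.P (fcGraph O.P A)) (B := fcGraph O.P B) fun a b =>
          fcMul_naturality (H := A.hom) (H' := B.hom) (VGraph.Hom.obj f) (VGraph.Hom.hom f) a b }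
  assoc A := VGraph.hom_mk_congr (A := fcGraph O.P (fcGraph O.P (fcGraph O.P A)))
    (B := fcGraph O.P A) fun a b => fcMul_assoc (H := A.hom) O a b
  left_unit A := VGraph.hom_mk_congr (A := fcGraph O.P A) (B := fcGraph O.P A)
    fun a b => fcUnit_mul (H := A.hom) a b
  right_unit A := VGraph.hom_mk_congr (A := fcGraph O.P A) (B := fcGraph O.P A)
    fun a b => fcMap_unit_mul (H := A.hom) a b

end FreeMonad

/-! ### The category of `(V, P)`-categories and its products -/

section Maps

variable {V : Type (u + 1)} [Category.{u} V] [CartesianMonoidalCategory V]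

theorem whisker_eq_lift (Z : V) {X Y : V} (f : X ⟶ Y) :
    Z ◁ f = lift (fst Z X) (snd Z X ≫ f) := by
  ext <;> simp

/-- A graph morphism commutes with families of composition maps. -/
def Commutes (P : ℕ → V) {A B : VGraph V}
    (γ : ∀ {n : ℕ} {a b : A.obj} (c : Chain n a b), P n ⊗ along A.hom c ⟶ A.hom a b)
    (γ' : ∀ {n : ℕ} {a b : B.obj} (c : Chain n a b), P n ⊗ along B.hom c ⟶ B.hom a b)
    (F : A ⟶ B) : Prop :=
  ∀ {n : ℕ} {a b : A.obj} (c : Chain n a b),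
    γ c ≫ VGraph.Hom.hom F a b =
      P n ◁ alongMap (VGraph.Hom.obj F) (VGraph.Hom.hom F) c ≫ γ' (c.map (VGraph.Hom.obj F))

variable {P : ℕ → V} {A B C : VGraph V}
    {γ : ∀ {n : ℕ} {a b : A.obj} (c : Chain n a b), P n ⊗ along A.hom c ⟶ A.hom a b}
    {γ' : ∀ {n : ℕ} {a b : B.obj} (c : Chain n a b), P n ⊗ along B.hom c ⟶ B.hom a b}
    {γ'' : ∀ {n : ℕ} {a b : C.obj} (c : Chain n a b), P n ⊗ along C.hom c ⟶ C.hom a b}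

theorem commutes_id : Commutes P γ γ (𝟙 A) := by
  intro n a b c
  rw [whisker_eq_lift]
  refine (Category.comp_id _).trans ((Category.id_comp _).symm.trans ?_)
  rw [← lift_fst_snd]
  exact Arr.ap_congr γ (Arr.map_id (Arr.mk c (snd _ _))).symm fun _ => Category.comp_id _

theorem commutes_comp {F : A ⟶ B} {G : B ⟶ C} (hF : Commutes P γ γ' F)
    (hG : Commutes P γ' γ'' G) : Commutes P γ γ'' (F ≫ G) := by
  intro n a b c
  have e : γ c ≫ VGraph.Hom.hom F a b ≫ VGraph.Hom.hom G _ _ =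
      lift (fst (P n) (along A.hom c)) ((snd _ _ ≫ alongMap (VGraph.Hom.obj F) (VGraph.Hom.hom F) c) ≫
          alongMap (VGraph.Hom.obj G) (VGraph.Hom.hom G) (c.map (VGraph.Hom.obj F))) ≫
        γ'' ((c.map (VGraph.Hom.obj F)).map (VGraph.Hom.obj G)) := by
    rw [← Category.assoc, hF, Category.assoc, hG, ← Category.assoc]
    congr 1
    ext <;> simp
  refine e.trans ?_
  rw [whisker_eq_lift]
  exact Arr.ap_congr γ'' (Arr.map_map (VGraph.Hom.obj F) (VGraph.Hom.hom F) (VGraph.Hom.obj G)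
    (VGraph.Hom.hom G) (Arr.mk c (snd (P n) _))) fun _ => Category.comp_id _

theorem commutes_unit (u' : 𝟙_ V ⟶ P 1) {F : A ⟶ B} (hF : Commutes P γ γ' F)
    (h : ∀ a b : B.obj, lift (toUnit (B.hom a b) ≫ u') (alongOne B.hom a b) ≫
      γ' ((Chain.nil a).snoc b) = 𝟙 (B.hom a b)) (a b : A.obj) :
    (lift (toUnit (A.hom a b) ≫ u') (alongOne A.hom a b) ≫ γ ((Chain.nil a).snoc b)) ≫
      VGraph.Hom.hom F a b = VGraph.Hom.hom F a b := by
  have e := hF ((Chain.nil a).snoc b)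
  rw [Category.assoc, e, lift_whiskerLeft_assoc, alongOne_map]
  show lift (toUnit (A.hom a b) ≫ u') (VGraph.Hom.hom F a b ≫ alongOne B.hom _ _) ≫
    γ' ((Chain.nil (VGraph.Hom.obj F a)).snoc (VGraph.Hom.obj F b)) = _
  have e₂ : lift (toUnit (A.hom a b) ≫ u') (VGraph.Hom.hom F a b ≫ alongOne B.hom _ _) =
      VGraph.Hom.hom F a b ≫ lift (toUnit (B.hom _ _) ≫ u') (alongOne B.hom _ _) := by
    rw [comp_lift, comp_toUnit_assoc]
  rw [e₂, Category.assoc]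
  exact (congrArg _ (h _ _)).trans (Category.comp_id _)

theorem commutes_assoc (comp : ∀ {n : ℕ} (L : Ar n), P n ⊗ tens P L ⟶ P L.sum) {F : A ⟶ B}
    (hF : Commutes P γ γ' F)
    (h : ∀ {n : ℕ} {a b : B.obj} {c : Chain n a b} {L : Ar n} (N : NChain c L),
      lift (P n ◁ labels P B.hom N ≫ comp L) (snd _ _ ≫ arrows P B.hom N) ≫ γ' N.flatten =
      P n ◁ nestEval γ' N ≫ γ' c)
    {n : ℕ} {a b : A.obj} {c : Chain n a b} {L : Ar n} (N : NChain c L) :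
    (lift (P n ◁ labels P A.hom N ≫ comp L) (snd _ _ ≫ arrows P A.hom N) ≫ γ N.flatten) ≫
        VGraph.Hom.hom F a b =
      (P n ◁ nestEval γ N ≫ γ c) ≫ VGraph.Hom.hom F a b := by
  set o := VGraph.Hom.obj F
  set k := VGraph.Hom.hom F
  have e₁ : (lift (P n ◁ labels P A.hom N ≫ comp L) (snd _ _ ≫ arrows P A.hom N) ≫ γ N.flatten) ≫
        VGraph.Hom.hom F a b =
      lift (P n ◁ labels P A.hom N ≫ comp L) ((snd _ _ ≫ arrows P A.hom N) ≫
        alongMap o k N.flatten) ≫ γ' (N.flatten.map o) := by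
    rw [Category.assoc, hF, lift_whiskerLeft_assoc]
  have e₂ : lift (P n ◁ labels P A.hom N ≫ comp L) ((snd _ _ ≫ arrows P A.hom N) ≫
        alongMap o k N.flatten) ≫ γ' (N.flatten.map o) =
      lift (P n ◁ labels P A.hom N ≫ comp L) (snd _ _ ≫ nestMap o k N ≫
        arrows P B.hom (N.map o)) ≫ γ' (N.map o).flatten :=
    Arr.ap_congr γ' (nestMap_arrows o k N (snd _ _)).symm fun _ => Category.comp_id _
  have e₃ : lift (P n ◁ labels P A.hom N ≫ comp L) (snd _ _ ≫ nestMap o k N ≫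
        arrows P B.hom (N.map o)) = P n ◁ nestMap o k N ≫
      lift (P n ◁ labels P B.hom (N.map o) ≫ comp L) (snd _ _ ≫ arrows P B.hom (N.map o)) := by
    rw [comp_lift, ← whiskerLeft_comp_assoc, nestMap_labels, whiskerLeft_snd_assoc]
  refine e₁.trans (e₂.trans ?_)
  rw [e₃, Category.assoc, h, Category.assoc, hF, ← whiskerLeft_comp_assoc,
    ← whiskerLeft_comp_assoc, nestMap_eval o k k γ γ' hF N]

end Maps

namespace PCat

variable {V : Type (u + 1)} [Category.{u} V] [CartesianMonoidalCategory V] {P : Operad V}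

instance : Category.{u} (PCat P) where
  Hom A B := { F : A.graph ⟶ B.graph // IsFunctor A B F }
  id A := ⟨𝟙 A.graph, commutes_id (P := P.P) (γ := A.γ)⟩
  comp {A B C} F G := ⟨F.1 ≫ G.1, commutes_comp (γ := A.γ) (γ' := B.γ) (γ'' := C.γ) F.2 G.2⟩
  id_comp F := Subtype.ext (Category.id_comp _)
  comp_id F := Subtype.ext (Category.comp_id _)
  assoc F G H := Subtype.ext (Category.assoc _ _ _)

variable (P) in
/-- The functor sending a `(V, P)`-category to its underlying graph. -/
def forget : PCat P ⥤ VGraph V where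
  obj A := A.graph
  map F := F.1

variable (P) in
/-- The terminal `(V, P)`-category. -/
def terminal : PCat P where
  graph := VGraph.terminal
  γ _ := toUnit _
  γ_unit _ _ := toUnit_unique _ _
  γ_assoc _ := toUnit_unique _ _

/-- The composition maps of a product. -/
def prodγ (A B : PCat P) {n : ℕ} {a b : (VGraph.prod A.graph B.graph).obj} (c : Chain n a b) :
    P.P n ⊗ along (VGraph.prod A.graph B.graph).hom c ⟶ (VGraph.prod A.graph B.graph).hom a b :=
  lift
    (P.P n ◁ alongMap Prod.fst (fun x y => fst (A.graph.hom x.1 y.1) (B.graph.hom x.2 y.2)) c ≫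
      A.γ (c.map Prod.fst))
    (P.P n ◁ alongMap Prod.snd (fun x y => snd (A.graph.hom x.1 y.1) (B.graph.hom x.2 y.2)) c ≫
      B.γ (c.map Prod.snd))

theorem commutes_fst (A B : PCat P) :
    Commutes P.P (prodγ A B) A.γ (VGraph.prodFst A.graph B.graph) :=
  fun _ => lift_fst _ _

theorem commutes_snd (A B : PCat P) :
    Commutes P.P (prodγ A B) B.γ (VGraph.prodSnd A.graph B.graph) :=
  fun _ => lift_snd _ _

/-- The product of two `(V, P)`-categories, with componentwise composition. -/
def prod (A B : PCat P) : PCat P where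
  graph := VGraph.prod A.graph B.graph
  γ := prodγ A B
  γ_unit a b := by
    refine CartesianMonoidalCategory.hom_ext (X := A.graph.hom a.1 b.1) (Y := B.graph.hom a.2 b.2)
      _ _ ?_ ?_
    · exact (commutes_unit P.unit (commutes_fst A B) A.γ_unit a b).trans (Category.id_comp _).symm
    · exact (commutes_unit P.unit (commutes_snd A B) B.γ_unit a b).trans (Category.id_comp _).symm
  γ_assoc {n a b c L} N := by
    refine CartesianMonoidalCategory.hom_ext (X := A.graph.hom a.1 b.1) (Y := B.graph.hom a.2 b.2)
      _ _ ?_ ?_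
    · exact commutes_assoc P.comp (commutes_fst A B) A.γ_assoc N
    · exact commutes_assoc P.comp (commutes_snd A B) B.γ_assoc N

def prodFst (A B : PCat P) : prod A B ⟶ A := ⟨VGraph.prodFst A.graph B.graph, commutes_fst A B⟩

def prodSnd (A B : PCat P) : prod A B ⟶ B := ⟨VGraph.prodSnd A.graph B.graph, commutes_snd A B⟩

theorem commutes_lift {X A B : PCat P} (F : X ⟶ A) (G : X ⟶ B) :
    Commutes P.P X.γ (prodγ A B) (VGraph.prodLift F.1 G.1) := by
  intro n a b c
  have key : ∀ {C : PCat P} (π : VGraph.prod A.graph B.graph ⟶ C.graph)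
      (hπ : Commutes P.P (prodγ A B) C.γ π) (K : X ⟶ C) (hK : K.1 = VGraph.prodLift F.1 G.1 ≫ π),
      (X.γ c ≫ VGraph.Hom.hom (VGraph.prodLift F.1 G.1) a b) ≫ VGraph.Hom.hom π _ _ =
        (P.P n ◁ alongMap _ (VGraph.Hom.hom (VGraph.prodLift F.1 G.1)) c ≫
          prodγ A B (c.map (VGraph.Hom.obj (VGraph.prodLift F.1 G.1)))) ≫ VGraph.Hom.hom π _ _ := by
    intro C π hπ K hK
    have h : Commutes P.P X.γ C.γ (VGraph.prodLift F.1 G.1 ≫ π) := hK ▸ K.2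
    rw [Category.assoc, Category.assoc, hπ]
    refine (h c).trans ?_
    rw [whisker_eq_lift, ← whiskerLeft_comp_assoc, whisker_eq_lift, ← Category.assoc]
    exact Arr.ap_congr C.γ (Arr.map_map (VGraph.Hom.obj (VGraph.prodLift F.1 G.1))
      (VGraph.Hom.hom (VGraph.prodLift F.1 G.1)) (VGraph.Hom.obj π) (VGraph.Hom.hom π)
      (Arr.mk c (snd (P.P n) _))).symm fun _ => Category.comp_id _
  refine CartesianMonoidalCategory.hom_ext (X := A.graph.hom _ _) (Y := B.graph.hom _ _)
      _ _ ?_ ?_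
  · exact key (VGraph.prodFst A.graph B.graph) (commutes_fst A B) F
      (VGraph.hom_mk_congr fun _ _ => (lift_fst _ _).symm)
  · exact key (VGraph.prodSnd A.graph B.graph) (commutes_snd A B) G
      (VGraph.hom_mk_congr fun _ _ => (lift_snd _ _).symm)

def prodLift {X A B : PCat P} (F : X ⟶ A) (G : X ⟶ B) : X ⟶ prod A B :=
  ⟨VGraph.prodLift F.1 G.1, commutes_lift F G⟩

instance cartesian : CartesianMonoidalCategory (PCat P) :=
  CartesianMonoidalCategory.ofChosenFiniteProducts
    { cone := asEmptyCone (terminal P)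
      isLimit := IsTerminal.ofUniqueHom
        (fun A => ⟨{ obj := fun _ => PUnit.unit, hom := fun _ _ => toUnit _ },
          fun _ => toUnit_unique _ _⟩)
        (fun _ m => Subtype.ext (VGraph.hom_mk_congr fun _ _ => toUnit_unique _ _)) }
    (fun A B =>
      { cone := BinaryFan.mk (prodFst A B) (prodSnd A B)
        isLimit := BinaryFan.isLimitMk (fun s => prodLift s.fst s.snd)
          (fun s => Subtype.ext (VGraph.hom_mk_congr (h := fun a b => _) fun a b => lift_fst _ _))
          (fun s => Subtype.ext (VGraph.hom_mk_congr (h := fun a b => _) fun a b => lift_snd _ _))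
          (fun s m h₁ h₂ => by
            have e₁ : m ≫ prodFst A B = s.fst := h₁
            have e₂ : m ≫ prodSnd A B = s.snd := h₂
            rw [← e₁, ← e₂]
            exact Subtype.ext (VGraph.hom_mk_congr (h := fun a b => _)
              fun a b => (lift_comp_fst_snd _).symm)) })

end PCat

/-! ### Transport along product-preserving functors -/

/-- A functor preserves finite products. -/
class PreservesProducts {C : Type (u + 1)} [Category.{u} C] [CartesianMonoidalCategory C]
    {D : Type (u + 1)} [Category.{u} D] [CartesianMonoidalCategory D] (F : C ⥤ D) : Prop where
  unit : IsIso (toUnit (F.obj (𝟙_ C)))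
  prod : ∀ A B : C, IsIso (lift (F.map (fst A B)) (F.map (snd A B)))

attribute [instance] PreservesProducts.unit PreservesProducts.prod

section Transport

variable {C : Type (u + 1)} [Category.{u} C] [CartesianMonoidalCategory C]
  {D : Type (u + 1)} [Category.{u} D] [CartesianMonoidalCategory D] (F : C ⥤ D)

/-- The canonical map `F(P(k_1) × ⋯ × P(k_n)) ⟶ F(P(k_1)) × ⋯ × F(P(k_n))`. -/
def tensCmp (P : ℕ → C) : {n : ℕ} → (L : Ar n) → (F.obj (tens P L) ⟶ tens (fun k => F.obj (P k)) L)
  | _, Ar.nil => toUnit _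
  | _, Ar.snoc L k => lift (F.map (fst (tens P L) (P k)) ≫ tensCmp P L) (F.map (snd (tens P L) (P k)))

/-- The canonical map from `F` of the product along a chain to the product of the `F(H(a, b))`. -/
def alongCmp {S : Type u} (H : S → S → C) :
    {n : ℕ} → {a b : S} → (c : Chain n a b) →
      (F.obj (along H c) ⟶ along (fun a b => F.obj (H a b)) c)
  | _, _, _, Chain.nil _ => toUnit _
  | _, _, _, @Chain.snoc _ _ _ b c b' =>
      lift (F.map (fst (along H c) (H b b')) ≫ alongCmp H c) (F.map (snd (along H c) (H b b')))

def nestCmp (P : ℕ → C) : {n : ℕ} → {L : Ar n} → (M : NAr L) →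
    (F.obj (nestTens P M) ⟶ nestTens (fun k => F.obj (P k)) M)
  | _, _, NAr.nil => toUnit _
  | _, _, @NAr.snoc _ k _ M K =>
      lift (F.map (fst (nestTens P M) (P k ⊗ tens P K)) ≫ nestCmp P M)
        (lift (F.map (snd (nestTens P M) (P k ⊗ tens P K) ≫ fst _ _))
          (F.map (snd (nestTens P M) (P k ⊗ tens P K) ≫ snd _ _) ≫ tensCmp F P K))

/-- For `f : F(Y) ⟶ Y'`, the map `F(X × Y) ⟶ F(X) × Y'`. -/
def pairCmp (X : C) {Y : C} {Y' : D} (f : F.obj Y ⟶ Y') : F.obj (X ⊗ Y) ⟶ F.obj X ⊗ Y' :=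
  lift (F.map (fst X Y)) (F.map (snd X Y) ≫ f)

theorem pairCmp_isIso [PreservesProducts F] (X : C) {Y : C} {Y' : D} (f : F.obj Y ⟶ Y') [IsIso f] :
    IsIso (pairCmp F X f) := by
  have : pairCmp F X f = lift (F.map (fst X Y)) (F.map (snd X Y)) ≫ F.obj X ◁ f := by
    rw [pairCmp, lift_whiskerLeft]
  rw [this]
  infer_instance

theorem lift_isIso [PreservesProducts F] {X Y : C} {X' Y' : D} (f : F.obj X ⟶ X')
    (g : F.obj Y ⟶ Y') [IsIso f] [IsIso g] :
    IsIso (lift (F.map (fst X Y) ≫ f) (F.map (snd X Y) ≫ g)) := by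
  rw [← lift_map]
  infer_instance

theorem tensCmp_isIso [PreservesProducts F] (P : ℕ → C) {n : ℕ} (L : Ar n) :
    IsIso (tensCmp F P L) := by
  induction L with
  | nil => exact PreservesProducts.unit
  | snoc L k ih =>
      have := lift_isIso F (tensCmp F P L) (𝟙 (F.obj (P k)))
      rw [Category.comp_id] at this
      exact this

theorem alongCmp_isIso [PreservesProducts F] {S : Type u} (H : S → S → C) {n : ℕ} {a b : S}
    (c : Chain n a b) : IsIso (alongCmp F H c) := by
  induction c with
  | nil => exact PreservesProducts.unit
  | @snoc n a b c b' ih =>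
      have := lift_isIso F (alongCmp F H c) (𝟙 (F.obj (H b b')))
      rw [Category.comp_id] at this
      exact this

theorem nestCmp_isIso [PreservesProducts F] (P : ℕ → C) {n : ℕ} {L : Ar n} (M : NAr L) :
    IsIso (nestCmp F P M) := by
  induction M with
  | nil => exact PreservesProducts.unit
  | @snoc n k L M K ih =>
      have := tensCmp_isIso F P K
      have := pairCmp_isIso F (P k) (tensCmp F P K)
      have := lift_isIso F (nestCmp F P M) (pairCmp F (P k) (tensCmp F P K))
      rw [pairCmp, comp_lift, ← Category.assoc, ← F.map_comp, ← F.map_comp] at this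
      exact this

theorem tensCmp_one (P : ℕ → C) (k : ℕ) :
    F.map (tensOne P k) ≫ tensCmp F P (Ar.nil.snoc k) = tensOne (fun k => F.obj (P k)) k := by
  refine CartesianMonoidalCategory.hom_ext (X := 𝟙_ D) (Y := F.obj (P k)) _ _
    (toUnit_unique _ _) ?_
  show (F.map (lift (toUnit (P k) : P k ⟶ 𝟙_ C) (𝟙 (P k))) ≫
    lift (F.map (fst (𝟙_ C) (P k)) ≫ tensCmp F P Ar.nil) (F.map (snd (𝟙_ C) (P k)))) ≫ snd _ _ =
      lift (toUnit (F.obj (P k)) : _ ⟶ 𝟙_ D) (𝟙 (F.obj (P k))) ≫ snd _ _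
  rw [Category.assoc, lift_snd, lift_snd, ← F.map_comp, lift_snd, F.map_id]

theorem tensCmp_join (P : ℕ → C) {n : ℕ} (L : Ar n) {m : ℕ} (K : Ar m) :
    F.map (tensJoin P L K) ≫ tensCmp F P (L.append K) =
      lift (F.map (fst _ _) ≫ tensCmp F P L) (F.map (snd _ _) ≫ tensCmp F P K) ≫
        tensJoin (fun k => F.obj (P k)) L K := by
  induction K with
  | nil => exact (lift_fst _ _).symm
  | @snoc m K k ih =>
      show F.map (lift (lift (fst (tens P L) (tens P K ⊗ P k)) (snd _ _ ≫ fst _ _) ≫ tensJoin P L K)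
          (snd _ _ ≫ snd _ _)) ≫
          lift (F.map (fst (tens P (L.append K)) (P k)) ≫ tensCmp F P (L.append K))
            (F.map (snd (tens P (L.append K)) (P k))) =
        lift (F.map (fst (tens P L) (tens P K ⊗ P k)) ≫ tensCmp F P L)
            (F.map (snd (tens P L) (tens P K ⊗ P k)) ≫
              lift (F.map (fst (tens P K) (P k)) ≫ tensCmp F P K) (F.map (snd (tens P K) (P k)))) ≫
          lift (lift (fst _ _) (snd _ _ ≫ fst _ _) ≫ tensJoin (fun k => F.obj (P k)) L K)
            (snd _ _ ≫ snd _ _)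
      rw [comp_lift, comp_lift, ← F.map_comp_assoc, lift_fst, F.map_comp, Category.assoc, ih,
        ← F.map_comp, lift_snd]
      congr 1
      · rw [← Category.assoc, ← Category.assoc]
        congr 1
        rw [comp_lift, comp_lift, ← F.map_comp_assoc, ← F.map_comp_assoc, lift_fst, lift_fst,
          lift_snd, lift_snd_assoc, Category.assoc (F.map _), lift_fst, F.map_comp_assoc]
      · rw [lift_snd_assoc, Category.assoc, lift_snd, F.map_comp]

variable [PreservesProducts F]

def mapUnit (O : Operad C) : 𝟙_ D ⟶ F.obj (O.P 1) :=
  inv (toUnit (F.obj (𝟙_ C))) ≫ F.map O.unit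

def mapComp (O : Operad C) {n : ℕ} (L : Ar n) :
    F.obj (O.P n) ⊗ tens (fun k => F.obj (O.P k)) L ⟶ F.obj (O.P L.sum) :=
  have := tensCmp_isIso F O.P L
  have := pairCmp_isIso F (O.P n) (tensCmp F O.P L)
  inv (pairCmp F (O.P n) (tensCmp F O.P L)) ≫ F.map (O.comp L)

theorem pairCmp_mapComp (O : Operad C) {n : ℕ} (L : Ar n) :
    pairCmp F (O.P n) (tensCmp F O.P L) ≫ mapComp F O L = F.map (O.comp L) := by
  have := tensCmp_isIso F O.P L
  have := pairCmp_isIso F (O.P n) (tensCmp F O.P L)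
  exact IsIso.hom_inv_id_assoc _ _

theorem map_lift_pairCmp {X Y Z : C} {Y' : D} (f : F.obj Y ⟶ Y') (p : Z ⟶ X) (q : Z ⟶ Y) :
    F.map (lift p q) ≫ pairCmp F X f = lift (F.map p) (F.map q ≫ f) := by
  rw [pairCmp, comp_lift, ← F.map_comp, lift_fst, ← F.map_comp_assoc, lift_snd]

theorem lift_mapComp (O : Operad C) {n : ℕ} (L : Ar n) {X : C} (p : X ⟶ O.P n)
    (q : X ⟶ tens O.P L) :
    lift (F.map p) (F.map q ≫ tensCmp F O.P L) ≫ mapComp F O L = F.map (lift p q ≫ O.comp L) := by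
  rw [← map_lift_pairCmp, Category.assoc, pairCmp_mapComp, F.map_comp]

theorem map_toUnit (X : C) : F.map (toUnit X) ≫ toUnit (F.obj (𝟙_ C)) = toUnit (F.obj X) :=
  toUnit_unique _ _

theorem map_toUnit_unit (O : Operad C) (X : C) :
    F.map (toUnit X ≫ O.unit) = toUnit (F.obj X) ≫ mapUnit F O := by
  rw [mapUnit, F.map_comp, ← map_toUnit, Category.assoc, IsIso.hom_inv_id_assoc]

theorem map_toUnit_units (O : Operad C) (X : C) (n : ℕ) :
    F.map (toUnit X ≫ tensUnits O.P O.unit n) ≫ tensCmp F O.P (Ar.ones n) =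
      toUnit (F.obj X) ≫ tensUnits (fun k => F.obj (O.P k)) (mapUnit F O) n := by
  induction n with
  | zero => exact toUnit_unique _ _
  | succ n ih =>
      show F.map (toUnit X ≫ lift (tensUnits O.P O.unit n) O.unit) ≫
          lift (F.map (fst (tens O.P (Ar.ones n)) (O.P 1)) ≫ tensCmp F O.P (Ar.ones n))
            (F.map (snd (tens O.P (Ar.ones n)) (O.P 1))) =
        toUnit (F.obj X) ≫ lift (tensUnits (fun k => F.obj (O.P k)) (mapUnit F O) n) (mapUnit F O)
      rw [comp_lift, comp_lift, comp_lift, ← ih, ← map_toUnit_unit, ← F.map_comp_assoc, lift_fst,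
        ← F.map_comp, lift_snd]

theorem nestCmp_labels (P : ℕ → C) {n : ℕ} {L : Ar n} (M : NAr L) :
    nestCmp F P M ≫ nestLabels (fun k => F.obj (P k)) M = F.map (nestLabels P M) ≫ tensCmp F P L := by
  induction M with
  | nil => exact toUnit_unique _ _
  | @snoc n k L M K ih =>
      show lift (F.map (fst (nestTens P M) (P k ⊗ tens P K)) ≫ nestCmp F P M)
        (lift (F.map (snd (nestTens P M) (P k ⊗ tens P K) ≫ fst _ _))
          (F.map (snd (nestTens P M) (P k ⊗ tens P K) ≫ snd _ _) ≫ tensCmp F P K)) ≫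
          (nestLabels (fun k => F.obj (P k)) M ⊗ₘ fst _ _) =
        F.map (nestLabels P M ⊗ₘ fst _ _) ≫
          lift (F.map (fst (tens P L) (P k)) ≫ tensCmp F P L) (F.map (snd (tens P L) (P k)))
      rw [lift_map, Category.assoc, ih, lift_fst, comp_lift, ← F.map_comp_assoc, ← F.map_comp_assoc,
        ← F.map_comp, tensorHom_fst, tensorHom_snd]

theorem nestCmp_flat (P : ℕ → C) {n : ℕ} {L : Ar n} (M : NAr L) :
    nestCmp F P M ≫ nestFlat (fun k => F.obj (P k)) M =
      F.map (nestFlat P M) ≫ tensCmp F P M.flatten := by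
  induction M with
  | nil => exact toUnit_unique _ _
  | @snoc n k L M K ih =>
      show lift (F.map (fst (nestTens P M) (P k ⊗ tens P K)) ≫ nestCmp F P M)
        (lift (F.map (snd (nestTens P M) (P k ⊗ tens P K) ≫ fst _ _))
          (F.map (snd (nestTens P M) (P k ⊗ tens P K) ≫ snd _ _) ≫ tensCmp F P K)) ≫
          (nestFlat (fun k => F.obj (P k)) M ⊗ₘ snd _ _) ≫ tensJoin _ M.flatten K =
        F.map ((nestFlat P M ⊗ₘ snd _ _) ≫ tensJoin P M.flatten K) ≫
          tensCmp F P (M.flatten.append K)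
      rw [F.map_comp (nestFlat P M ⊗ₘ snd _ _), Category.assoc, tensCmp_join, ← Category.assoc,
        ← Category.assoc, lift_map, comp_lift, Category.assoc, ih, lift_snd, ← F.map_comp_assoc,
        ← F.map_comp_assoc, ← F.map_comp_assoc, tensorHom_fst, tensorHom_snd]

theorem nestCmp_comp (O : Operad C) {n : ℕ} {L : Ar n} (M : NAr L) :
    nestCmp F O.P M ≫ nestComp (fun k => F.obj (O.P k)) (mapComp F O) M =
      F.map (nestComp O.P O.comp M) ≫ tensCmp F O.P M.sums := by
  induction M with
  | nil => exact toUnit_unique _ _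
  | @snoc n k L M K ih =>
      show lift (F.map (fst (nestTens O.P M) (O.P k ⊗ tens O.P K)) ≫ nestCmp F O.P M)
        (lift (F.map (snd (nestTens O.P M) (O.P k ⊗ tens O.P K) ≫ fst _ _))
          (F.map (snd (nestTens O.P M) (O.P k ⊗ tens O.P K) ≫ snd _ _) ≫ tensCmp F O.P K)) ≫
          (nestComp (fun k => F.obj (O.P k)) (mapComp F O) M ⊗ₘ mapComp F O K) =
        F.map (nestComp O.P O.comp M ⊗ₘ O.comp K) ≫
          lift (F.map (fst (tens O.P M.sums) (O.P K.sum)) ≫ tensCmp F O.P M.sums)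
            (F.map (snd (tens O.P M.sums) (O.P K.sum)))
      rw [lift_map, Category.assoc, ih, lift_mapComp, comp_lift, ← F.map_comp_assoc,
        ← F.map_comp_assoc, ← F.map_comp, tensorHom_fst, tensorHom_snd, ← comp_lift,
        lift_fst_snd, Category.comp_id]

/-- The image of an operad under a functor preserving finite products: `(FP)(k) = F(P(k))`. -/
def Operad.map (O : Operad C) : Operad D where
  P k := F.obj (O.P k)
  unit := mapUnit F O
  comp L := mapComp F O L
  unit_comp k := by
    have e := lift_mapComp F O (Ar.nil.snoc k) (toUnit (O.P k) ≫ O.unit) (tensOne O.P k)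
    rw [O.unit_comp, tensCmp_one, map_toUnit_unit] at e
    exact e.trans (eqToHom_map F _)
  comp_unit n := by
    have e := lift_mapComp F O (Ar.ones n) (𝟙 (O.P n)) (toUnit (O.P n) ≫ tensUnits O.P O.unit n)
    rw [O.comp_unit, map_toUnit_units, F.map_id] at e
    exact e.trans (eqToHom_map F _)
  comp_assoc {n L} M := by
    have := nestCmp_isIso F O.P M
    have := pairCmp_isIso F (O.P n) (nestCmp F O.P M)
    rw [← cancel_epi (pairCmp F (O.P n) (nestCmp F O.P M))]
    have e₁ : pairCmp F (O.P n) (nestCmp F O.P M) ≫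
        F.obj (O.P n) ◁ nestLabels (fun k => F.obj (O.P k)) M ≫ mapComp F O L =
        F.map (O.P n ◁ nestLabels O.P M ≫ O.comp L) := by
      rw [← Category.assoc, pairCmp, lift_whiskerLeft, Category.assoc, nestCmp_labels,
        ← F.map_comp_assoc, lift_mapComp, whisker_eq_lift]
    have e₂ : pairCmp F (O.P n) (nestCmp F O.P M) ≫ snd _ _ ≫
        nestFlat (fun k => F.obj (O.P k)) M =
        F.map (snd _ _ ≫ nestFlat O.P M) ≫ tensCmp F O.P M.flatten := by
      rw [pairCmp, lift_snd_assoc, Category.assoc, nestCmp_flat, F.map_comp, Category.assoc]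
    have e₃ : pairCmp F (O.P n) (nestCmp F O.P M) ≫
        F.obj (O.P n) ◁ nestComp (fun k => F.obj (O.P k)) (mapComp F O) M ≫ mapComp F O M.sums =
        F.map (O.P n ◁ nestComp O.P O.comp M ≫ O.comp M.sums) := by
      rw [← Category.assoc, pairCmp, lift_whiskerLeft, Category.assoc, nestCmp_comp,
        ← F.map_comp_assoc, lift_mapComp, whisker_eq_lift]
    refine Eq.trans ?_ e₃.symm
    rw [← O.comp_assoc M, ← Category.assoc, comp_lift, e₁, e₂, ← Category.assoc, lift_mapComp,
      ← Category.assoc, F.map_comp (_ ≫ _)]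
    exact congrArg _ (eqToHom_map F _).symm

end Transport

instance {V : Type (u + 1)} [Category.{u} V] [CartesianMonoidalCategory V] (P : Operad V) :
    PreservesProducts (PCat.forget P) where
  unit := by
    have : toUnit ((PCat.forget P).obj (𝟙_ (PCat P))) = 𝟙 (𝟙_ (VGraph V)) := toUnit_unique _ _
    rw [this]
    exact (inferInstance : IsIso (𝟙 (𝟙_ (VGraph V))))
  prod A B := by
    have : lift ((PCat.forget P).map (fst A B)) ((PCat.forget P).map (snd A B)) =
        𝟙 (A.graph ⊗ B.graph) :=
      CartesianMonoidalCategory.hom_ext _ _ ((lift_fst _ _).trans (Category.id_comp _).symm)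
        ((lift_snd _ _).trans (Category.id_comp _).symm)
    rw [this]
    exact (inferInstance : IsIso (𝟙 (A.graph ⊗ B.graph)))

section Star

variable {V W : Type (u + 1)} [Category.{u} V] [CartesianMonoidalCategory V]
    [Category.{u} W] [CartesianMonoidalCategory W] (F : V ⥤ W) [PreservesProducts F]

def invUnit : 𝟙_ W ⟶ F.obj (𝟙_ V) := inv (toUnit (F.obj (𝟙_ V)))

def invProd (A B : V) : F.obj A ⊗ F.obj B ⟶ F.obj (A ⊗ B) :=
  inv (lift (F.map (fst A B)) (F.map (snd A B)))

instance : PreservesProducts (VGraph.star F) where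
  unit := by
    refine ⟨⟨VGraph.Hom.mk (A := 𝟙_ (VGraph W)) (B := (VGraph.star F).obj (𝟙_ (VGraph V)))
      (fun _ => PUnit.unit) (fun _ _ => invUnit F), ?_, ?_⟩⟩
    · exact VGraph.hom_mk_congr fun _ _ => IsIso.hom_inv_id (toUnit (F.obj (𝟙_ V)))
    · exact toUnit_unique _ _
  prod A B := by
    refine ⟨⟨VGraph.Hom.mk
      (A := (VGraph.star F).obj A ⊗ (VGraph.star F).obj B) (B := (VGraph.star F).obj (A ⊗ B))
      (fun x => x) (fun x y => invProd F (A.hom x.1 y.1) (B.hom x.2 y.2)), ?_, ?_⟩⟩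
    · exact VGraph.hom_mk_congr fun x y => IsIso.hom_inv_id
        (lift (F.map (fst (A.hom x.1 y.1) (B.hom x.2 y.2)))
        (F.map (snd (A.hom x.1 y.1) (B.hom x.2 y.2))))
    · exact VGraph.hom_mk_congr fun x y => IsIso.inv_hom_id
        (lift (F.map (fst (A.hom x.1 y.1) (B.hom x.2 y.2)))
        (F.map (snd (A.hom x.1 y.1) (B.hom x.2 y.2))))

end Star

instance {C D E : Type (u + 1)} [Category.{u} C] [CartesianMonoidalCategory C]
    [Category.{u} D] [CartesianMonoidalCategory D] [Category.{u} E] [CartesianMonoidalCategory E]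
    (F : C ⥤ D) (G : D ⥤ E) [PreservesProducts F] [PreservesProducts G] :
    PreservesProducts (F ⋙ G) where
  unit := by
    have : toUnit ((F ⋙ G).obj (𝟙_ C)) = G.map (toUnit (F.obj (𝟙_ C))) ≫ toUnit (G.obj (𝟙_ D)) :=
      toUnit_unique _ _
    rw [this]
    infer_instance
  prod A B := by
    have : lift ((F ⋙ G).map (fst A B)) ((F ⋙ G).map (snd A B)) =
        G.map (lift (F.map (fst A B)) (F.map (snd A B))) ≫
          lift (G.map (fst (F.obj A) (F.obj B))) (G.map (snd (F.obj A) (F.obj B))) := by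
      rw [comp_lift, ← G.map_comp, ← G.map_comp, lift_fst, lift_snd]
      rfl
    rw [this]
    infer_instance

/-! ### Distributive laws and distributive series of monads -/

section Laws

variable {C : Type (u + 1)} [Category.{u} C]

/-- A distributive law `S T ⟹ T S` between monads. -/
structure IsDistributiveLaw (S T : Monad C)
    (l : T.toFunctor ⋙ S.toFunctor ⟶ S.toFunctor ⋙ T.toFunctor) : Prop where
  map_unit : ∀ X : C, S.map (T.η.app X) ≫ l.app X = T.η.app (S.obj X)
  unit_app : ∀ X : C, S.η.app (T.obj X) ≫ l.app X = T.map (S.η.app X)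
  map_mul : ∀ X : C, S.map (T.μ.app X) ≫ l.app X =
    l.app (T.obj X) ≫ T.map (l.app X) ≫ T.μ.app (S.obj X)
  mul_app : ∀ X : C, S.μ.app (T.obj X) ≫ l.app X =
    S.map (l.app X) ≫ l.app (S.obj X) ≫ T.map (S.μ.app X)

/-- The structure of a distributive series on monads `T_0, …, T_{n-1}`: distributive laws
`T_i T_j ⟹ T_j T_i` for all `i > j`, satisfying the Yang–Baxter equation for all `i > j > k`. -/
structure DistributiveSeries {n : ℕ} (T : Fin n → Monad C) : Type (u + 1) where
  law : ∀ i j : Fin n, j < i →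
    ((T j).toFunctor ⋙ (T i).toFunctor ⟶ (T i).toFunctor ⋙ (T j).toFunctor)
  isDistributiveLaw : ∀ (i j : Fin n) (h : j < i), IsDistributiveLaw (T i) (T j) (law i j h)
  yangBaxter : ∀ (i j k : Fin n) (hij : j < i) (hjk : k < j) (X : C),
    (law i j hij).app ((T k).obj X) ≫ (T j).map ((law i k (hjk.trans hij)).app X) ≫
        (law j k hjk).app ((T i).obj X) =
      (T i).map ((law j k hjk).app X) ≫ (law i k (hjk.trans hij)).app ((T j).obj X) ≫
        (T k).map ((law i j hij).app X)

end Laws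

section Interchange

variable {V : Type (u + 1)} [Category.{u} V] [CartesianMonoidalCategory V]

def tensMap {P P' : ℕ → V} (α : ∀ k, P k ⟶ P' k) : {n : ℕ} → (L : Ar n) → (tens P L ⟶ tens P' L)
  | _, Ar.nil => 𝟙 _
  | _, Ar.snoc L k => tensMap α L ⊗ₘ α k

/-- The maps `α_k : T(P(k)) ⟶ P(k)` make the operad `P` into an operad in `T`-algebras: they are
actions of the monad `T`, and the unit and the compositions of the operad are algebra maps
(with respect to the componentwise actions on products). -/
structure IsAlgebraOperad (T : Monad V) (O : Operad V) (α : ∀ k, T.obj (O.P k) ⟶ O.P k) :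
    Prop where
  unit_act : ∀ k, T.η.app (O.P k) ≫ α k = 𝟙 (O.P k)
  mul_act : ∀ k, T.μ.app (O.P k) ≫ α k = T.map (α k) ≫ α k
  map_unit : T.map O.unit ≫ α 1 = toUnit _ ≫ O.unit
  map_comp : ∀ {n : ℕ} (L : Ar n), T.map (O.comp L) ≫ α L.sum =
    lift (T.map (fst _ _) ≫ α n)
      (T.map (snd _ _) ≫ tensCmp T.toFunctor O.P L ≫ tensMap α L) ≫ O.comp L

variable [CoprodDistrib V]

/-- The parametrised interchange law `T_* fc ⟹ fc T_*` for a coproduct-preserving monad `T` and an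
operad `P` in `T`-algebras with actions `α`: it is the identity on objects, and on the summand of
a chain it is the map
`T(P(n) × A(a_0, a_1) × ⋯) ⟶ T(P(n)) × T(A(a_0, a_1)) × ⋯ ⟶ P(n) × T(A(a_0, a_1)) × ⋯`
given by the projections and the action on `P(n)`. -/
structure IsParamInterchange (T : Monad V) (O : Operad V) (α : ∀ k, T.obj (O.P k) ⟶ O.P k)
    (l : (fcMonad O).toFunctor ⋙ (VGraph.starMonad T).toFunctor ⟶
      (VGraph.starMonad T).toFunctor ⋙ (fcMonad O).toFunctor) : Prop where
  preservesCoproducts : ∀ ι : Type u, PreservesColimitsOfShape (Discrete ι) T.toFunctor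
  isAlgebraOperad : IsAlgebraOperad T O α
  app_eq : ∀ A : VGraph V,
    ∃ f : ∀ a b : A.obj, T.obj (fcHom O.P A.hom a b) ⟶
        fcHom O.P (fun a b => T.obj (A.hom a b)) a b,
      l.app A = VGraph.Hom.mk (A := (VGraph.starMonad T).obj ((fcMonad O).obj A))
        (B := (fcMonad O).obj ((VGraph.starMonad T).obj A)) (fun a => a) f ∧
      ∀ {n : ℕ} {a b : A.obj} (c : Chain n a b),
        T.map (fcInj O.P A.hom c) ≫ f a b =
          lift (T.map (fst _ _) ≫ α n) (T.map (snd _ _) ≫ alongCmp T.toFunctor A.hom c) ≫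
            fcInj O.P (fun a b => T.obj (A.hom a b)) c

/-- A transformation `S_* T_* ⟹ T_* S_*` is obtained by applying `l : S T ⟹ T S` to every
hom-object. -/
def IsStar {S T : Monad V} (l : T.toFunctor ⋙ S.toFunctor ⟶ S.toFunctor ⋙ T.toFunctor)
    (m : (VGraph.starMonad T).toFunctor ⋙ (VGraph.starMonad S).toFunctor ⟶
      (VGraph.starMonad S).toFunctor ⋙ (VGraph.starMonad T).toFunctor) : Prop :=
  ∀ A : VGraph V, m.app A = VGraph.Hom.mk (A := (VGraph.starMonad S).obj ((VGraph.starMonad T).obj A))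
    (B := (VGraph.starMonad T).obj ((VGraph.starMonad S).obj A)) (fun a => a) (fun a b => l.app (A.hom a b))

end Interchange

/-! ### Iterated graphs and iterative operadic theories of `n`-categories -/

/-- A category with chosen finite products and distributive small coproducts. -/
structure DistCat : Type (u + 2) where
  C : Type (u + 1)
  [cat : Category.{u} C]
  [cart : CartesianMonoidalCategory C]
  [distrib : CoprodDistrib C]

attribute [instance] DistCat.cat DistCat.cart DistCat.distrib

/-- The category of `n`-graphs: sets for `n = 0`, and graphs enriched in `n`-graphs for `n + 1`. -/
def NGph : ℕ → DistCat.{u}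
  | 0 => { C := Type u }
  | n + 1 => { C := VGraph (NGph n).C }

/-- A candidate category of `n`-categories: a category with finite products, a forgetful functor
to `n`-graphs, and a notion of contractibility. -/
structure Stage (n : ℕ) : Type (u + 2) where
  C : Type (u + 1)
  [cat : Category.{u} C]
  [cart : CartesianMonoidalCategory C]
  U : C ⥤ (NGph.{u} n).C
  [preserves : PreservesProducts U]
  Contr : C → Prop

attribute [instance] Stage.cat Stage.cart Stage.preserves

instance {C : Type (u + 1)} [Category.{u} C] [CartesianMonoidalCategory C] :
    PreservesProducts (𝟭 C) where
  unit := by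
    have : toUnit ((𝟭 C).obj (𝟙_ C)) = 𝟙 (𝟙_ C) := toUnit_unique _ _
    rw [this]
    exact (inferInstance : IsIso (𝟙 (𝟙_ C)))
  prod A B := by
    have : lift ((𝟭 C).map (fst A B)) ((𝟭 C).map (snd A B)) = 𝟙 (A ⊗ B) := lift_fst_snd
    rw [this]
    exact (inferInstance : IsIso (𝟙 (A ⊗ B)))

/-- `0`-categories are sets; a set is contractible if it is terminal. -/
def Stage.zero : Stage.{u} 0 where
  C := Type u
  U := 𝟭 (Type u)
  preserves := (inferInstance : PreservesProducts (𝟭 (Type u)))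
  Contr X := Nonempty (IsTerminal X)

/-- `(n + 1)`-categories are the categories enriched in `n`-categories and weakened by an operad
`P` in `n`-categories. Such a category is contractible if it has an object and all its hom-objects
are contractible. -/
def Stage.succ {n : ℕ} (S : Stage.{u} n) (P : Operad S.C) : Stage.{u} (n + 1) where
  C := PCat P
  U := PCat.forget P ⋙ VGraph.star S.U
  preserves := (inferInstance : PreservesProducts (PCat.forget P ⋙ VGraph.star S.U))
  Contr A := Nonempty A.graph.obj ∧ ∀ a b : A.graph.obj, S.Contr (A.graph.hom a b)

/-- The first `n` steps of an iterative operadic theory of `n`-categories: contractible operads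
`P_0, …, P_{n-1}`, where `P_i` is an operad in the category of `i`-categories determined by the
previous operads. The index is the resulting category of `n`-categories. -/
inductive Theory : (n : ℕ) → Stage.{u} n → Type (u + 2)
  | zero : Theory 0 Stage.zero
  | succ {n : ℕ} {S : Stage.{u} n} (T : Theory n S) (P : Operad S.C)
      (contractible : ∀ k, S.Contr (P.P k)) : Theory (n + 1) (S.succ P)

/-- The monads `Q_0, …, Q_{n-1}` on `n`-graphs for parametrised `i`-composition: `Q_i` is obtained
from the free `(V, P)`-category monad, where `V` is the category of `(n - i - 1)`-graphs and `P` is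
the underlying operad of `P_{n-i-1}`, by applying the construction `(-)_*` to it `i` times. -/
def Q : {n : ℕ} → {S : Stage.{u} n} → Theory n S → Fin n → Monad (NGph.{u} n).C
  | _, _, @Theory.succ _ S _ P _, ⟨0, _⟩ => fcMonad (P.map S.U)
  | _, _, Theory.succ T _ _, ⟨i + 1, h⟩ => VGraph.starMonad (Q T ⟨i, Nat.lt_of_succ_lt_succ h⟩)

section Act

variable {C : Type (u + 1)} [Category.{u} C] [CartesianMonoidalCategory C]
  {V : Type (u + 1)} [Category.{u} V] [CartesianMonoidalCategory V] [CoprodDistrib V]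
  (F : C ⥤ V) [PreservesProducts F] {P : Operad C}

/-- The image under `F` of a composition map. -/
def mapγ (A : PCat P) {n : ℕ} {a b : A.graph.obj} (c : Chain n a b) :
    F.obj (P.P n) ⊗ along (fun a b => F.obj (A.graph.hom a b)) c ⟶ F.obj (A.graph.hom a b) :=
  have := alongCmp_isIso F A.graph.hom c
  have := pairCmp_isIso F (P.P n) (alongCmp F A.graph.hom c)
  inv (pairCmp F (P.P n) (alongCmp F A.graph.hom c)) ≫ F.map (A.γ c)

/-- The action of the free `(V, F(P))`-category monad on the image under `F_*` of a
`(C, P)`-category. -/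
def fcAct (A : PCat P) : (fcMonad (P.map F)).obj ((VGraph.star F).obj A.graph) ⟶
    (VGraph.star F).obj A.graph :=
  VGraph.Hom.mk (A := (fcMonad (P.map F)).obj ((VGraph.star F).obj A.graph))
    (B := (VGraph.star F).obj A.graph) (fun a => a) (fun a b => fcDesc fun c => mapγ F A c)

end Act

/-- The action of the monad `Q_i` on the underlying `n`-graph of an `n`-category, given by its
`i`-composition. -/
def act : {n : ℕ} → {S : Stage.{u} n} → (T : Theory n S) → (i : Fin n) → (A : S.C) →
    ((Q T i).obj (S.U.obj A) ⟶ S.U.obj A)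
  | _, _, @Theory.succ _ S _ P _, ⟨0, _⟩, A => fcAct S.U (P := P) A
  | _, _, @Theory.succ _ S T P _, ⟨i + 1, h⟩, (A : PCat P) =>
      VGraph.Hom.mk
        (A := (VGraph.starMonad (Q T ⟨i, Nat.lt_of_succ_lt_succ h⟩)).obj ((VGraph.star S.U).obj A.graph))
        (B := (VGraph.star S.U).obj A.graph) (fun a => a)
        (fun a b => act T ⟨i, Nat.lt_of_succ_lt_succ h⟩ (A.graph.hom a b))

/-- For `i > j`, a transformation `Q_i Q_j ⟹ Q_j Q_i` is the parametrised interchange law of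
`i`-composition and `j`-composition: for `j = 0` it is the parametrised interchange law
`T_* fc ⟹ fc T_*` for the monad `T = Q_{i-1}` on `(n - 1)`-graphs and the operad `P_{n-1}`,
and for `j > 0` it is obtained from the interchange law of `(i - 1)`-composition and
`(j - 1)`-composition on `(n - 1)`-graphs by applying it to hom-objects. -/
def IsInterchange : {n : ℕ} → {S : Stage.{u} n} → (T : Theory n S) → (i j : Fin n) →
    ((Q T j).toFunctor ⋙ (Q T i).toFunctor ⟶ (Q T i).toFunctor ⋙ (Q T j).toFunctor) → Prop
  | _, _, Theory.succ _ _ _, ⟨0, _⟩, _, _ => False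
  | _, _, @Theory.succ _ S T P _, ⟨i + 1, h⟩, ⟨0, _⟩, l =>
      IsParamInterchange (Q T ⟨i, Nat.lt_of_succ_lt_succ h⟩) (P.map S.U)
        (fun k => act T ⟨i, Nat.lt_of_succ_lt_succ h⟩ (P.P k)) l
  | _, _, @Theory.succ _ S T P _, ⟨i + 1, h⟩, ⟨j + 1, h'⟩, m =>
      ∃ l, IsInterchange T ⟨i, Nat.lt_of_succ_lt_succ h⟩ ⟨j, Nat.lt_of_succ_lt_succ h'⟩ l ∧
        IsStar l m

end IterOp

end

noncomputable section

namespace IterOp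

/-! ### Comparing the image of a product with the product of the images -/

section Comparison

variable {V : Type (u + 1)} [Category.{u} V] [CartesianMonoidalCategory V]
  {W : Type (u + 1)} [Category.{u} W] [CartesianMonoidalCategory W]
  {E : Type (u + 1)} [Category.{u} E] [CartesianMonoidalCategory E]
  {S S' : Type u}

/-! The laws are built by induction on the theory. In the step from `n` to `n + 1`, each old monad
is applied to hom-objects and one new monad is added at index `0`, the free category monad of the
operad `P` carried to graphs by `U`. Laws between old monads, and all equations between them, hold
on one hom-object at a time. What is new is the family of laws with `j = 0` and the Yang–Baxter
equations with `k = 0`.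

A hom-object of a free category is a coproduct over chains of "label in `P(n)` times arrows along
the chain". For a coproduct-preserving `T` this gives a comparison map `fcCmp`, which treats the
label by an action `T(P(n)) ⟶ P(n)` and the arrows by the images of the projections. This is the
parametrised interchange law. Each equation about it is tested on the summands and splits into two
components. The arrow component needs no hypothesis on the actions: the comparison maps are
assembled from images of projections, so every natural transformation respects them
(`alongCmp_natTrans`), whether it is the unit or multiplication of `T` or another distributive law.
The label component is the real content. The four axioms of a distributive law become the four
axioms of an operad in `T`-algebras, and the Yang–Baxter equation becomes compatibility of the
actions of `Q_i` and `Q_j` on each `P(k)` with the law between them (`yangBaxter_paramInterchange`).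

The label equations hold because the `P(k)` are themselves `n`-categories. Each `Q_i` acts on the
underlying graph of every `n`-category, naturally in functors (`isNaturalAction_act`). The unit and
compositions of `P` are functors and `U` preserves products, so naturality makes them algebra maps
(`IsNaturalAction.isAlgebraOperad`). Compatibility of two actions is an instance of the stronger
claim that the laws hold in every `n`-category, `HoldsInCategories`, which is therefore carried
through the induction. Its new case is `IsNaturalAction.fcAct_action`: the composition maps of a
`(V, P)`-category are morphisms of `V`, hence commute with any natural action.

It remains that every `Q_i` preserves coproducts. A chain in a disjoint union of graphs either stays
in one of them or has an initial product of hom-objects (`inFibre_or_isInitial`), so the free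
category functor preserves coproducts. The construction `(-)_*` keeps this property. -/

/-- All comparison maps have the form of the second factor on the left. Together with
`map_tensorHom_lift` this computes them on images of pairs and of products of maps; `F` need not
preserve products. -/
theorem map_lift_lift (F : V ⥤ W) {Z X Y : V} {X' Y' : W} (p : Z ⟶ X) (q : Z ⟶ Y)
    (f : F.obj X ⟶ X') (g : F.obj Y ⟶ Y') :
    F.map (lift p q) ≫ lift (F.map (fst X Y) ≫ f) (F.map (snd X Y) ≫ g) =
      lift (F.map p ≫ f) (F.map q ≫ g) := by
  rw [comp_lift, ← F.map_comp_assoc, ← F.map_comp_assoc, lift_fst, lift_snd]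

theorem map_tensorHom_lift (F : V ⥤ W) {X Y X₁ Y₁ : V} {X' Y' : W} (p : X₁ ⟶ X) (q : Y₁ ⟶ Y)
    (f : F.obj X ⟶ X') (g : F.obj Y ⟶ Y') :
    F.map (p ⊗ₘ q) ≫ lift (F.map (fst X Y) ≫ f) (F.map (snd X Y) ≫ g) =
      lift (F.map (fst _ _) ≫ F.map p ≫ f) (F.map (snd _ _) ≫ F.map q ≫ g) := by
  rw [comp_lift, ← F.map_comp_assoc, ← F.map_comp_assoc, tensorHom_fst, tensorHom_snd,
    F.map_comp_assoc, F.map_comp_assoc]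

/-- The spurious identity brings the recursive clause into the shape expected by `map_lift_lift` and
`map_tensorHom_lift`. -/
theorem alongCmp_snoc (F : V ⥤ W) (H : S → S → V) {n : ℕ} {a b : S} (c : Chain n a b) (b' : S) :
    alongCmp F H (c.snoc b') =
      lift (F.map (fst (along H c) (H b b')) ≫ alongCmp F H c)
        (F.map (snd (along H c) (H b b')) ≫ 𝟙 _) :=
  congrArg (fun t => lift (F.map (fst (along H c) (H b b')) ≫ alongCmp F H c) t)
    (Category.comp_id _).symm

theorem tensCmp_snoc (F : V ⥤ W) (P : ℕ → V) {n : ℕ} (L : Ar n) (k : ℕ) :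
    tensCmp F P (L.snoc k) =
      lift (F.map (fst (tens P L) (P k)) ≫ tensCmp F P L) (F.map (snd (tens P L) (P k)) ≫ 𝟙 _) :=
  congrArg (fun t => lift (F.map (fst (tens P L) (P k)) ≫ tensCmp F P L) t)
    (Category.comp_id _).symm

theorem alongHom_id (H : S → S → V) {n : ℕ} {a b : S} (c : Chain n a b) :
    alongHom (fun a b => 𝟙 (H a b)) c = 𝟙 _ := by
  induction c with
  | nil a => rfl
  | snoc c b' ih =>
      exact (congrArg (· ⊗ₘ 𝟙 (H _ b')) ih).trans (id_tensorHom_id _ _)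

theorem alongCmp_map (F : V ⥤ W) {H : S → S → V} {H' : S' → S' → V} (o : S → S')
    (h : ∀ a b, H a b ⟶ H' (o a) (o b)) {n : ℕ} {a b : S} (c : Chain n a b) :
    alongCmp F H c ≫ alongMap (H' := fun a b => F.obj (H' a b)) o (fun a b => F.map (h a b)) c =
      F.map (alongMap o h c) ≫ alongCmp F H' (c.map o) := by
  induction c with
  | nil a => exact toUnit_unique _ _
  | snoc c b' ih =>
      refine Eq.trans ?_ ((congrArg (F.map (alongMap o h c ⊗ₘ h _ b') ≫ ·)
        (alongCmp_snoc F H' (c.map o) (o b'))).trans (map_tensorHom_lift F _ _ _ _)).symm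
      rw [← ih, Category.comp_id]
      exact (lift_map _ _ _ _).trans (congrArg (lift · _) (Category.assoc _ _ _))

/-- The comparison map is built from images of projections alone, and `τ` commutes with those, so no
monoidality of `τ` is required. This settles the arrow component in every later equation where two
functors are compared: `τ` will be the unit, the multiplication, a distributive law or an action. -/
theorem alongCmp_natTrans {F G : V ⥤ W} (τ : F ⟶ G) (H : S → S → V)
    {n : ℕ} {a b : S} (c : Chain n a b) :
    τ.app (along H c) ≫ alongCmp G H c =
      alongCmp F H c ≫ alongHom (fun a b => τ.app (H a b)) c := by
  induction c with
  | nil a => exact toUnit_unique _ _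
  | @snoc n a b c b' ih =>
      refine (comp_lift _ _ _).trans (Eq.trans ?_ (lift_map _ _ _ _).symm)
      rw [Category.assoc, ← ih]
      exact congrArg₂ lift ((Category.assoc _ _ _).symm.trans
        ((congrArg (· ≫ _) (τ.naturality _).symm).trans (Category.assoc _ _ _)))
        (τ.naturality _).symm

theorem tensCmp_natTrans {F G : V ⥤ W} (τ : F ⟶ G) (P : ℕ → V) {n : ℕ} (L : Ar n) :
    τ.app (tens P L) ≫ tensCmp G P L = tensCmp F P L ≫ tensMap (fun k => τ.app (P k)) L := by
  induction L with
  | nil => exact toUnit_unique _ _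
  | @snoc n L k ih =>
      refine (comp_lift _ _ _).trans (Eq.trans ?_ (lift_map _ _ _ _).symm)
      rw [Category.assoc, ← ih]
      exact congrArg₂ lift ((Category.assoc _ _ _).symm.trans
        ((congrArg (· ≫ _) (τ.naturality _).symm).trans (Category.assoc _ _ _)))
        (τ.naturality _).symm

/-- Multiplications, distributive laws and actions have composite functors as source or target; this
unfolds the comparison maps that `alongCmp_natTrans` then produces. -/
theorem alongCmp_comp (F : V ⥤ W) (G : W ⥤ E) (H : S → S → V)
    {n : ℕ} {a b : S} (c : Chain n a b) :
    alongCmp (F ⋙ G) H c =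
      G.map (alongCmp F H c) ≫ alongCmp G (fun a b => F.obj (H a b)) c := by
  induction c with
  | nil a => exact toUnit_unique _ _
  | @snoc n a b c b' ih =>
      refine Eq.trans ?_ ((congrArg (G.map _ ≫ ·) (alongCmp_snoc G _ c b')).trans
        (map_lift_lift G _ _ _ _)).symm
      refine congrArg₂ lift ?_ (Category.comp_id _).symm
      rw [ih, G.map_comp, Category.assoc]
      rfl

theorem tensCmp_comp (F : V ⥤ W) (G : W ⥤ E) (P : ℕ → V) {n : ℕ} (L : Ar n) :
    tensCmp (F ⋙ G) P L = G.map (tensCmp F P L) ≫ tensCmp G (fun k => F.obj (P k)) L := by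
  induction L with
  | nil => exact toUnit_unique _ _
  | @snoc n L k ih =>
      refine Eq.trans ?_ ((congrArg (G.map _ ≫ ·) (tensCmp_snoc G _ L k)).trans
        (map_lift_lift G _ _ _ _)).symm
      refine congrArg₂ lift ?_ (Category.comp_id _).symm
      rw [ih, G.map_comp, Category.assoc]
      rfl

theorem alongCmp_id (H : S → S → V) {n : ℕ} {a b : S} (c : Chain n a b) :
    alongCmp (𝟭 V) H c = 𝟙 (along H c) := by
  induction c with
  | nil a => exact toUnit_unique _ _
  | @snoc n a b c b' ih =>
      refine Eq.trans (congrArg (fun t => lift ((𝟭 V).map (fst (along H c) (H b b')) ≫ t)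
        (snd (along H c) (H b b'))) ih) ?_
      exact (congrArg (lift · (snd (along H c) (H b b'))) (Category.comp_id _)).trans lift_fst_snd

theorem alongCmp_one (F : V ⥤ W) (H : S → S → V) (a b : S) :
    F.map (alongOne H a b) ≫ alongCmp F H ((Chain.nil a).snoc b) =
      alongOne (fun a b => F.obj (H a b)) a b := by
  refine (congrArg (F.map (alongOne H a b) ≫ ·) (alongCmp_snoc F H (Chain.nil a) b)).trans
    ((map_lift_lift F _ _ _ _).trans ?_)
  refine congrArg₂ lift (toUnit_unique _ _) ?_
  rw [F.map_id, Category.comp_id]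

theorem alongCmp_join (F : V ⥤ W) (H : S → S → V) {n : ℕ} {a b : S} (c : Chain n a b)
    {m : ℕ} {b' : S} (d : Chain m b b') :
    F.map (alongJoin H c d) ≫ alongCmp F H (c.append d) =
      lift (F.map (fst _ _) ≫ alongCmp F H c) (F.map (snd _ _) ≫ alongCmp F H d) ≫
        alongJoin (fun a b => F.obj (H a b)) c d := by
  induction d with
  | nil => exact (lift_fst _ _).symm
  | @snoc m b b'' d b' ih =>
      show F.map (lift (lift (fst (along H c) (along H d ⊗ H b'' b')) (snd _ _ ≫ fst _ _) ≫
          alongJoin H c d) (snd _ _ ≫ snd _ _)) ≫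
          lift (F.map (fst (along H (c.append d)) (H b'' b')) ≫ alongCmp F H (c.append d))
            (F.map (snd (along H (c.append d)) (H b'' b'))) =
        lift (F.map (fst (along H c) (along H d ⊗ H b'' b')) ≫ alongCmp F H c)
            (F.map (snd (along H c) (along H d ⊗ H b'' b')) ≫
              lift (F.map (fst (along H d) (H b'' b')) ≫ alongCmp F H d)
                (F.map (snd (along H d) (H b'' b')))) ≫
          lift (lift (fst _ _) (snd _ _ ≫ fst _ _) ≫ alongJoin (fun a b => F.obj (H a b)) c d)
            (snd _ _ ≫ snd _ _)
      rw [comp_lift, comp_lift, ← F.map_comp_assoc, lift_fst, F.map_comp, Category.assoc, ih,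
        ← F.map_comp, lift_snd]
      congr 1
      · rw [← Category.assoc, ← Category.assoc]
        congr 1
        rw [comp_lift, comp_lift, ← F.map_comp_assoc, ← F.map_comp_assoc, lift_fst, lift_fst,
          lift_snd, lift_snd_assoc, Category.assoc (F.map _), lift_fst, F.map_comp_assoc]
      · rw [lift_snd_assoc, Category.assoc, lift_snd, F.map_comp]

/-- The comparison map for the products `nest`, followed by given maps on the labels. -/
def nestCmpMap (F : V ⥤ W) {P : ℕ → V} {P' : ℕ → W} (α : ∀ k, F.obj (P k) ⟶ P' k)
    (H : S → S → V) : {n : ℕ} → {a b : S} → {c : Chain n a b} → {L : Ar n} → (N : NChain c L) →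
      (F.obj (nest P H N) ⟶ nest P' (fun a b => F.obj (H a b)) N)
  | _, _, _, _, _, NChain.nil _ => toUnit _
  | _, _, _, _, _, @NChain.snoc _ _ k _ _ _ _ _ N l =>
      lift (F.map (fst (nest P H N) (P k ⊗ along H l)) ≫ nestCmpMap F α H N)
        (F.map (snd (nest P H N) (P k ⊗ along H l)) ≫
          lift (F.map (fst _ _) ≫ α k) (F.map (snd _ _) ≫ alongCmp F H l))

variable (F : V ⥤ W) {P : ℕ → V} {P' : ℕ → W} (α : ∀ k, F.obj (P k) ⟶ P' k) (H : S → S → V)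

/-- With `nestCmpMap_arrows`, this separates a two-layer element into its labels, on which `α` acts,
and its concatenated arrows, which see only `F`. These are the two inputs of the free
multiplication. -/
theorem nestCmpMap_labels {n : ℕ} {a b : S} {c : Chain n a b} {L : Ar n} (N : NChain c L) :
    nestCmpMap F α H N ≫ labels P' (fun a b => F.obj (H a b)) N =
      F.map (labels P H N) ≫ tensCmp F P L ≫ tensMap α L := by
  induction N with
  | nil a => exact toUnit_unique _ _
  | @snoc n k a b b' c L N l ih =>
      refine (lift_map _ _ _ _).trans (Eq.trans ?_ ((Category.assoc _ _ _).symm.trans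
        ((congrArg (· ≫ (tensMap α L ⊗ₘ α k)) ((congrArg (F.map (labels P H N ⊗ₘ fst _ _) ≫ ·)
          (tensCmp_snoc F P L k)).trans (map_tensorHom_lift F _ _ _ _))).trans
            (lift_map _ _ _ _))).symm)
      refine congrArg₂ lift ?_ ?_
      · rw [Category.assoc, ih, Category.assoc, Category.assoc]
        rfl
      · rw [Category.assoc, lift_fst, Category.assoc, Category.comp_id]
        rfl

theorem nestCmpMap_arrows {n : ℕ} {a b : S} {c : Chain n a b} {L : Ar n} (N : NChain c L) :
    nestCmpMap F α H N ≫ arrows P' (fun a b => F.obj (H a b)) N =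
      F.map (arrows P H N) ≫ alongCmp F H N.flatten := by
  induction N with
  | nil a => exact toUnit_unique _ _
  | @snoc n k a b b' c L N l ih =>
      show lift (F.map (fst (nest P H N) (P k ⊗ along H l)) ≫ nestCmpMap F α H N)
        (F.map (snd (nest P H N) (P k ⊗ along H l)) ≫
          lift (F.map (fst _ _) ≫ α k) (F.map (snd _ _) ≫ alongCmp F H l)) ≫
          (arrows P' (fun a b => F.obj (H a b)) N ⊗ₘ snd _ _) ≫ alongJoin _ N.flatten l =
        F.map ((arrows P H N ⊗ₘ snd _ _) ≫ alongJoin H N.flatten l) ≫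
          alongCmp F H (N.flatten.append l)
      rw [F.map_comp, Category.assoc, alongCmp_join, ← Category.assoc, ← Category.assoc,
        lift_map, map_tensorHom_lift, Category.assoc, ih, Category.assoc, lift_snd]

/-- If `h` is compatible with evaluation of a single labelled chain, it is compatible with
evaluation of a whole family of them. It serves twice: for the coproduct inclusions with `h` the
comparison map, and for the composition maps of a category with `h` the identity. -/
theorem nestCmpMap_eval {H' : S → S → V} {H'' : S → S → W}
    (γ : ∀ {k : ℕ} {a b : S} (l : Chain k a b), P k ⊗ along H l ⟶ H' a b)
    (γ' : ∀ {k : ℕ} {a b : S} (l : Chain k a b),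
      P' k ⊗ along (fun a b => F.obj (H a b)) l ⟶ H'' a b)
    (h : ∀ a b, F.obj (H' a b) ⟶ H'' a b)
    (e : ∀ {k : ℕ} {a b : S} (l : Chain k a b), F.map (γ l) ≫ h a b =
      lift (F.map (fst _ _) ≫ α k) (F.map (snd _ _) ≫ alongCmp F H l) ≫ γ' l)
    {n : ℕ} {a b : S} {c : Chain n a b} {L : Ar n} (N : NChain c L) :
    nestCmpMap F α H N ≫ nestEval γ' N =
      F.map (nestEval γ N) ≫ alongCmp F H' c ≫ alongHom h c := by
  induction N with
  | nil a => exact toUnit_unique _ _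
  | @snoc n k a b b' c L N l ih =>
      refine (lift_map _ _ _ _).trans (Eq.trans ?_ ((Category.assoc _ _ _).symm.trans
        ((congrArg (· ≫ (alongHom h c ⊗ₘ h _ _)) ((congrArg (F.map (nestEval γ N ⊗ₘ γ l) ≫ ·)
          (alongCmp_snoc F H' c b')).trans (map_tensorHom_lift F _ _ _ _))).trans
            (lift_map _ _ _ _))).symm)
      refine congrArg₂ lift ?_ ?_
      · rw [Category.assoc, ih, Category.assoc, Category.assoc]
        rfl
      · rw [Category.assoc, ← e, Category.assoc, Category.comp_id]
        rfl

theorem nestEval_alongHom {H₀ H H' : S → S → V}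
    (γ : ∀ {k : ℕ} {a b : S} (l : Chain k a b), P k ⊗ along H₀ l ⟶ H a b)
    (h : ∀ a b, H a b ⟶ H' a b) {n : ℕ} {a b : S} {c : Chain n a b} {L : Ar n}
    (N : NChain c L) :
    nestEval γ N ≫ alongHom h c = nestEval (fun l => γ l ≫ h _ _) N := by
  induction N with
  | nil a => exact toUnit_unique _ _
  | @snoc n k a b b' c L N l ih =>
      exact (tensorHom_comp_tensorHom _ _ _ _).trans (congrArg (· ⊗ₘ (γ l ≫ h _ _)) ih)

theorem tensMap_id (P : ℕ → V) {n : ℕ} (L : Ar n) : tensMap (fun k => 𝟙 (P k)) L = 𝟙 _ := by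
  induction L with
  | nil => rfl
  | snoc L k ih => exact (congrArg (· ⊗ₘ 𝟙 (P k)) ih).trans (id_tensorHom_id _ _)

end Comparison

/-! ### Testing maps out of the image of a free hom-object -/

section PreservedCoproducts

variable {V : Type (u + 1)} [Category.{u} V] {W : Type (u + 1)} [Category.{u} W]
  (F : V ⥤ W) [∀ ι : Type u, PreservesColimitsOfShape (Discrete ι) F]

def isColimitMapCofan {ι : Type u} {Y : ι → V} {X : V} {j : ∀ i, Y i ⟶ X}
    (h : IsColimit (Cofan.mk X j)) : IsColimit (Cofan.mk (F.obj X) fun i => F.map (j i)) :=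
  isColimitMapCoconeCofanMkEquiv F Y j (isColimitOfPreserves F h)

theorem map_cofan_hom_ext {ι : Type u} {Y : ι → V} {X : V} {j : ∀ i, Y i ⟶ X}
    (h : IsColimit (Cofan.mk X j)) {Z : W} {f g : F.obj X ⟶ Z}
    (e : ∀ i, F.map (j i) ≫ f = F.map (j i) ≫ g) : f = g :=
  Cofan.IsColimit.hom_ext (isColimitMapCofan F h) _ _ e

variable [CartesianMonoidalCategory V] [CoprodDistrib V] {S : Type u}

theorem map_fcHom_ext {P : ℕ → V} {H : S → S → V} {a b : S} {Z : W}
    {f g : F.obj (fcHom P H a b) ⟶ Z}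
    (h : ∀ {n : ℕ} (c : Chain n a b), F.map (fcInj P H c) ≫ f = F.map (fcInj P H c) ≫ g) :
    f = g :=
  map_cofan_hom_ext F (coproductIsCoproduct
    fun c : (Σ n : ℕ, Chain n a b) => P c.1 ⊗ along H c.2) fun c => h c.2

theorem map_fcCell_ext {P : ℕ → V} {H : S → S → V} {a b : S} {Z : W}
    {f g : F.obj (fcHom P H a b) ⟶ Z}
    (h : ∀ {X : V} {n : ℕ} (p : X ⟶ P n) (c : Chain n a b) (y : X ⟶ along H c),
      F.map (fcCell p c y) ≫ f = F.map (fcCell p c y) ≫ g) : f = g :=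
  map_fcHom_ext F fun c => by rw [fcInj_eq]; exact h _ _ _

/-- The product of an object with the hom-objects of a free category along a chain is a
coproduct. -/
def alongIsColimit (P : ℕ → V) (H : S → S → V) {n : ℕ} {a b : S} (c : Chain n a b) (Y : V) :
    IsColimit (Cofan.mk (Y ⊗ along (fcHom P H) c)
      fun N : (Σ L : Ar n, NChain c L) => Y ◁ nestEval (fcInj P H) N.2) :=
  Cofan.IsColimit.mk _ (fun s => alongDesc P H c Y s.pt fun {L} N => s.inj ⟨L, N⟩)
    (fun s N => nestEval_alongDesc P H c Y s.pt (fun {L} N => s.inj ⟨L, N⟩) N.2)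
    (fun s m hm => along_ext P H fun {L} N => (hm ⟨L, N⟩).trans
      (nestEval_alongDesc P H c Y s.pt (fun {L} N => s.inj ⟨L, N⟩) N).symm)

/-- Distributivity makes each summand of the two-fold free hom-object again a coproduct, over
families of chains. A functor preserving coproducts preserves both layers, so elements given by
explicit families suffice. -/
theorem map_fcCell_ext₂ {P : ℕ → V} {H : S → S → V} {a b : S} {Z : W}
    {f g : F.obj (fcHom P (fcHom P H) a b) ⟶ Z}
    (h : ∀ {X : V} {n : ℕ} (p : X ⟶ P n) {c : Chain n a b} {L : Ar n} (N : NChain c L)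
      (y : X ⟶ nest P H N), F.map (fcCell p c (y ≫ nestEval (fcInj P H) N)) ≫ f =
        F.map (fcCell p c (y ≫ nestEval (fcInj P H) N)) ≫ g) : f = g := by
  refine map_fcHom_ext F fun {n} c => map_cofan_hom_ext F (alongIsColimit P H c (P n)) ?_
  rintro ⟨L, N⟩
  have w : P n ◁ nestEval (fcInj P H) N ≫ fcInj P (fcHom P H) c =
      fcCell (fst _ _) c (snd _ _ ≫ nestEval (fcInj P H) N) := by
    refine congrArg (· ≫ fcInj P (fcHom P H) c) ?_
    ext <;> simp
  rw [← F.map_comp_assoc, ← F.map_comp_assoc, w]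
  exact h _ _ _

end PreservedCoproducts

/-! ### The comparison map for free hom-objects -/

section FreeComparison

variable {V : Type (u + 1)} [Category.{u} V] [CartesianMonoidalCategory V] [CoprodDistrib V]
  {W : Type (u + 1)} [Category.{u} W] [CartesianMonoidalCategory W] [CoprodDistrib W]
  {S S' : Type u} (F : V ⥤ W) [∀ ι : Type u, PreservesColimitsOfShape (Discrete ι) F]
  {P : ℕ → V} {P' : ℕ → W} (α : ∀ k, F.obj (P k) ⟶ P' k)

/-- The comparison map `F(fcHom P H) ⟶ fcHom P' (F H)` for a coproduct-preserving functor `F` and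
maps `F(P(k)) ⟶ P'(k)`. -/
def fcCmp (H : S → S → V) (a b : S) :
    F.obj (fcHom P H a b) ⟶ fcHom P' (fun a b => F.obj (H a b)) a b :=
  Cofan.IsColimit.desc (isColimitMapCofan F (coproductIsCoproduct
    fun c : (Σ n : ℕ, Chain n a b) => P c.1 ⊗ along H c.2)) fun c =>
      lift (F.map (fst _ _) ≫ α c.1) (F.map (snd _ _) ≫ alongCmp F H c.2) ≫ fcInj P' _ c.2

theorem map_fcInj_cmp (H : S → S → V) {n : ℕ} {a b : S} (c : Chain n a b) :
    F.map (fcInj P H c) ≫ fcCmp F α H a b =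
      lift (F.map (fst _ _) ≫ α n) (F.map (snd _ _) ≫ alongCmp F H c) ≫
        fcInj P' (fun a b => F.obj (H a b)) c :=
  Cofan.IsColimit.fac (isColimitMapCofan F (coproductIsCoproduct
    fun c : (Σ n : ℕ, Chain n a b) => P c.1 ⊗ along H c.2)) _
      (⟨n, c⟩ : Σ n : ℕ, Chain n a b)

/-- On elements the chain is unchanged while label and arrows are treated independently, so an
equation between composites of comparison maps splits into a label and an arrow component. -/
theorem map_fcCell_cmp {H : S → S → V} {X : V} {n : ℕ} {a b : S} (p : X ⟶ P n)
    (c : Chain n a b) (y : X ⟶ along H c) :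
    F.map (fcCell p c y) ≫ fcCmp F α H a b =
      fcCell (H := fun a b => F.obj (H a b)) (F.map p ≫ α n) c (F.map y ≫ alongCmp F H c) := by
  rw [fcCell, F.map_comp, Category.assoc, map_fcInj_cmp, ← Category.assoc, map_lift_lift, fcCell]

theorem map_fcCell_cmp_assoc {H : S → S → V} {X : V} {n : ℕ} {a b : S} (p : X ⟶ P n)
    (c : Chain n a b) (y : X ⟶ along H c) {Z : W} (g : fcHom P' (fun a b => F.obj (H a b)) a b ⟶ Z) :
    F.map (fcCell p c y) ≫ fcCmp F α H a b ≫ g =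
      fcCell (H := fun a b => F.obj (H a b)) (F.map p ≫ α n) c (F.map y ≫ alongCmp F H c) ≫ g := by
  rw [← Category.assoc, map_fcCell_cmp]

theorem fcCmp_naturality {H : S → S → V} {H' : S' → S' → V} (o : S → S')
    (h : ∀ a b, H a b ⟶ H' (o a) (o b)) (a b : S) :
    F.map (fcMap o h a b) ≫ fcCmp F α H' (o a) (o b) =
      fcCmp F α H a b ≫ fcMap (H' := fun a b => F.obj (H' a b)) o (fun a b => F.map (h a b)) a b := by
  refine map_fcCell_ext F fun {X n} p c y => ?_
  rw [← F.map_comp_assoc, fcCell_map, map_fcCell_cmp, ← Category.assoc, map_fcCell_cmp,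
    fcCell_map, Category.assoc, alongCmp_map, F.map_comp, Category.assoc]

end FreeComparison

/-! ### The parametrised interchange law is a distributive law -/

section Interchange

variable {V : Type (u + 1)} [Category.{u} V] [CartesianMonoidalCategory V] [CoprodDistrib V]
  {S S' : Type u} (T : Monad V) [∀ ι : Type u, PreservesColimitsOfShape (Discrete ι) T.toFunctor]
  {O : Operad V} {α : ∀ k, T.obj (O.P k) ⟶ O.P k}

/-- The label is the operad unit, so the equation reduces to the unit being an algebra map. -/
theorem fcCmp_unit (h : IsAlgebraOperad T O α) (H : S → S → V) (a b : S) :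
    T.map (fcUnit H O a b) ≫ fcCmp T.toFunctor α H a b =
      fcUnit (fun a b => T.obj (H a b)) O a b := by
  refine (map_fcCell_cmp T.toFunctor α _ _ _).trans ?_
  rw [alongCmp_one, T.map_comp, Category.assoc, h.map_unit, ← Category.assoc]
  exact congrArg (fun t => fcCell (t ≫ O.unit) _ _) (toUnit_unique _ _)

theorem unit_fcCmp (h : IsAlgebraOperad T O α) (H : S → S → V) (a b : S) :
    T.η.app (fcHom O.P H a b) ≫ fcCmp T.toFunctor α H a b =
      fcMap (fun a => a) (fun a b => T.η.app (H a b)) a b := by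
  refine fcCell_ext fun {X n} p c y => ?_
  have e := T.η.naturality (fcCell p c y)
  have e₁ := T.η.naturality p
  have e₂ := T.η.naturality y
  have e₃ := alongCmp_natTrans T.η H c
  dsimp only [Functor.id_obj, Functor.id_map] at e e₁ e₂ e₃
  rw [alongCmp_id, Category.id_comp] at e₃
  rw [← Category.assoc, e, Category.assoc, map_fcCell_cmp, comp_fcCell, ← Category.assoc, ← e₁,
    Category.assoc, h.unit_act, Category.comp_id, ← Category.assoc, ← e₂, Category.assoc,
    fcCell_map_id, e₃]

/-- The free multiplication composes labels and concatenates chains. Compatibility with the former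
says that operad composition is an algebra map; compatibility with the latter is formal. -/
theorem fcCmp_mul (h : IsAlgebraOperad T O α) (H : S → S → V) (a b : S) :
    T.map (fcMul H O a b) ≫ fcCmp T.toFunctor α H a b =
      fcCmp T.toFunctor α (fcHom O.P H) a b ≫
        fcMap (fun a => a) (fcCmp T.toFunctor α H) a b ≫
          fcMul (fun a b => T.obj (H a b)) O a b := by
  refine map_fcCell_ext₂ T.toFunctor fun {X n} p {c L} N y => ?_
  have e := nestCmpMap_eval T.toFunctor α H (fcInj O.P H)
    (fcInj O.P (fun a b => T.obj (H a b))) (fcCmp T.toFunctor α H)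
    (fun l => map_fcInj_cmp T.toFunctor α H l) N
  have e₁ : (T.map (y ≫ nestEval (fcInj O.P H) N) ≫ alongCmp T.toFunctor (fcHom O.P H) c) ≫
      alongHom (fcCmp T.toFunctor α H) c =
      (T.map y ≫ nestCmpMap T.toFunctor α H N) ≫
        nestEval (fcInj O.P (fun a b => T.obj (H a b))) N := by
    rw [Category.assoc, T.map_comp, Category.assoc, ← e, Category.assoc]
  rw [← T.map_comp_assoc, fcCell_mul, map_fcCell_cmp, ← Category.assoc, map_fcCell_cmp,
    ← Category.assoc, fcCell_map_id, e₁, fcCell_mul]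
  -- Both sides are now cells over the same concatenated chain. `h.map_comp` is used for the labels
  -- only.
  refine congrArg₂ (fun x z => fcCell x _ z) ?_ ?_
  · rw [T.map_comp, Category.assoc, h.map_comp, ← Category.assoc, map_lift_lift,
      Category.assoc, nestCmpMap_labels, T.map_comp, Category.assoc]
  · rw [Category.assoc, nestCmpMap_arrows, T.map_comp, Category.assoc]

theorem mul_fcCmp (h : IsAlgebraOperad T O α) (H : S → S → V) (a b : S) :
    T.μ.app (fcHom O.P H a b) ≫ fcCmp T.toFunctor α H a b =
      T.map (fcCmp T.toFunctor α H a b) ≫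
        fcCmp T.toFunctor α (fun a b => T.obj (H a b)) a b ≫
          fcMap (fun a => a) (fun a b => T.μ.app (H a b)) a b := by
  -- The source is `T` applied twice to a free hom-object, and a composite of coproduct-preserving
  -- functors preserves coproducts.
  refine map_fcCell_ext (T.toFunctor ⋙ T.toFunctor) fun {X n} p c y => ?_
  have e := T.μ.naturality (fcCell p c y)
  have e₁ := T.μ.naturality p
  have e₂ := T.μ.naturality y
  have e₃ := alongCmp_natTrans T.μ H c
  rw [alongCmp_comp] at e₃
  dsimp only [Functor.comp_obj, Functor.comp_map] at e e₁ e₂ e₃ ⊢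
  rw [← Category.assoc, e, Category.assoc, map_fcCell_cmp, comp_fcCell, ← T.map_comp_assoc,
    map_fcCell_cmp, map_fcCell_cmp_assoc, fcCell_map_id]
  -- The labels require associativity of the action; the arrows require only naturality of the
  -- multiplication of `T`.
  refine congrArg₂ (fun x z => fcCell x c z) ?_ ?_
  · rw [← Category.assoc, ← e₁, Category.assoc, h.mul_act, T.map_comp, Category.assoc]
  · rw [← Category.assoc, ← e₂, Category.assoc, e₃, T.map_comp, Category.assoc, Category.assoc,
      Category.assoc]

variable (O α) in
/-- The parametrised interchange law. -/
def paramInterchange : (fcMonad O).toFunctor ⋙ (VGraph.starMonad T).toFunctor ⟶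
    (VGraph.starMonad T).toFunctor ⋙ (fcMonad O).toFunctor where
  app A := VGraph.Hom.mk (A := (VGraph.starMonad T).obj ((fcMonad O).obj A))
    (B := (fcMonad O).obj ((VGraph.starMonad T).obj A)) (fun a => a) (fcCmp T.toFunctor α A.hom)
  naturality A B f := VGraph.hom_mk_congr (A := (VGraph.starMonad T).obj ((fcMonad O).obj A))
    (B := (fcMonad O).obj ((VGraph.starMonad T).obj B)) fun a b =>
      fcCmp_naturality T.toFunctor α (H := A.hom) (H' := B.hom) (VGraph.Hom.obj f)
        (VGraph.Hom.hom f) a b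

theorem isParamInterchange_paramInterchange (h : IsAlgebraOperad T O α) :
    IsParamInterchange T O α (paramInterchange T O α) where
  preservesCoproducts := inferInstance
  isAlgebraOperad := h
  app_eq A := ⟨fcCmp T.toFunctor α A.hom, rfl, fun c => map_fcInj_cmp T.toFunctor α A.hom c⟩

/-- The four axioms correspond to the four clauses of `IsAlgebraOperad`. Compatibility with the unit
and multiplication of the free category monad uses that the unit and compositions of the operad are
algebra maps; compatibility with those of `T` uses the unit and associativity laws of the actions.
-/
theorem isDistributiveLaw_paramInterchange (h : IsAlgebraOperad T O α) :
    IsDistributiveLaw (VGraph.starMonad T) (fcMonad O) (paramInterchange T O α) where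
  map_unit A := VGraph.hom_mk_congr (A := (VGraph.starMonad T).obj A)
    (B := (fcMonad O).obj ((VGraph.starMonad T).obj A)) fun a b => fcCmp_unit T h A.hom a b
  unit_app A := VGraph.hom_mk_congr (A := (fcMonad O).obj A)
    (B := (fcMonad O).obj ((VGraph.starMonad T).obj A)) fun a b => unit_fcCmp T h A.hom a b
  map_mul A := VGraph.hom_mk_congr
    (A := (VGraph.starMonad T).obj ((fcMonad O).obj ((fcMonad O).obj A)))
    (B := (fcMonad O).obj ((VGraph.starMonad T).obj A)) fun a b => fcCmp_mul T h A.hom a b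
  mul_app A := VGraph.hom_mk_congr
    (A := (VGraph.starMonad T).obj ((VGraph.starMonad T).obj ((fcMonad O).obj A)))
    (B := (fcMonad O).obj ((VGraph.starMonad T).obj A)) fun a b => mul_fcCmp T h A.hom a b

/-- Interchange laws for two monads with a transformation `l : S T ⟹ T S` satisfy the Yang–Baxter
equation if the actions on the operad are compatible with `l`. -/
theorem yangBaxter_paramInterchange (R : Monad V)
    [∀ ι : Type u, PreservesColimitsOfShape (Discrete ι) R.toFunctor]
    (l : T.toFunctor ⋙ R.toFunctor ⟶ R.toFunctor ⋙ T.toFunctor)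
    (β : ∀ k, R.obj (O.P k) ⟶ O.P k)
    (hl : ∀ k, l.app (O.P k) ≫ T.map (β k) ≫ α k = R.map (α k) ≫ β k)
    (H : S → S → V) (a b : S) :
    l.app (fcHom O.P H a b) ≫ T.map (fcCmp R.toFunctor β H a b) ≫
        fcCmp T.toFunctor α (fun a b => R.obj (H a b)) a b =
      R.map (fcCmp T.toFunctor α H a b) ≫
        fcCmp R.toFunctor β (fun a b => T.obj (H a b)) a b ≫
          fcMap (fun a => a) (fun a b => l.app (H a b)) a b := by
  refine map_fcCell_ext (T.toFunctor ⋙ R.toFunctor) fun {X n} p c y => ?_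
  have e := l.naturality (fcCell p c y)
  have e₁ := l.naturality p
  have e₂ := l.naturality y
  have e₃ := alongCmp_natTrans l H c
  rw [alongCmp_comp, alongCmp_comp] at e₃
  dsimp only [Functor.comp_obj, Functor.comp_map] at e e₁ e₂ e₃ ⊢
  rw [← Category.assoc, e, Category.assoc, ← T.map_comp_assoc, map_fcCell_cmp, map_fcCell_cmp,
    comp_fcCell, ← R.map_comp_assoc, map_fcCell_cmp, map_fcCell_cmp_assoc, fcCell_map_id]
  -- On labels the equation is `hl`. On arrows it is `e₃`, which holds for any natural
  -- transformation `l`; that `l` be a distributive law plays no role.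
  refine congrArg₂ (fun x z => fcCell x c z) ?_ ?_
  · rw [T.map_comp, Category.assoc, ← Category.assoc, ← e₁, Category.assoc, hl, R.map_comp,
      Category.assoc]
  · rw [T.map_comp, Category.assoc, ← Category.assoc, ← e₂, Category.assoc, e₃, R.map_comp,
      Category.assoc, Category.assoc, Category.assoc]

end Interchange

/-! ### Applying a law to every hom-object -/

section StarLaw

variable {V : Type (u + 1)} [Category.{u} V]

/-- The transformation `S_* T_* ⟹ T_* S_*` induced by `S T ⟹ T S`. -/
def starLaw {R T : Monad V} (l : T.toFunctor ⋙ R.toFunctor ⟶ R.toFunctor ⋙ T.toFunctor) :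
    (VGraph.starMonad T).toFunctor ⋙ (VGraph.starMonad R).toFunctor ⟶
      (VGraph.starMonad R).toFunctor ⋙ (VGraph.starMonad T).toFunctor where
  app A := VGraph.Hom.mk (A := (VGraph.starMonad R).obj ((VGraph.starMonad T).obj A))
    (B := (VGraph.starMonad T).obj ((VGraph.starMonad R).obj A)) (fun a => a)
    (fun a b => l.app (A.hom a b))
  naturality A B f := VGraph.hom_mk_congr
    (A := (VGraph.starMonad R).obj ((VGraph.starMonad T).obj A))
    (B := (VGraph.starMonad T).obj ((VGraph.starMonad R).obj B)) fun a b =>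
      l.naturality (VGraph.Hom.hom f a b)

theorem isDistributiveLaw_starLaw {R T : Monad V}
    {l : T.toFunctor ⋙ R.toFunctor ⟶ R.toFunctor ⋙ T.toFunctor} (h : IsDistributiveLaw R T l) :
    IsDistributiveLaw (VGraph.starMonad R) (VGraph.starMonad T) (starLaw l) where
  map_unit A := VGraph.hom_mk_congr (A := (VGraph.starMonad R).obj A)
    (B := (VGraph.starMonad T).obj ((VGraph.starMonad R).obj A)) fun a b => h.map_unit _
  unit_app A := VGraph.hom_mk_congr (A := (VGraph.starMonad T).obj A)
    (B := (VGraph.starMonad T).obj ((VGraph.starMonad R).obj A)) fun a b => h.unit_app _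
  map_mul A := VGraph.hom_mk_congr
    (A := (VGraph.starMonad R).obj ((VGraph.starMonad T).obj ((VGraph.starMonad T).obj A)))
    (B := (VGraph.starMonad T).obj ((VGraph.starMonad R).obj A)) fun a b => h.map_mul _
  mul_app A := VGraph.hom_mk_congr
    (A := (VGraph.starMonad R).obj ((VGraph.starMonad R).obj ((VGraph.starMonad T).obj A)))
    (B := (VGraph.starMonad T).obj ((VGraph.starMonad R).obj A)) fun a b => h.mul_app _

end StarLaw

/-! ### The free category monad acts on underlying graphs -/

section Action

variable {C : Type (u + 1)} [Category.{u} C] [CartesianMonoidalCategory C]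
  {V : Type (u + 1)} [Category.{u} V] [CartesianMonoidalCategory V]
  {S : Type u} (F : C ⥤ V) [PreservesProducts F]

theorem nestCmpMap_isIso {P : ℕ → C} {P' : ℕ → V} (α : ∀ k, F.obj (P k) ⟶ P' k)
    [∀ k, IsIso (α k)] (H : S → S → C) {n : ℕ} {a b : S} {c : Chain n a b} {L : Ar n}
    (N : NChain c L) : IsIso (nestCmpMap F α H N) := by
  induction N with
  | nil a => exact PreservesProducts.unit
  | @snoc n k a b b' c L N l ih =>
      have := alongCmp_isIso F H l
      have := lift_isIso F (α k) (alongCmp F H l)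
      exact lift_isIso F (nestCmpMap F α H N)
        (lift (F.map (fst (P k) (along H l)) ≫ α k) (F.map (snd _ _) ≫ alongCmp F H l))

/-- This removes the inverse comparison map from the definition of `mapγ`: on images of elements of
`C`, the transported composition is the image of the composite. -/
theorem lift_mapγ {P : Operad C} (A : PCat P) {X : C} {n : ℕ} {a b : A.graph.obj}
    (c : Chain n a b) (p : X ⟶ P.P n) (q : X ⟶ along A.graph.hom c) :
    lift (F.map p) (F.map q ≫ alongCmp F A.graph.hom c) ≫ mapγ F A c =
      F.map (lift p q ≫ A.γ c) := by
  have := alongCmp_isIso F A.graph.hom c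
  have := pairCmp_isIso F (P.P n) (alongCmp F A.graph.hom c)
  rw [← map_lift_pairCmp, mapγ, Category.assoc, IsIso.hom_inv_id_assoc, F.map_comp]

variable [CoprodDistrib V]

/-- As `F` preserves products, each summand is up to isomorphism the image of a product formed in
`C`. Hence elements that are images under `F` detect equality, and identities of a `(C, P)`-category
can be transported by applying `F` to them. -/
theorem fcInj_eq_map {P : ℕ → C} {H : S → S → C} {n : ℕ} {a b : S} (c : Chain n a b) :
    have := alongCmp_isIso F H c
    have := pairCmp_isIso F (P n) (alongCmp F H c)
    fcInj (fun k => F.obj (P k)) (fun a b => F.obj (H a b)) c =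
      inv (pairCmp F (P n) (alongCmp F H c)) ≫
        fcCell (F.map (fst _ _)) c (F.map (snd _ _) ≫ alongCmp F H c) := by
  intro _ _
  rw [IsIso.eq_inv_comp]
  rfl

theorem fcCell_map_ext {P : ℕ → C} {H : S → S → C} {a b : S} {Z : V}
    {f g : fcHom (fun k => F.obj (P k)) (fun a b => F.obj (H a b)) a b ⟶ Z}
    (h : ∀ {X : C} {n : ℕ} (p : X ⟶ P n) (c : Chain n a b) (y : X ⟶ along H c),
      fcCell (P := fun k => F.obj (P k)) (H := fun a b => F.obj (H a b))
          (F.map p) c (F.map y ≫ alongCmp F H c) ≫ f =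
        fcCell (P := fun k => F.obj (P k)) (H := fun a b => F.obj (H a b))
          (F.map p) c (F.map y ≫ alongCmp F H c) ≫ g) : f = g :=
  fcHom_ext fun c => by rw [fcInj_eq_map, Category.assoc, Category.assoc, h]

theorem map_fcCell_map_ext {W : Type (u + 1)} [Category.{u} W] (T : V ⥤ W)
    [∀ ι : Type u, PreservesColimitsOfShape (Discrete ι) T]
    {P : ℕ → C} {H : S → S → C} {a b : S} {Z : W}
    {f g : T.obj (fcHom (fun k => F.obj (P k)) (fun a b => F.obj (H a b)) a b) ⟶ Z}
    (h : ∀ {X : C} {n : ℕ} (p : X ⟶ P n) (c : Chain n a b) (y : X ⟶ along H c),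
      T.map (fcCell (P := fun k => F.obj (P k)) (H := fun a b => F.obj (H a b))
          (F.map p) c (F.map y ≫ alongCmp F H c)) ≫ f =
        T.map (fcCell (P := fun k => F.obj (P k)) (H := fun a b => F.obj (H a b))
          (F.map p) c (F.map y ≫ alongCmp F H c)) ≫ g) : f = g :=
  map_fcHom_ext T fun c => by
    rw [fcInj_eq_map, T.map_comp, Category.assoc, Category.assoc, h]

theorem fcCell_map_ext₂ {P : ℕ → C} {H : S → S → C} {a b : S} {Z : V}
    {f g : fcHom (fun k => F.obj (P k))
      (fcHom (fun k => F.obj (P k)) (fun a b => F.obj (H a b))) a b ⟶ Z}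
    (h : ∀ {X : C} {n : ℕ} (p : X ⟶ P n) {c : Chain n a b} {L : Ar n} (N : NChain c L)
      (y : X ⟶ nest P H N),
      fcCell (P := fun k => F.obj (P k)) (F.map p) c
          ((F.map y ≫ nestCmpMap F (fun k => 𝟙 (F.obj (P k))) H N) ≫
            nestEval (fcInj (fun k => F.obj (P k)) (fun a b => F.obj (H a b))) N) ≫ f =
        fcCell (P := fun k => F.obj (P k)) (F.map p) c
          ((F.map y ≫ nestCmpMap F (fun k => 𝟙 (F.obj (P k))) H N) ≫
            nestEval (fcInj (fun k => F.obj (P k)) (fun a b => F.obj (H a b))) N) ≫ g) :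
    f = g := by
  refine fcCell_ext₂ fun {X n} p {c L} N y => ?_
  have := nestCmpMap_isIso F (fun k => 𝟙 (F.obj (P k))) H N
  have := pairCmp_isIso F (P n) (nestCmpMap F (fun k => 𝟙 (F.obj (P k))) H N)
  -- The pair of projections on `P n ⊗ nest P H N` is the universal element in `C`; every element
  -- `(p, y)` in `V` is its image under `F` pulled back along `z`.
  let z := lift p y ≫ inv (pairCmp F (P n) (nestCmpMap F (fun k => 𝟙 (F.obj (P k))) H N))
  have hz : z ≫ pairCmp F (P n) (nestCmpMap F (fun k => 𝟙 (F.obj (P k))) H N) = lift p y := by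
    rw [Category.assoc, IsIso.inv_hom_id, Category.comp_id]
  have hp : z ≫ F.map (fst _ _) = p := by
    have := congrArg (· ≫ fst _ _) hz
    simpa only [pairCmp, Category.assoc, lift_fst] using this
  have hy : z ≫ F.map (snd _ _) ≫ nestCmpMap F (fun k => 𝟙 (F.obj (P k))) H N = y := by
    have := congrArg (· ≫ snd _ _) hz
    simpa only [pairCmp, Category.assoc, lift_snd] using this
  have e := h (fst _ _) N (snd _ _)
  have e' := congrArg (z ≫ ·) e
  simp only [← Category.assoc, comp_fcCell] at e'
  simp only [Category.assoc, reassoc_of% hy] at e'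
  rw [hp] at e'
  exact e'

variable {P : Operad C} (A : PCat P)

theorem fcCell_mapγ {X : C} {n : ℕ} {a b : A.graph.obj}
    (c : Chain n a b) (p : X ⟶ P.P n) (q : X ⟶ along A.graph.hom c) :
    fcCell (P := fun k => F.obj (P.P k)) (H := fun a b => F.obj (A.graph.hom a b)) (F.map p) c
        (F.map q ≫ alongCmp F A.graph.hom c) ≫ fcDesc (fun c => mapγ F A c) =
      F.map (lift p q ≫ A.γ c) := by
  rw [fcCell, Category.assoc, fcInj_desc, lift_mapγ]

theorem fcUnit_mapγ (a b : A.graph.obj) :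
    fcUnit (fun a b => F.obj (A.graph.hom a b)) (P.map F) a b ≫ fcDesc (fun c => mapγ F A c) =
      𝟙 (F.obj (A.graph.hom a b)) := by
  have e := fcCell_mapγ F A ((Chain.nil a).snoc b) (toUnit (A.graph.hom a b) ≫ P.unit)
    (alongOne A.graph.hom a b)
  rw [A.γ_unit, F.map_id, alongCmp_one, map_toUnit_unit] at e
  exact e

/-- This is the image under `F` of the associativity law of `A`: evaluating after flattening agrees
with evaluating twice. -/
theorem fcMul_mapγ (a b : A.graph.obj) :
    fcMul (fun a b => F.obj (A.graph.hom a b)) (P.map F) a b ≫ fcDesc (fun c => mapγ F A c) =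
      fcMap (fun a => a) (fun a b => fcDesc (fun c => mapγ F A c)) a b ≫
        fcDesc (fun c => mapγ F A c) := by
  refine fcCell_map_ext₂ F (P := P.P) (H := A.graph.hom) fun {X n} p {c L} N y => ?_
  -- The labels (`l₁`), the concatenated arrows (`l₂`) and the inner composites (`l₃`) of the test
  -- element are all images of data in `C`, followed by comparison maps. Both sides thereby become
  -- images of morphisms of `C`.
  have l₁ : (F.map y ≫ nestCmpMap F (fun k => 𝟙 (F.obj (P.P k))) A.graph.hom N) ≫
      labels (fun k => F.obj (P.P k)) (fun a b => F.obj (A.graph.hom a b)) N =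
      F.map (y ≫ labels P.P A.graph.hom N) ≫ tensCmp F P.P L := by
    rw [Category.assoc, nestCmpMap_labels, tensMap_id, Category.comp_id, F.map_comp,
      Category.assoc]
  have l₂ : (F.map y ≫ nestCmpMap F (fun k => 𝟙 (F.obj (P.P k))) A.graph.hom N) ≫
      arrows (fun k => F.obj (P.P k)) (fun a b => F.obj (A.graph.hom a b)) N =
      F.map (y ≫ arrows P.P A.graph.hom N) ≫ alongCmp F A.graph.hom N.flatten := by
    rw [Category.assoc, nestCmpMap_arrows, F.map_comp, Category.assoc]
  have l₃ : ((F.map y ≫ nestCmpMap F (fun k => 𝟙 (F.obj (P.P k))) A.graph.hom N) ≫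
      nestEval (fcInj (fun k => F.obj (P.P k)) (fun a b => F.obj (A.graph.hom a b))) N) ≫
      alongHom (fun a b => fcDesc (fun c => mapγ F A c)) c =
      F.map (y ≫ nestEval A.γ N) ≫ alongCmp F A.graph.hom c := by
    rw [Category.assoc, nestEval_alongHom]
    simp only [fcInj_desc]
    rw [Category.assoc, nestCmpMap_eval F (fun k => 𝟙 (F.obj (P.P k))) A.graph.hom A.γ
      (fun c => mapγ F A c) (fun a b => 𝟙 (F.obj (A.graph.hom a b))), alongHom_id,
      Category.comp_id, F.map_comp, Category.assoc]
    intro k a b l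
    rw [Category.comp_id, Category.comp_id, lift_mapγ, lift_fst_snd, Category.id_comp]
  have e₁ := fcCell_mul (O := P.map F) (H := fun a b => F.obj (A.graph.hom a b)) N (F.map p)
    (F.map y ≫ nestCmpMap F (fun k => 𝟙 (F.obj (P.P k))) A.graph.hom N)
  have e₂ := fcCell_map_id (P := fun k => F.obj (P.P k))
    (fun a b => fcDesc (fun c => mapγ F A c)) (F.map p) c
    ((F.map y ≫ nestCmpMap F (fun k => 𝟙 (F.obj (P.P k))) A.graph.hom N) ≫
      nestEval (fcInj (fun k => F.obj (P.P k)) (fun a b => F.obj (A.graph.hom a b))) N)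
  refine (Category.assoc _ _ _).symm.trans ((congrArg (· ≫ _) e₁).trans ?_)
  refine Eq.trans ?_ ((Category.assoc _ _ _).symm.trans (congrArg (· ≫ _) e₂)).symm
  rw [l₃]
  have e₃ : lift (F.map p) (F.map (y ≫ labels P.P A.graph.hom N) ≫ tensCmp F P.P L) ≫
      mapComp F P L = _ := lift_mapComp F P L p (y ≫ labels P.P A.graph.hom N)
  have e₄ := A.γ_assoc N
  refine (congrArg₂ (fun s t => fcCell (P := fun k => F.obj (P.P k))
    (H := fun a b => F.obj (A.graph.hom a b)) s N.flatten t ≫ fcDesc (fun c => mapγ F A c))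
    ((congrArg (fun t => lift (F.map p) t ≫ mapComp F P L) l₁).trans e₃) l₂).trans ?_
  rw [fcCell_mapγ, fcCell_mapγ]
  -- What remains is an equation inside `C`, namely `A.γ_assoc` evaluated at the element `(p, y)`.
  have e₅ := congrArg (lift p y ≫ ·) e₄
  refine congrArg F.map (Eq.trans ?_ (e₅.trans ?_))
  · rw [← Category.assoc, comp_lift, lift_whiskerLeft_assoc, lift_snd_assoc]
  · rw [lift_whiskerLeft_assoc]

/-- On images of elements of `C`, this is the condition that `f` is a functor, with `F` applied. -/
theorem mapγ_naturality {A B : PCat P} (f : A ⟶ B) (a b : A.graph.obj) :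
    fcMap (H' := fun a b => F.obj (B.graph.hom a b)) (VGraph.Hom.obj f.1)
        (fun a b => F.map (VGraph.Hom.hom f.1 a b)) a b ≫ fcDesc (fun c => mapγ F B c) =
      fcDesc (fun c => mapγ F A c) ≫ F.map (VGraph.Hom.hom f.1 a b) := by
  refine fcCell_map_ext F (P := P.P) (H := A.graph.hom) fun {X n} p c y => ?_
  rw [← Category.assoc, ← Category.assoc, fcCell_mapγ, fcCell_map, Category.assoc, alongCmp_map,
    ← F.map_comp_assoc, fcCell_mapγ, ← F.map_comp, Category.assoc]
  rw [f.2 c, lift_whiskerLeft_assoc]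

theorem fcAct_naturality {A B : PCat P} (f : A ⟶ B) :
    (fcMonad (P.map F)).map ((VGraph.star F).map f.1) ≫ fcAct F B =
      fcAct F A ≫ (VGraph.star F).map f.1 :=
  VGraph.hom_mk_congr (A := (fcMonad (P.map F)).obj ((VGraph.star F).obj A.graph))
    (B := (VGraph.star F).obj B.graph) fun a b => mapγ_naturality F f a b

theorem fcAct_unit : (fcMonad (P.map F)).η.app ((VGraph.star F).obj A.graph) ≫ fcAct F A = 𝟙 _ :=
  VGraph.hom_mk_congr (A := (VGraph.star F).obj A.graph)
    (B := (VGraph.star F).obj A.graph) fun a b => fcUnit_mapγ F A a b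

theorem fcAct_mul : (fcMonad (P.map F)).μ.app ((VGraph.star F).obj A.graph) ≫ fcAct F A =
    (fcMonad (P.map F)).map (fcAct F A) ≫ fcAct F A :=
  VGraph.hom_mk_congr
    (A := (fcMonad (P.map F)).obj ((fcMonad (P.map F)).obj ((VGraph.star F).obj A.graph)))
    (B := (VGraph.star F).obj A.graph) fun a b => fcMul_mapγ F A a b

end Action

/-! ### Natural actions of a monad on the values of a functor -/

section NaturalAction

variable {C : Type (u + 1)} [Category.{u} C] {V : Type (u + 1)} [Category.{u} V]

/-- Algebra structures for the monad `T` on the values of a functor `F`, natural in the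
argument. -/
structure IsNaturalAction (T : Monad V) (F : C ⥤ V) (τ : ∀ A : C, T.obj (F.obj A) ⟶ F.obj A) :
    Prop where
  naturality : ∀ {A B : C} (f : A ⟶ B), T.map (F.map f) ≫ τ B = τ A ≫ F.map f
  unit : ∀ A, T.η.app (F.obj A) ≫ τ A = 𝟙 _
  mul : ∀ A, T.μ.app (F.obj A) ≫ τ A = T.map (τ A) ≫ τ A

namespace IsNaturalAction

variable {T : Monad V} {F : C ⥤ V} {τ : ∀ A : C, T.obj (F.obj A) ⟶ F.obj A}

/-- Regarding the action as a natural transformation makes `alongCmp_natTrans` and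
`tensCmp_natTrans` applicable to it. -/
def natTrans (h : IsNaturalAction T F τ) : F ⋙ T.toFunctor ⟶ F where
  app := τ
  naturality _ _ f := h.naturality f

variable [CartesianMonoidalCategory C] [CartesianMonoidalCategory V] {S : Type u}

theorem alongCmp_action (h : IsNaturalAction T F τ) (H : S → S → C) {n : ℕ} {a b : S}
    (c : Chain n a b) :
    T.map (alongCmp F H c) ≫ alongCmp T.toFunctor (fun a b => F.obj (H a b)) c ≫
        alongHom (fun a b => τ (H a b)) c = τ (along H c) ≫ alongCmp F H c := by
  have e := alongCmp_natTrans h.natTrans H c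
  rw [alongCmp_comp, Category.assoc] at e
  exact e.symm

theorem tensCmp_action (h : IsNaturalAction T F τ) (P : ℕ → C) {n : ℕ} (L : Ar n) :
    T.map (tensCmp F P L) ≫ tensCmp T.toFunctor (fun k => F.obj (P k)) L ≫
        tensMap (fun k => τ (P k)) L = τ (tens P L) ≫ tensCmp F P L := by
  have e := tensCmp_natTrans h.natTrans P L
  rw [tensCmp_comp, Category.assoc] at e
  exact e.symm

variable [PreservesProducts F]

/-- Naturality says that `F` sends every morphism of `C` to an algebra map, in particular the unit
and compositions of `P`. Product preservation identifies the action on the image of a product with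
the componentwise one. -/
theorem isAlgebraOperad (h : IsNaturalAction T F τ) (P : Operad C) :
    IsAlgebraOperad T (P.map F) (fun k => τ (P.P k)) where
  unit_act k := h.unit _
  mul_act k := h.mul _
  map_unit := by
    show T.map (mapUnit F P) ≫ τ (P.P 1) = toUnit _ ≫ mapUnit F P
    rw [mapUnit, T.map_comp, Category.assoc, h.naturality, ← Category.assoc, ← Category.assoc]
    refine congrArg (· ≫ F.map P.unit) ?_
    -- The image of the terminal object is terminal, so the map to the unit is invertible and may be
    -- cancelled.
    rw [← cancel_mono (toUnit (F.obj (𝟙_ C)))]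
    exact toUnit_unique _ _
  map_comp {n} L := by
    show T.map (mapComp F P L) ≫ τ (P.P L.sum) =
      lift (T.map (fst (F.obj (P.P n)) (tens (fun k => F.obj (P.P k)) L)) ≫ τ (P.P n))
        (T.map (snd _ _) ≫ tensCmp T.toFunctor (fun k => F.obj (P.P k)) L ≫
          tensMap (fun k => τ (P.P k)) L) ≫ mapComp F P L
    have := tensCmp_isIso F P.P L
    have := pairCmp_isIso F (P.P n) (tensCmp F P.P L)
    -- Precomposing with the image of an isomorphism removes the inverse in `mapComp`, after which
    -- `h.naturality` applies to the original composition in `C`.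
    rw [← cancel_epi (T.map (pairCmp F (P.P n) (tensCmp F P.P L))), ← T.map_comp_assoc,
      pairCmp_mapComp, h.naturality, pairCmp, ← Category.assoc, map_lift_lift, T.map_comp,
      Category.assoc, h.tensCmp_action, h.naturality, ← Category.assoc, h.naturality,
      Category.assoc, ← comp_lift, Category.assoc, lift_mapComp, lift_fst_snd, Category.id_comp]

variable [CoprodDistrib V] [∀ ι : Type u, PreservesColimitsOfShape (Discrete ι) T.toFunctor]

/-- The composition maps of `A` are morphisms of `C`, so their images commute with the natural
action; the action on labels in the comparison map is the same action, taken at the objects of the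
operad. -/
theorem mapγ_action (h : IsNaturalAction T F τ) {P : Operad C} (A : PCat P) (a b : A.graph.obj) :
    fcCmp T.toFunctor (P := fun k => F.obj (P.P k)) (fun k => τ (P.P k))
        (fun a b => F.obj (A.graph.hom a b)) a b ≫
      fcMap (fun a => a) (fun a b => τ (A.graph.hom a b)) a b ≫ fcDesc (fun c => mapγ F A c) =
    T.map (fcDesc (fun c => mapγ F A c)) ≫ τ (A.graph.hom a b) := by
  refine map_fcCell_map_ext F T.toFunctor (P := P.P) (H := A.graph.hom) fun {X n} p c y => ?_
  rw [map_fcCell_cmp_assoc, ← T.map_comp_assoc, fcCell_mapγ, h.naturality, ← Category.assoc,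
    fcCell_map_id, T.map_comp, Category.assoc, Category.assoc, h.alongCmp_action, h.naturality,
    ← Category.assoc, h.naturality, Category.assoc, ← comp_fcCell, Category.assoc, fcCell_mapγ]

/-- The parametrised interchange law holds in every `(C, P)`-category. -/
theorem fcAct_action (h : IsNaturalAction T F τ) {P : Operad C} (A : PCat P)
    (σ : (VGraph.starMonad T).obj ((VGraph.star F).obj A.graph) ⟶ (VGraph.star F).obj A.graph)
    (hσ : σ = VGraph.Hom.mk (A := (VGraph.starMonad T).obj ((VGraph.star F).obj A.graph))
      (B := (VGraph.star F).obj A.graph) (fun a => a) (fun a b => τ (A.graph.hom a b))) :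
    (paramInterchange T (P.map F) (fun k => τ (P.P k))).app ((VGraph.star F).obj A.graph) ≫
        (fcMonad (P.map F)).map σ ≫ fcAct F A =
      (VGraph.starMonad T).map (fcAct F A) ≫ σ := by
  -- The action enters as a variable with an equation, so that an action that agrees with the
  -- displayed one only by unfolding can be supplied with `rfl`.
  subst hσ
  exact VGraph.hom_mk_congr
    (A := (VGraph.starMonad T).obj ((fcMonad (P.map F)).obj ((VGraph.star F).obj A.graph)))
    (B := (VGraph.star F).obj A.graph) fun a b => h.mapγ_action A a b

end IsNaturalAction

end NaturalAction

/-! ### Initial objects in distributive categories -/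

section Initial

variable {V : Type (u + 1)} [Category.{u} V] [CartesianMonoidalCategory V] [CoprodDistrib V]

/-- An initial object is an empty coproduct, and distributivity with empty index set makes `X ⊗ -`
preserve it. -/
theorem nonempty_isInitial_tensor_right (X : V) {I : V} (h : Nonempty (IsInitial I)) :
    Nonempty (IsInitial (X ⊗ I)) := by
  obtain ⟨h⟩ := h
  let e : I ≅ ∐ (PEmpty.elim : PEmpty.{u + 1} → V) :=
    { hom := h.to _
      inv := Sigma.desc fun i => i.elim
      hom_inv_id := h.hom_ext _ _
      inv_hom_id := Sigma.hom_ext _ _ fun i => i.elim }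
  exact ⟨IsInitial.ofUniqueHom (fun Z => X ◁ e.hom ≫ tensorDesc fun i => i.elim) fun Z m => by
    have : m = X ◁ e.hom ≫ X ◁ e.inv ≫ m := by
      rw [← whiskerLeft_comp_assoc, e.hom_inv_id, whiskerLeft_id, Category.id_comp]
    rw [this]
    exact congrArg _ (tensor_hom_ext fun i => i.elim)⟩

theorem nonempty_isInitial_tensor_left (X : V) {I : V} (h : Nonempty (IsInitial I)) :
    Nonempty (IsInitial (I ⊗ X)) := by
  obtain ⟨h⟩ := nonempty_isInitial_tensor_right X h
  exact ⟨h.ofIso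
    { hom := lift (snd _ _) (fst _ _)
      inv := lift (snd _ _) (fst _ _)
      hom_inv_id := by ext <;> simp
      inv_hom_id := by ext <;> simp }⟩

theorem nonempty_isInitial_sigma {ι : Type u} (Y : ι → V) (h : ∀ i, Nonempty (IsInitial (Y i))) :
    Nonempty (IsInitial (∐ Y)) :=
  ⟨IsInitial.ofUniqueHom (fun Z => Sigma.desc fun i => (h i).some.to Z)
    fun Z m => Sigma.hom_ext _ _ fun i => (h i).some.hom_ext _ _⟩

theorem nonempty_isInitial_obj (F : V ⥤ V)
    [∀ ι : Type u, PreservesColimitsOfShape (Discrete ι) F] {I : V}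
    (h : Nonempty (IsInitial I)) : Nonempty (IsInitial (F.obj I)) := by
  obtain ⟨h⟩ := h
  -- Coproducts are indexed by types in universe `u`, while preservation of initial objects refers
  -- to a fixed empty type; the two empty diagrams are equivalent.
  have := preservesColimitsOfShape_of_equiv
    (Discrete.equivalence (Equiv.equivPEmpty PEmpty.{u + 1}) : Discrete PEmpty.{u + 1} ≌ _) F
  exact ⟨IsInitial.isInitialObj F I h⟩

end Initial

/-! ### Recognising coproducts of graphs -/

namespace VGraph

variable {V : Type (u + 1)} [Category.{u} V]

/-- A graph whose objects are those of the disjoint union of the graphs `A i` is their coproduct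
if the hom-objects within each `A i` are unchanged and those between different ones are initial. -/
theorem nonempty_isColimit_sigma {ι : Type u} (A : ι → VGraph V)
    (H : (Σ i, (A i).obj) → (Σ i, (A i).obj) → V)
    (k : ∀ i (a b : (A i).obj), (A i).hom a b ⟶ H ⟨i, a⟩ ⟨i, b⟩)
    (hk : ∀ i (a b : (A i).obj), IsIso (k i a b))
    (h₀ : ∀ x y, x.1 ≠ y.1 → Nonempty (IsInitial (H x y))) :
    Nonempty (IsColimit (Cofan.mk (VGraph.mk _ H)
      fun i => (Hom.mk (fun a => ⟨i, a⟩) (k i) : A i ⟶ VGraph.mk _ H))) := by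
  classical
  -- On each hom-object the induced map is forced: inside a summand by inverting `k`, across
  -- summands by initiality. Quantifying over all presentations of `x` and `y`, with heterogeneous
  -- equality, states the two cases uniformly, so that `choose` yields one family `d`.
  have ex : ∀ {Z : VGraph V} (φ : ∀ i, A i ⟶ Z) (x y : Σ i, (A i).obj),
      ∃! d : H x y ⟶ Z.hom (Hom.obj (φ x.1) x.2) (Hom.obj (φ y.1) y.2),
        ∀ i a b (hx : x = ⟨i, a⟩) (hy : y = ⟨i, b⟩),
          HEq (k i a b ≫ eqToHom (by rw [hx, hy]) ≫ d) (Hom.hom (φ i) a b) := by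
    rintro Z φ ⟨i, a⟩ ⟨j, b⟩
    by_cases h : i = j
    · subst h
      refine ⟨inv (k i a b) ≫ Hom.hom (φ i) a b, ?_, ?_⟩
      · intro i' a' b' hx hy
        cases hx
        cases hy
        rw [eqToHom_refl, Category.id_comp, IsIso.hom_inv_id_assoc]
      · intro d hd
        have := eq_of_heq (hd i a b rfl rfl)
        rw [eqToHom_refl, Category.id_comp] at this
        rw [IsIso.eq_inv_comp, this]
    · obtain ⟨I⟩ := h₀ ⟨i, a⟩ ⟨j, b⟩ h
      refine ⟨I.to _, ?_, fun _ _ => I.hom_ext _ _⟩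
      intro i' a' b' hx hy
      exact absurd ((congrArg Sigma.fst hx).trans (congrArg Sigma.fst hy).symm) h
  choose d hd hd' using @ex
  refine ⟨Cofan.IsColimit.mk _ (fun s => Hom.mk (A := VGraph.mk _ H)
    (fun x => Hom.obj (s.inj x.1) x.2) (d s.inj)) ?_ ?_⟩
  · intro s i
    refine hom_mk_congr (A := A i) (B := s.pt) fun a b => ?_
    have := eq_of_heq (hd s.inj ⟨i, a⟩ ⟨i, b⟩ i a b rfl rfl)
    rwa [eqToHom_refl, Category.id_comp] at this
  · intro s m hm
    obtain ⟨mo, mh⟩ := m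
    have hm' : s.inj = fun i => (Hom.mk (fun a => ⟨i, a⟩) (k i) : A i ⟶ VGraph.mk _ H) ≫
      (Hom.mk mo mh : VGraph.mk _ H ⟶ s.pt) := funext fun i => (hm i).symm
    -- Once the cocone is expressed through `m`, the induced map and `m` have the same object
    -- function definitionally, and only hom components remain to be compared.
    rw [hm']
    refine hom_mk_congr (A := VGraph.mk _ H) (B := s.pt) fun x y => ?_
    refine hd' (Z := s.pt) (fun i => (Hom.mk (fun a => ⟨i, a⟩) (k i) : A i ⟶ VGraph.mk _ H) ≫
      (Hom.mk mo mh : VGraph.mk _ H ⟶ s.pt)) x y (mh x y) ?_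
    rintro i a b rfl rfl
    rw [eqToHom_refl, Category.id_comp]
    rfl

/-- The target is a coproduct over the proofs of `i = i`, a one-element index type. -/
theorem sigmaInj_isIso [CartesianMonoidalCategory V] [CoprodDistrib V] {ι : Type u}
    (A : ι → VGraph V) (i : ι) (a b : (A i).obj) : IsIso (Hom.hom (sigmaInj A i) a b) :=
  ⟨Sigma.desc (fun h : ULift.{u} (PLift (i = i)) => 𝟙 ((A i).hom a b)),
    Sigma.ι_desc _ _, Sigma.hom_ext _ _ fun h => (Category.assoc _ _ _).symm.trans
      ((congrArg (· ≫ Hom.hom (sigmaInj A i) a b) (Sigma.ι_desc _ _)).trans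
        ((Category.id_comp _).trans (Category.comp_id _).symm))⟩

theorem sigma_isInitial [CartesianMonoidalCategory V] [CoprodDistrib V] {ι : Type u}
    (A : ι → VGraph V) {x y : Σ i, (A i).obj} (h : x.1 ≠ y.1) :
    Nonempty (IsInitial ((sigma A).hom x y)) :=
  nonempty_isInitial_sigma _ fun e => absurd e.down.down h

variable [CartesianMonoidalCategory V] [CoprodDistrib V]

/-- Preservation need only be checked on one colimit cocone per family. With `sigma` chosen, both
functors in question keep the object set `Σ i, (A i).obj`, so `nonempty_isColimit_sigma` is the test
to pass. -/
theorem preservesCoproducts_of_isColimit (F : VGraph V ⥤ VGraph V)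
    (h : ∀ {ι : Type u} (A : ι → VGraph V),
      Nonempty (IsColimit (Cofan.mk (F.obj (sigma A)) fun i => F.map (sigmaInj A i))))
    (ι : Type u) : PreservesColimitsOfShape (Discrete ι) F := by
  refine @preservesColimitsOfShape_of_discrete _ _ _ _ _ _ (fun A => ?_)
  exact preservesColimit_of_preserves_colimit_cocone (sigmaIsColimit A)
    ((isColimitMapCoconeCofanMkEquiv F A (sigmaInj A)).symm (h A).some)

/-- The criterion asks for isomorphisms within summands and initial objects between them. Any
functor preserves the former, and `F` preserves the latter as empty coproducts. -/
instance star_preservesCoproducts (F : V ⥤ V)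
    [∀ ι : Type u, PreservesColimitsOfShape (Discrete ι) F] (ι : Type u) :
    PreservesColimitsOfShape (Discrete ι) (star F) :=
  preservesCoproducts_of_isColimit (star F) (fun A =>
    nonempty_isColimit_sigma (fun i => (star F).obj (A i)) ((star F).obj (sigma A)).hom
      (fun i a b => F.map (Hom.hom (sigmaInj A i) a b))
      (fun i a b => @Functor.map_isIso _ _ _ _ _ _ F _ (sigmaInj_isIso A i a b))
      (fun x y h => nonempty_isInitial_obj F (sigma_isInitial A h))) ι

end VGraph

/-! ### Chains in a disjoint union -/

namespace Chain

theorem map_injective {S S' : Type u} {o : S → S'} (ho : Function.Injective o) {n : ℕ} {a b : S}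
    (c : Chain n a b) : ∀ d : Chain n a b, c.map o = d.map o → c = d := by
  induction c with
  | nil a => intro d _; cases d; rfl
  | @snoc n a b c b' ih =>
      intro d h
      cases d with
      | @snoc _ _ b₂ d _ =>
      simp only [map, snoc.injEq] at h
      obtain ⟨e, h⟩ := h
      obtain rfl := ho e
      rw [ih d (eq_of_heq h)]

/-- The chain lies in one of the sets `O i`. -/
inductive InFibre {ι : Type u} {O : ι → Type u} :
    {n : ℕ} → {x y : Σ i, O i} → Chain n x y → Prop
  | map (i : ι) {n : ℕ} {a b : O i} (c : Chain n a b) : InFibre (c.map fun a => ⟨i, a⟩)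

theorem InFibre.fst_eq {ι : Type u} {O : ι → Type u} {n : ℕ} {x y : Σ i, O i} {c : Chain n x y}
    (h : InFibre c) : x.1 = y.1 := by
  cases h
  rfl

theorem InFibre.exists_eq {ι : Type u} {O : ι → Type u} {i : ι} {a b : O i} {n : ℕ}
    {c : Chain n (⟨i, a⟩ : Σ i, O i) ⟨i, b⟩} (h : InFibre c) :
    ∃ c' : Chain n a b, c'.map (fun a => (⟨i, a⟩ : Σ i, O i)) = c := by
  cases h with
  | map _ c => exact ⟨c, rfl⟩

end Chain

/-! ### The free category functor preserves coproducts -/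

section FreeCoproducts

variable {V : Type (u + 1)} [Category.{u} V] [CartesianMonoidalCategory V] [CoprodDistrib V]
  {ι : Type u} (A : ι → VGraph V)

/-- The hom-objects of a disjoint union of graphs. -/
abbrev sigmaHom : (Σ i, (A i).obj) → (Σ i, (A i).obj) → V := (VGraph.sigma A).hom

abbrev sigmaInjHom (i : ι) (a b : (A i).obj) : (A i).hom a b ⟶ sigmaHom A ⟨i, a⟩ ⟨i, b⟩ :=
  VGraph.Hom.hom (VGraph.sigmaInj A i) a b

abbrev alongInj (i : ι) {n : ℕ} {a b : (A i).obj} (c : Chain n a b) :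
    along (A i).hom c ⟶ along (sigmaHom A) (c.map fun a => (⟨i, a⟩ : Σ i, (A i).obj)) :=
  alongMap (fun a => (⟨i, a⟩ : Σ i, (A i).obj)) (sigmaInjHom A i) c

abbrev fcSigmaInj (P : ℕ → V) (i : ι) (a b : (A i).obj) :
    fcHom P (A i).hom a b ⟶ fcHom P (sigmaHom A) ⟨i, a⟩ ⟨i, b⟩ :=
  fcMap (fun a => (⟨i, a⟩ : Σ i, (A i).obj)) (sigmaInjHom A i) a b

/-- A chain that leaves its summand has a step between different summands. The hom-object there is
initial, and an initial factor makes the whole product initial. -/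
theorem inFibre_or_isInitial {n : ℕ} {x y : Σ i, (A i).obj} (c : Chain n x y) :
    c.InFibre ∨ Nonempty (IsInitial (along (sigmaHom A) c)) := by
  induction c with
  | nil x => exact Or.inl (Chain.InFibre.map (O := fun i => (A i).obj) x.1 (Chain.nil x.2))
  | @snoc n x y c y' ih =>
      rcases ih with h | h
      · cases h with
        | @map i n a b c =>
        obtain ⟨j, b'⟩ := y'
        by_cases e : i = j
        · subst e
          exact Or.inl (Chain.InFibre.map (O := fun i => (A i).obj) i (Chain.snoc c b'))
        · exact Or.inr (nonempty_isInitial_tensor_right _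
            (VGraph.sigma_isInitial A (x := ⟨i, b⟩) (y := ⟨j, b'⟩) e))
      · exact Or.inr (nonempty_isInitial_tensor_left _ h)

theorem alongMap_isIso {S S' : Type u} {H : S → S → V} {H' : S' → S' → V} (o : S → S')
    (h : ∀ a b, H a b ⟶ H' (o a) (o b)) [∀ a b, IsIso (h a b)] {n : ℕ} {a b : S}
    (c : Chain n a b) : IsIso (alongMap o h c) := by
  induction c with
  | nil a => exact (inferInstance : IsIso (𝟙 (𝟙_ V)))
  | @snoc n a b c b' ih => exact (inferInstance : IsIso (alongMap o h c ⊗ₘ h b b'))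

theorem alongInj_isIso (i : ι) {n : ℕ} {a b : (A i).obj} (c : Chain n a b) :
    IsIso (alongInj A i c) :=
  have : ∀ a b, IsIso (sigmaInjHom A i a b) := VGraph.sigmaInj_isIso A i
  alongMap_isIso _ _ c

/-- Chains of the disjoint union lying in one summand are exactly the chains of that summand, with
isomorphic products of hom-objects; all other chains contribute initial terms to the coproduct. -/
theorem fcSigmaInj_isIso (P : ℕ → V) (i : ι) (a b : (A i).obj) : IsIso (fcSigmaInj A P i a b) := by
  -- The inverse is built one summand at a time. The two conditions on `r` give the two inverse
  -- laws; the first allows for `c` being only propositionally the image of a chain in the summand.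
  have ex : ∀ {n : ℕ} (c : Chain n (⟨i, a⟩ : Σ i, (A i).obj) ⟨i, b⟩),
      ∃ r : P n ⊗ along (sigmaHom A) c ⟶ fcHom P (A i).hom a b,
        (∀ (c' : Chain n a b) (e : c'.map (fun a => (⟨i, a⟩ : Σ i, (A i).obj)) = c),
          P n ◁ alongInj A i c' ≫
            eqToHom (congrArg (fun d => P n ⊗ along (sigmaHom A) d) e) ≫ r =
              fcInj P (A i).hom c') ∧
        r ≫ fcSigmaInj A P i a b = fcInj P (sigmaHom A) c := by
    intro n c
    by_cases h : c.InFibre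
    · obtain ⟨c', rfl⟩ := h.exists_eq
      have := alongInj_isIso A i c'
      refine ⟨inv (P n ◁ alongInj A i c') ≫ fcInj P (A i).hom c', ?_, ?_⟩
      · intro c'' e
        -- The chain chosen to define `r` is the only one with image `c`, so the first condition
        -- holds for every preimage.
        obtain rfl := Chain.map_injective (fun x y h => by cases h; rfl) _ _ e
        rw [eqToHom_refl, Category.id_comp, IsIso.hom_inv_id_assoc]
      · rw [Category.assoc, IsIso.inv_comp_eq]
        exact fcInj_desc _ c'
    · obtain ⟨I⟩ := nonempty_isInitial_tensor_right (P n)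
        ((inFibre_or_isInitial A c).resolve_left h)
      exact ⟨I.to _, fun c' e => absurd (e ▸ Chain.InFibre.map (O := fun i => (A i).obj) i c') h, I.hom_ext _ _⟩
  choose r hr hr' using @ex
  refine ⟨fcDesc r, fcHom_ext fun {n} c => ?_, fcHom_ext fun {n} c => ?_⟩
  · rw [← Category.assoc, fcSigmaInj, fcMap, fcInj_desc, Category.assoc, fcInj_desc,
      Category.comp_id]
    have := hr _ c rfl
    rwa [eqToHom_refl, Category.id_comp] at this
  · rw [← Category.assoc, fcInj_desc, hr', Category.comp_id]

theorem fcHom_sigma_isInitial (P : ℕ → V) {x y : Σ i, (A i).obj} (h : x.1 ≠ y.1) :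
    Nonempty (IsInitial (fcHom P (sigmaHom A) x y)) :=
  nonempty_isInitial_sigma _ fun c => nonempty_isInitial_tensor_right _
    ((inFibre_or_isInitial A c.2).resolve_left fun hc => h hc.fst_eq)

/-- This makes the free category monad, and then all its iterated stars, admissible as the monad `T`
of an interchange law one dimension higher. -/
instance fcFunctor_preservesCoproducts (P : ℕ → V) (ι : Type u) :
    PreservesColimitsOfShape (Discrete ι) (fcFunctor P) :=
  VGraph.preservesCoproducts_of_isColimit (fcFunctor P) (fun A =>
    VGraph.nonempty_isColimit_sigma (fun i => fcGraph P (A i)) (fcHom P (sigmaHom A)) (fcSigmaInj A P) (fcSigmaInj_isIso A P)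
      (fun x y h => fcHom_sigma_isInitial A P h)) ι

end FreeCoproducts

/-! ### Natural actions on the category of enriched categories -/

section ActionOnCategories

variable {C : Type (u + 1)} [Category.{u} C] [CartesianMonoidalCategory C]
  {V : Type (u + 1)} [Category.{u} V]

theorem isNaturalAction_fcAct [CartesianMonoidalCategory V] [CoprodDistrib V] (F : C ⥤ V)
    [PreservesProducts F] (P : Operad C) :
    IsNaturalAction (fcMonad (P.map F)) (PCat.forget P ⋙ VGraph.star F) (fun A => fcAct F A) where
  naturality f := fcAct_naturality F f
  unit A := fcAct_unit F A
  mul A := fcAct_mul F A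

variable {T : Monad V} {F : C ⥤ V} {τ : ∀ A : C, T.obj (F.obj A) ⟶ F.obj A}

variable (T F τ) in
/-- The action on a graph given by actions on its hom-objects. -/
def homAction (A : VGraph C) :
    (VGraph.starMonad T).obj ((VGraph.star F).obj A) ⟶ (VGraph.star F).obj A :=
  VGraph.Hom.mk (A := (VGraph.starMonad T).obj ((VGraph.star F).obj A))
    (B := (VGraph.star F).obj A) (fun a => a) (fun a b => τ (A.hom a b))

/-- A functor of enriched categories is given on hom-objects by morphisms of `C`, so naturality and
the action laws are inherited from each hom-object. -/
theorem IsNaturalAction.star (h : IsNaturalAction T F τ) (P : Operad C) :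
    IsNaturalAction (VGraph.starMonad T) (PCat.forget P ⋙ VGraph.star F)
      (fun A => homAction T F τ A.graph) where
  naturality {A B} f := VGraph.hom_mk_congr
    (A := (VGraph.starMonad T).obj ((VGraph.star F).obj A.graph))
    (B := (VGraph.star F).obj B.graph) fun a b => h.naturality (VGraph.Hom.hom f.1 a b)
  unit A := VGraph.hom_mk_congr (A := (VGraph.star F).obj A.graph)
    (B := (VGraph.star F).obj A.graph) fun a b => h.unit _
  mul A := VGraph.hom_mk_congr
    (A := (VGraph.starMonad T).obj ((VGraph.starMonad T).obj ((VGraph.star F).obj A.graph)))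
    (B := (VGraph.star F).obj A.graph) fun a b => h.mul _

end ActionOnCategories

/-! ### The distributive series of an iterative operadic theory -/

theorem Q_preservesCoproducts : {n : ℕ} → {S : Stage.{u} n} → (T : Theory n S) → (i : Fin n) →
    ∀ ι : Type u, PreservesColimitsOfShape (Discrete ι) (Q T i).toFunctor
  | _, _, @Theory.succ _ S _ P _, ⟨0, _⟩, ι =>
      fcFunctor_preservesCoproducts (P.map S.U).P ι
  | _, _, Theory.succ T _ _, ⟨i + 1, h⟩, ι =>
      have := Q_preservesCoproducts T ⟨i, Nat.lt_of_succ_lt_succ h⟩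
      VGraph.star_preservesCoproducts (Q T ⟨i, Nat.lt_of_succ_lt_succ h⟩).toFunctor ι

theorem isNaturalAction_act : {n : ℕ} → {S : Stage.{u} n} → (T : Theory n S) → (i : Fin n) →
    IsNaturalAction (Q T i) S.U (act T i)
  | _, _, @Theory.succ _ S _ P _, ⟨0, _⟩ => isNaturalAction_fcAct S.U P
  | _, _, @Theory.succ _ S T P _, ⟨i + 1, h⟩ =>
      (isNaturalAction_act T ⟨i, Nat.lt_of_succ_lt_succ h⟩).star P

/-! ### The inductive step -/

section Series

variable {n : ℕ} {S : Stage.{u} n} (T : Theory n S) (P : Operad S.C)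
  (hP : ∀ k, S.Contr (P.P k))

/-- The interchange law of `(i + 1)`-composition and `0`-composition. -/
def actInterchange (i : Fin n) :
    (fcMonad (P.map S.U)).toFunctor ⋙ (VGraph.starMonad (Q T i)).toFunctor ⟶
      (VGraph.starMonad (Q T i)).toFunctor ⋙ (fcMonad (P.map S.U)).toFunctor :=
  have := Q_preservesCoproducts T i
  paramInterchange (Q T i) (P.map S.U) (fun k => act T i (P.P k))

variable (law : ∀ i j : Fin n, j < i →
  ((Q T j).toFunctor ⋙ (Q T i).toFunctor ⟶ (Q T i).toFunctor ⋙ (Q T j).toFunctor))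

/-- Index `0` is the new outermost composition, and an old index `i` becomes `i + 1`. The case `i =
0` is vacuous. -/
def succLaw : ∀ i j : Fin (n + 1), j < i →
    ((Q (T.succ P hP) j).toFunctor ⋙ (Q (T.succ P hP) i).toFunctor ⟶
      (Q (T.succ P hP) i).toFunctor ⋙ (Q (T.succ P hP) j).toFunctor)
  | ⟨0, _⟩, j, h => absurd h (Nat.not_lt_zero _)
  | ⟨i + 1, hi⟩, ⟨0, _⟩, _ => actInterchange T P ⟨i, Nat.lt_of_succ_lt_succ hi⟩
  | ⟨i + 1, hi⟩, ⟨j + 1, hj⟩, h =>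
      starLaw (law ⟨i, Nat.lt_of_succ_lt_succ hi⟩ ⟨j, Nat.lt_of_succ_lt_succ hj⟩
        (Nat.lt_of_succ_lt_succ h))

variable {T} in
/-- The laws hold in all `n`-categories: the actions of `Q_i` and `Q_j` on an `n`-category form an
algebra for the composite monad. -/
def HoldsInCategories : Prop :=
  ∀ (i j : Fin n) (h : j < i) (A : S.C),
    (law i j h).app (S.U.obj A) ≫ (Q T j).map (act T i A) ≫ act T j A =
      (Q T i).map (act T j A) ≫ act T i A

variable {T law}

/-- For `j = 0` no inductive hypothesis is used: the interchange law holds because the composition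
maps are morphisms of `n`-categories. For `j > 0` the statement is the old one at every hom-object.
-/
theorem holdsInCategories_succLaw (hl : HoldsInCategories law) :
    HoldsInCategories (succLaw T P hP law)
  | ⟨0, _⟩, j, h, _ => absurd h (Nat.not_lt_zero _)
  | ⟨i + 1, hi⟩, ⟨0, _⟩, _, A =>
      have := Q_preservesCoproducts T ⟨i, Nat.lt_of_succ_lt_succ hi⟩
      (isNaturalAction_act T ⟨i, Nat.lt_of_succ_lt_succ hi⟩).fcAct_action A _ rfl
  | ⟨i + 1, hi⟩, ⟨j + 1, hj⟩, h, (A : PCat P) =>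
      VGraph.hom_mk_congr
        (A := (VGraph.starMonad (Q T ⟨i, Nat.lt_of_succ_lt_succ hi⟩)).obj
          ((VGraph.starMonad (Q T ⟨j, Nat.lt_of_succ_lt_succ hj⟩)).obj
            ((VGraph.star S.U).obj A.graph)))
        (B := (VGraph.star S.U).obj A.graph) fun a b =>
          hl ⟨i, Nat.lt_of_succ_lt_succ hi⟩ ⟨j, Nat.lt_of_succ_lt_succ hj⟩
            (Nat.lt_of_succ_lt_succ h) (A.graph.hom a b)

theorem isDistributiveLaw_succLaw
    (hl : ∀ (i j : Fin n) (h : j < i), IsDistributiveLaw (Q T i) (Q T j) (law i j h)) :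
    ∀ (i j : Fin (n + 1)) (h : j < i),
      IsDistributiveLaw (Q (T.succ P hP) i) (Q (T.succ P hP) j) (succLaw T P hP law i j h)
  | ⟨0, _⟩, j, h => absurd h (Nat.not_lt_zero _)
  | ⟨i + 1, hi⟩, ⟨0, _⟩, _ =>
      have := Q_preservesCoproducts T ⟨i, Nat.lt_of_succ_lt_succ hi⟩
      isDistributiveLaw_paramInterchange _
        ((isNaturalAction_act T ⟨i, Nat.lt_of_succ_lt_succ hi⟩).isAlgebraOperad P)
  | ⟨i + 1, hi⟩, ⟨j + 1, hj⟩, h =>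
      isDistributiveLaw_starLaw (hl ⟨i, Nat.lt_of_succ_lt_succ hi⟩
        ⟨j, Nat.lt_of_succ_lt_succ hj⟩ (Nat.lt_of_succ_lt_succ h))

theorem isInterchange_succLaw
    (hl : ∀ (i j : Fin n) (h : j < i), IsInterchange T i j (law i j h)) :
    ∀ (i j : Fin (n + 1)) (h : j < i),
      IsInterchange (T.succ P hP) i j (succLaw T P hP law i j h)
  | ⟨0, _⟩, j, h => absurd h (Nat.not_lt_zero _)
  | ⟨i + 1, hi⟩, ⟨0, _⟩, _ =>
      have := Q_preservesCoproducts T ⟨i, Nat.lt_of_succ_lt_succ hi⟩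
      isParamInterchange_paramInterchange _
        ((isNaturalAction_act T ⟨i, Nat.lt_of_succ_lt_succ hi⟩).isAlgebraOperad P)
  | ⟨i + 1, hi⟩, ⟨j + 1, hj⟩, h =>
      ⟨_, hl ⟨i, Nat.lt_of_succ_lt_succ hi⟩ ⟨j, Nat.lt_of_succ_lt_succ hj⟩
        (Nat.lt_of_succ_lt_succ h), fun _ => rfl⟩

/-- When the smallest index is positive, the equation is the old one at each hom-object. When it is
`0`, two of the three laws are interchange laws with parameters in `P`, and validity of the third in
`n`-categories is what makes their labels agree. -/
theorem yangBaxter_succLaw (hc : HoldsInCategories law)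
    (hl : ∀ (i j k : Fin n) (hij : j < i) (hjk : k < j) (X : (NGph.{u} n).C),
      (law i j hij).app ((Q T k).obj X) ≫ (Q T j).map ((law i k (hjk.trans hij)).app X) ≫
          (law j k hjk).app ((Q T i).obj X) =
        (Q T i).map ((law j k hjk).app X) ≫ (law i k (hjk.trans hij)).app ((Q T j).obj X) ≫
          (Q T k).map ((law i j hij).app X)) :
    ∀ (i j k : Fin (n + 1)) (hij : j < i) (hjk : k < j) (X : (NGph.{u} (n + 1)).C),
      (succLaw T P hP law i j hij).app ((Q (T.succ P hP) k).obj X) ≫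
          (Q (T.succ P hP) j).map ((succLaw T P hP law i k (hjk.trans hij)).app X) ≫
          (succLaw T P hP law j k hjk).app ((Q (T.succ P hP) i).obj X) =
        (Q (T.succ P hP) i).map ((succLaw T P hP law j k hjk).app X) ≫
          (succLaw T P hP law i k (hjk.trans hij)).app ((Q (T.succ P hP) j).obj X) ≫
          (Q (T.succ P hP) k).map ((succLaw T P hP law i j hij).app X)
  | ⟨0, _⟩, _, _, hij, _, _ => absurd hij (Nat.not_lt_zero _)
  | ⟨_ + 1, _⟩, ⟨0, _⟩, _, _, hjk, _ => absurd hjk (Nat.not_lt_zero _)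
  | ⟨i + 1, hi⟩, ⟨j + 1, hj⟩, ⟨0, _⟩, hij, _, (X : VGraph (NGph.{u} n).C) =>
      have := Q_preservesCoproducts T ⟨i, Nat.lt_of_succ_lt_succ hi⟩
      have := Q_preservesCoproducts T ⟨j, Nat.lt_of_succ_lt_succ hj⟩
      VGraph.hom_mk_congr
        (A := (VGraph.starMonad (Q T ⟨i, Nat.lt_of_succ_lt_succ hi⟩)).obj
          ((VGraph.starMonad (Q T ⟨j, Nat.lt_of_succ_lt_succ hj⟩)).obj
            ((fcMonad (P.map S.U)).obj X)))
        (B := (fcMonad (P.map S.U)).obj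
          ((VGraph.starMonad (Q T ⟨j, Nat.lt_of_succ_lt_succ hj⟩)).obj
            ((VGraph.starMonad (Q T ⟨i, Nat.lt_of_succ_lt_succ hi⟩)).obj X))) fun a b =>
        yangBaxter_paramInterchange (O := P.map S.U) (Q T ⟨j, Nat.lt_of_succ_lt_succ hj⟩)
          (Q T ⟨i, Nat.lt_of_succ_lt_succ hi⟩)
          (law ⟨i, Nat.lt_of_succ_lt_succ hi⟩ ⟨j, Nat.lt_of_succ_lt_succ hj⟩
            (Nat.lt_of_succ_lt_succ hij))
          (fun k => act T ⟨i, Nat.lt_of_succ_lt_succ hi⟩ (P.P k))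
          -- The objects of the operad are themselves `n`-categories, so the law holds in them; this
          -- is the compatibility of the two actions on labels.
          (fun k => hc ⟨i, Nat.lt_of_succ_lt_succ hi⟩ ⟨j, Nat.lt_of_succ_lt_succ hj⟩
            (Nat.lt_of_succ_lt_succ hij) (P.P k)) X.hom a b
  | ⟨i + 1, hi⟩, ⟨j + 1, hj⟩, ⟨k + 1, hk⟩, hij, hjk, (X : VGraph (NGph.{u} n).C) =>
      VGraph.hom_mk_congr
        (A := (VGraph.starMonad (Q T ⟨i, Nat.lt_of_succ_lt_succ hi⟩)).obj
          ((VGraph.starMonad (Q T ⟨j, Nat.lt_of_succ_lt_succ hj⟩)).obj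
            ((VGraph.starMonad (Q T ⟨k, Nat.lt_of_succ_lt_succ hk⟩)).obj X)))
        (B := (VGraph.starMonad (Q T ⟨k, Nat.lt_of_succ_lt_succ hk⟩)).obj
          ((VGraph.starMonad (Q T ⟨j, Nat.lt_of_succ_lt_succ hj⟩)).obj
            ((VGraph.starMonad (Q T ⟨i, Nat.lt_of_succ_lt_succ hi⟩)).obj X))) fun a b =>
        hl ⟨i, Nat.lt_of_succ_lt_succ hi⟩ ⟨j, Nat.lt_of_succ_lt_succ hj⟩
          ⟨k, Nat.lt_of_succ_lt_succ hk⟩ (Nat.lt_of_succ_lt_succ hij)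
          (Nat.lt_of_succ_lt_succ hjk) (X.hom a b)

end Series

/-- The interchange laws form a distributive series, and they hold in all `n`-categories. -/
theorem exists_distributiveSeries {n : ℕ} {S : Stage.{u} n} (T : Theory n S) :
    ∃ D : DistributiveSeries (Q T), HoldsInCategories D.law ∧
      ∀ (i j : Fin n) (h : j < i), IsInterchange T i j (D.law i j h) := by
  -- Validity in `n`-categories must accompany the series: the Yang–Baxter equation one dimension
  -- higher needs it for the objects of the next operad.
  induction T with
  | zero =>
      exact ⟨{ law := fun i => i.elim0
               isDistributiveLaw := fun i => i.elim0
               yangBaxter := fun i => i.elim0 }, fun i => i.elim0, fun i => i.elim0⟩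
  | succ T P hP ih =>
      obtain ⟨D, hD, hD'⟩ := ih
      exact ⟨{ law := succLaw T P hP D.law
               isDistributiveLaw := isDistributiveLaw_succLaw P hP D.isDistributiveLaw
               yangBaxter := yangBaxter_succLaw P hP hD D.yangBaxter },
        holdsInCategories_succLaw P hP hD, isInterchange_succLaw P hP hD'⟩

end IterOp

end

theorem mainTheorem9 (n : ℕ) (hn : 3 ≤ n) {S : IterOp.Stage.{u} n} (T : IterOp.Theory n S) :
    ∃ D : IterOp.DistributiveSeries (IterOp.Q T),
      ∀ (i j : Fin n) (h : j < i), IterOp.IsInterchange T i j (D.law i j h) := by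
  obtain ⟨D, -, hD⟩ := IterOp.exists_distributiveSeries T
  exact ⟨D, hD⟩
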